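/- For $\operatorname{Im}\tau>0$ let $\theta_k(z|\tau)$, $k=1,2,3,4$, be Jacobi's theta functions $$\theta{\alpha\brack\beta}(z|\tau)=\sum_{k\in\mathbb Z}e^{\pi i(k+\frac\alpha2)^2\tau+2\pi i(k+\frac\alpha2)(z+\frac\beta2)},\qquad \theta_1=-\theta{1\brack1},\ \theta_2=\theta{1\brack0},\ \theta_3=\theta{0\brack0},\ \theta_4=\theta{0\brack1},$$ and $\vartheta_k(\tau)=\theta_k(0|\tau)$. Put $$z(\tau)=2+3\,\frac{\vartheta_4^2(\tau)}{\vartheta_3^2(\tau)}\frac{\theta_1^2(\frac16|\tau)}{\theta_2^2(\frac16|\tau)}-\frac{\vartheta_2^2(\tau)}{\vartheta_3^2(\tau)}\frac{\theta_1^2(\frac16|\tau)}{\theta_4^2(\frac16|\tau)} .$$ **Theorem.** (1) All denominators here and below are non-zero in the upper half plane $\mathbb H^+$, and $$s(\tau):=9\,\frac{\vartheta_3^4(3\tau)}{\vartheta_3^4(\tau)}=z(\tau)^2=\frac{\theta_1^4(\frac13|\tau)\,\theta_3^4(\frac13|\tau)}{\theta_2^4(\frac13|\tau)\,\theta_4^4(\frac13|\tau)}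 .$$ (2) The function $s(\tau)$ solves the inversion problem for the Heun equation with singularities $0,1,9,\infty$ $$\Psi''=-\frac14\left(\frac1{s^2}+\frac1{(s-1)^2}+\frac1{(s-9)^2}-\frac{2s-8}{s(s-1)(s-9)}\right)\Psi .$$ That is, let $k(s)=\frac14\sqrt{(s-6)\sqrt s-\frac3{\sqrt s}+8}$, $K(k)=\frac\pi2\,{}_2F_1(\frac12,\frac12;1|k^2)$, $K'(k)=\frac\pi2\,{}_2F_1(\frac12,\frac12;1|1-k^2)$. The functions $\Psi_1=\sqrt[4]{s(s-1)^2(s-9)^2}\,K(k(s))$ and $\Psi_2=\sqrt[4]{s(s-1)^2(s-9)^2}\,K'(k(s))$ (principal branches near the interval $1<s<9$) are solutions of the equation. From any base point $s_0\in(1,9)$ they continue analytically, as solutions, along every path in $\mathbb C\setminus\{0,1,9\}$. For every resulting branch, near the end of the path, $\Psi_2\neq0$, the number $\tau=i\,\Psi_1(s)/\Psi_2(s)$ lies in $\mathbb H^+$, and $s(\tau)=s$. Every $\tau\in\mathbb H^+$ arises as such a value at the point $s(\tau)$. (3) Let $G_s\subset SL_2(\mathbb R)$ be the group generated by $$T_{(0)}=\begin{pmatrix}4&-1\\9&-2\end{pmatrix},\qquad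 T_{(\infty)}=\begin{pmatrix}4&-3\\3&-2\end{pmatrix},\qquad T_{(9)}=\begin{pmatrix}1&-2\\0&1\end{pmatrix}.$$ Up to sign, $G_s$ is the monodromy group of the Heun equation with respect to the column $(i\Psi_1,\Psi_2)^{\top}$ at any base point $s_0\in(1,9)$: continuation along any loop in $\mathbb C\setminus\{0,1,9\}$ multiplies the column by $\pm g$ with $g\in G_s$, and every $g\in G_s$ occurs in this way. There are simple clockwise loops on the sphere around $s=0,\infty,9$ alone whose monodromy matrices are $-T_{(0)},-T_{(\infty)},-T_{(9)}$, and one around $s=1$ alone with matrix $-T_{(1)}^{-1}$, where $T_{(1)}=\begin{pmatrix}1&0\\-6&1\end{pmatrix}$. (4) $G_s$ is the automorphism group of $s(\tau)$: for $g\in SL_2(\mathbb R)$, $s(g\tau)=s(\tau)$ for all $\tau\in\mathbb H^+$ if and only if $g\in G_s$ or $-g\in G_s$. (5) $T_{(0)},T_{(\infty)},T_{(9)}$ are parabolic with fixed points $\tau=\frac13,1,\infty$, and $s(\tau)$ has at these cusps (as limits along horoball neighbourhoods) the values $0,\infty,9$. The fourth point $s=1$ is the value at the cusps $0,\frac12,2$,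 which form the cycle $$0\overset{T_{(0)}}\mapsto\tfrac12\overset{T_{(\infty)}}\mapsto2\overset{T_{(9)}}\mapsto0 ,$$ and $T_{(9)}T_{(\infty)}T_{(0)}=T_{(1)}$, which is parabolic with fixed point $0$. -/

import Mathlib

open Filter Topology UpperHalfPlane
open scoped MatrixGroups

noncomputable section

/-- Jacobi's theta function with characteristics `[α, β]`,
`∑ₖ exp (π i (k + α/2)² τ + 2 π i (k + α/2) (z + β/2))`. -/
def thetaChar (α β : ℤ) (z τ : ℂ) : ℂ :=
  ∑' k : ℤ, Complex.exp (Real.pi * Complex.I * ((k : ℂ) + α / 2) ^ 2 * τ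
    + 2 * Real.pi * Complex.I * ((k : ℂ) + α / 2) * (z + β / 2))

def theta1 (z τ : ℂ) : ℂ := -thetaChar 1 1 z τ
def theta2 (z τ : ℂ) : ℂ := thetaChar 1 0 z τ
def theta3 (z τ : ℂ) : ℂ := thetaChar 0 0 z τ
def theta4 (z τ : ℂ) : ℂ := thetaChar 0 1 z τ

/-- The function `z(τ) = 2 + 3 (ϑ₄²/ϑ₃²)(θ₁²/θ₂²) - (ϑ₂²/ϑ₃²)(θ₁²/θ₄²)`, where `ϑₖ = θₖ(0|τ)` and
`θₖ = θₖ(1/6|τ)`. -/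
def hauptZ (τ : ℂ) : ℂ :=
  2 + 3 * (theta4 0 τ ^ 2 / theta3 0 τ ^ 2) * (theta1 (1 / 6) τ ^ 2 / theta2 (1 / 6) τ ^ 2)
    - theta2 0 τ ^ 2 / theta3 0 τ ^ 2 * (theta1 (1 / 6) τ ^ 2 / theta4 (1 / 6) τ ^ 2)

/-- The function `s(τ) = 9 ϑ₃⁴(3τ) / ϑ₃⁴(τ)`. -/
def hauptS (τ : ℂ) : ℂ := 9 * theta3 0 (3 * τ) ^ 4 / theta3 0 τ ^ 4

/-- The coefficient of the Heun equation `Ψ'' = heunCoeff · Ψ`. -/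
def heunCoeff (s : ℂ) : ℂ :=
  -(1 / 4) * (1 / s ^ 2 + 1 / (s - 1) ^ 2 + 1 / (s - 9) ^ 2
    - (2 * s - 8) / (s * (s - 1) * (s - 9)))

/-- `f` is a holomorphic solution of the Heun equation in a neighbourhood of `w`. -/
def IsHeunSolutionAt (f : ℂ → ℂ) (w : ℂ) : Prop :=
  AnalyticAt ℂ f w ∧ ∀ᶠ s in 𝓝 w, deriv (deriv f) s = heunCoeff s * f s

/-- The complete elliptic integral `K(k) = (π/2) ₂F₁(1/2, 1/2; 1 | k²)` (used for `|k²| < 1`). -/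
def ellipticK (k : ℂ) : ℂ := Real.pi / 2 * ordinaryHypergeometric (1 / 2 : ℂ) (1 / 2) 1 (k ^ 2)

/-- The complementary integral `K'(k) = (π/2) ₂F₁(1/2, 1/2; 1 | 1 - k²)` (used for
`|1 - k²| < 1`). -/
def ellipticK' (k : ℂ) : ℂ :=
  Real.pi / 2 * ordinaryHypergeometric (1 / 2 : ℂ) (1 / 2) 1 (1 - k ^ 2)

/-- The modulus `(1/4) √((s - 6) √s - 3/√s + 8)`, with principal roots (used near `1 < s < 9`,
where its square lies near the interval `(0, 1)`). -/
def heunModulus (s : ℂ) : ℂ :=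
  1 / 4 * ((s - 6) * s ^ (1 / 2 : ℂ) - 3 / s ^ (1 / 2 : ℂ) + 8) ^ (1 / 2 : ℂ)

/-- The pair `(i Ψ₁, Ψ₂)` with `Ψ₁ = (s (s-1)² (s-9)²)^(1/4) K` and
`Ψ₂ = (s (s-1)² (s-9)²)^(1/4) K'`, principal branches (used near `1 < s < 9`). -/
def heunBasis (s : ℂ) : Fin 2 → ℂ :=
  ![Complex.I * ((s * (s - 1) ^ 2 * (s - 9) ^ 2) ^ (1 / 4 : ℂ) * ellipticK (heunModulus s)),
    (s * (s - 1) ^ 2 * (s - 9) ^ 2) ^ (1 / 4 : ℂ) * ellipticK' (heunModulus s)]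

/-- The complex plane without the finite singularities of the Heun equation. -/
def heunDomain : Set ℂ := {0, 1, 9}ᶜ

/-- `F t` is, for every `t`, a holomorphic germ at `γ t`, and the germs are obtained from one
another by analytic continuation along `γ`. -/
def IsAnalyticContinuation {a b : ℂ} (γ : Path a b) (F : unitInterval → ℂ → Fin 2 → ℂ) : Prop :=
  (∀ t, AnalyticAt ℂ (F t) (γ t)) ∧ ∀ t, ∀ᶠ t' in 𝓝 t, F t' =ᶠ[𝓝 (γ t')] F t

/-- `F` is the analytic continuation of the pair `heunBasis` along `γ`. -/
def ContinuesBasis {a b : ℂ} (γ : Path a b) (F : unitInterval → ℂ → Fin 2 → ℂ) : Prop :=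
  IsAnalyticContinuation γ F ∧ F 0 =ᶠ[𝓝 a] heunBasis

/-- Analytic continuation along the loop `γ` replaces the column `heunBasis` by `M * heunBasis`. -/
def HasMonodromy {a : ℂ} (γ : Path a a) (M : SL(2, ℝ)) : Prop :=
  ∃ F, ContinuesBasis γ F ∧
    F 1 =ᶠ[𝓝 a] fun s => ((M : Matrix (Fin 2) (Fin 2) ℝ).map Complex.ofReal).mulVec (heunBasis s)

/-- The circle with centre `c` through `c + z`, run through `n` times counterclockwise. -/
def circlePath (c z : ℂ) (n : ℤ) : Path (c + z) (c + z) where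
  toFun t := c + z * Complex.exp (n * (2 * Real.pi * Complex.I) * (t : ℝ))
  continuous_toFun := by fun_prop
  source' := by simp
  target' := by simp [Complex.exp_int_mul_two_pi_mul_I]

/-- `γ` runs in `heunDomain` from its base point to `c + z`, `n` times around the circle with
centre `c`, and back by the same way. -/
def IsLasso {a : ℂ} (γ : Path a a) (c z : ℂ) (n : ℤ) : Prop :=
  ∃ δ : Path a (c + z), (∀ t, δ t ∈ heunDomain) ∧ γ = (δ.trans (circlePath c z n)).trans δ.symm

/-- `γ` is a simple clockwise loop, on the Riemann sphere, around the singularity `e` alone. For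
`e = ∞` this is a counterclockwise circle that encloses `0`, `1` and `9`. -/
def IsClockwiseLoopAround {a : ℂ} (γ : Path a a) : OnePoint ℂ → Prop
  | none => ∃ z : ℂ, 9 < ‖z‖ ∧ IsLasso γ 0 z 1
  | some e => ∃ z : ℂ, 0 < ‖z‖ ∧ ‖z‖ < 1 ∧ IsLasso γ e z (-1)

/-- Horoball neighbourhoods in the upper half plane of a point of `ℝ ∪ {∞}`. -/
def cuspFilter : OnePoint ℝ → Filter ℍ
  | none => comap (fun τ : ℍ => τ.im) atTop
  | some c => comap (fun τ : ℍ => τ.im / ‖(τ : ℂ) - c‖ ^ 2) atTop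

/-- The function `s` has the value `e` at the cusp `c`. -/
def HasCuspValue (c : OnePoint ℝ) (e : OnePoint ℂ) : Prop :=
  Tendsto (fun τ : ℍ => (hauptS τ : OnePoint ℂ)) (cuspFilter c) (𝓝 e)

def T0 : SL(2, ℝ) := ⟨!![4, -1; 9, -2], by norm_num [Matrix.det_fin_two]⟩
def Tinf : SL(2, ℝ) := ⟨!![4, -3; 3, -2], by norm_num [Matrix.det_fin_two]⟩
def T9 : SL(2, ℝ) := ⟨!![1, -2; 0, 1], by norm_num [Matrix.det_fin_two]⟩
def T1 : SL(2, ℝ) := ⟨!![1, 0; -6, 1], by norm_num [Matrix.det_fin_two]⟩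

/-- The group generated by the three matrices. -/
def heunGroup : Subgroup SL(2, ℝ) := Subgroup.closure {T0, Tinf, T9}

/-- The linear fractional action of `SL(2, ℝ)` on `ℝ ∪ {∞}`. -/
def cuspAct (g : SL(2, ℝ)) (c : OnePoint ℝ) : OnePoint ℝ := (g : GL (Fin 2) ℝ) • c

/-- `g` is parabolic and `c` is its fixed point. -/
def IsParabolicFixing (g : SL(2, ℝ)) (c : OnePoint ℝ) : Prop :=
  (g : Matrix (Fin 2) (Fin 2) ℝ).IsParabolic ∧ cuspAct g c = c

end

/-! The function s is a covering map from the upper half plane onto ℂ∖{0,1,9}, and its fibres are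
the orbits of G_s. Pulled back along it, the column (iΨ₁, Ψ₂) becomes (τD, D) with D² = 6πi s′. Its
quotient is therefore τ, and its monodromy is the action of G_s on τ, up to the sign of the square
root D.

Theta identities. The triple product (`jacobiTheta₂_eq_prod`) shows that theta constants have no
zeros. Multiplying its factors over the cube roots of unity links the arguments 1/3 and 1/6 at τ
with theta constants at 3τ. The remaining identities rest on one principle (`eq_value_of_regular`):
a holomorphic function invariant under G_s and bounded at the cusps ∞, 0, 1, 1/3 is a constant, read
off at ∞. Applied to the quotients P = `cubP` and Q = `cubQ`, it gives (P−Q)² = s and 16PQ = (s−1)².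
With z = 3ϑ₃²(3τ)/ϑ₃²(τ) (`multZ`) this becomes P = (z+1)²/4, Q = (z−1)²/4. Hence ϑ₂⁴/ϑ₃⁴ =
(z+1)³(3−z)/(16z), and z omits 0, ±1, ±3. The same principle yields s′² = −(π²/576) s(s−1)²(s−9)²ϑ₃⁸
(`deriv_hauptS_sq`), so s is locally biholomorphic.

Solutions. The function F = ₂F₁(1/2,1/2;1) obeys a cubic transformation (`hypF_cubic`) that matches
τ ↦ 3τ. The ratio F(ϑ₂⁴/ϑ₃⁴)/ϑ₃² on the imaginary axis is therefore unchanged by y ↦ 3y and tends to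
1, so it equals 1 (`hypF_thetaX`). Together with the formula for s′², this identifies (iΨ₁, Ψ₂) at
s(τ) with (τD, D), first on the axis and then near it. The Heun equation is verified directly near
(1,9); the identity theorem transports it, in the coordinate τ, to the whole half plane
(`heunOp_pairPhi`).

Covering. Over a compact subset of ℂ∖{0,1,9} the values at the cusps are avoided, so modulo G_s the
preimage is compact and local sections have a uniform radius (`exists_uniform_section`). Paths then
lift. Near s = 9 only the cusp ∞ contributes and fibres are visibly orbits; lifting paths spreads
this to all s (`exists_smul_eq`). Continuation along a path is now motion of the lifted point τ.
This gives the inversion, the monodromy up to sign, and the automorphism group.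

Local loops. A small clockwise circle around a singular value lifts to a translation by the width of
a cusp, that is, to the action of its generator. Because s′ has odd order in the local parameter
there, D changes sign under that translation relative to its automorphy factor. This is the source
of the minus signs in part (3). -/

noncomputable section

/-! ### Jacobi's triple product -/

/-- The finite product `∏ (1 - Q ^ (i + 1))`, `i < n`. -/
def qPoch (Q : ℂ) (n : ℕ) : ℂ := ∏ i ∈ Finset.range n, (1 - Q ^ (i + 1))

/-- The reciprocal of `qPoch`, extended by zero to negative indices. -/
def qPochInv (Q : ℂ) (n : ℤ) : ℂ := if 0 ≤ n then (qPoch Q n.toNat)⁻¹ else 0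

/-- Euler's product `∏ (1 - Q ^ (n + 1))`. -/
def eulerProd (Q : ℂ) : ℂ := ∏' n : ℕ, (1 - Q ^ (n + 1))

/-- The product `∏ (1 + w q ^ (2 n + 1))`. -/
def oddProd (q w : ℂ) : ℂ := ∏' n : ℕ, (1 + w * q ^ (2 * n + 1))

/-- The product `∏ (1 + w Q ^ (n + 1))`. -/
def plusProd (Q w : ℂ) : ℂ := ∏' n : ℕ, (1 + w * Q ^ (n + 1))

lemma one_sub_pow_ne_zero {Q : ℂ} (hQ : ‖Q‖ < 1) (n : ℕ) : 1 - Q ^ (n + 1) ≠ 0 := by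
  intro h
  have h1 : ‖Q ^ (n + 1)‖ < 1 := by
    rw [norm_pow]; exact pow_lt_one₀ (norm_nonneg _) hQ (Nat.succ_ne_zero n)
  rw [← sub_eq_zero.mp h] at h1
  simp at h1

lemma summable_norm_mul_pow_succ {Q : ℂ} (hQ : ‖Q‖ < 1) (w : ℂ) :
    Summable fun n : ℕ => ‖w * Q ^ (n + 1)‖ := by
  have := (summable_geometric_of_lt_one (norm_nonneg Q) hQ).mul_left (‖w‖ * ‖Q‖)
  refine this.congr fun n => ?_
  simp [pow_succ]; ring

lemma summable_norm_mul_pow_odd {q : ℂ} (hq : ‖q‖ < 1) (w : ℂ) :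
    Summable fun n : ℕ => ‖w * q ^ (2 * n + 1)‖ := by
  have h2 : ‖q ^ 2‖ < 1 := by
    rw [norm_pow]; exact pow_lt_one₀ (norm_nonneg _) hq two_ne_zero
  have := (summable_geometric_of_lt_one (norm_nonneg _) h2).mul_left (‖w‖ * ‖q‖)
  refine this.congr fun n => ?_
  simp [pow_succ, pow_mul]; ring

lemma multipliable_one_add_mul_pow {Q : ℂ} (hQ : ‖Q‖ < 1) (w : ℂ) :
    Multipliable fun n : ℕ => 1 + w * Q ^ (n + 1) :=
  multipliable_one_add_of_summable (summable_norm_mul_pow_succ hQ w)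

lemma multipliable_one_add_mul_pow_odd {q : ℂ} (hq : ‖q‖ < 1) (w : ℂ) :
    Multipliable fun n : ℕ => 1 + w * q ^ (2 * n + 1) :=
  multipliable_one_add_of_summable (summable_norm_mul_pow_odd hq w)

lemma eulerProd_eq_plusProd (Q : ℂ) : eulerProd Q = plusProd Q (-1) := by
  simp [eulerProd, plusProd, sub_eq_add_neg]

lemma plusProd_ne_zero {Q w : ℂ} (hQ : ‖Q‖ < 1) (h : ‖w‖ ≤ 1) : plusProd Q w ≠ 0 := by
  refine tprod_one_add_ne_zero_of_summable (fun n h0 => ?_) (summable_norm_mul_pow_succ hQ w)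
  have h1 : ‖w * Q ^ (n + 1)‖ < 1 := by
    rw [norm_mul, norm_pow]
    calc _ ≤ 1 * ‖Q‖ ^ (n + 1) := by gcongr
      _ < 1 := by rw [one_mul]; exact pow_lt_one₀ (norm_nonneg _) hQ (Nat.succ_ne_zero n)
  rw [eq_neg_of_add_eq_zero_right h0] at h1
  simp at h1

lemma oddProd_ne_zero {q w : ℂ} (hq : ‖q‖ < 1) (h : ‖w‖ ≤ 1) : oddProd q w ≠ 0 := by
  refine tprod_one_add_ne_zero_of_summable (fun n h0 => ?_) (summable_norm_mul_pow_odd hq w)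
  have h1 : ‖w * q ^ (2 * n + 1)‖ < 1 := by
    rw [norm_mul, norm_pow]
    calc _ ≤ 1 * ‖q‖ ^ (2 * n + 1) := by gcongr
      _ < 1 := by rw [one_mul]; exact pow_lt_one₀ (norm_nonneg _) hq (Nat.succ_ne_zero _)
  rw [eq_neg_of_add_eq_zero_right h0] at h1
  simp at h1

lemma eulerProd_ne_zero {Q : ℂ} (hQ : ‖Q‖ < 1) : eulerProd Q ≠ 0 := by
  rw [eulerProd_eq_plusProd]; exact plusProd_ne_zero hQ (by simp)

lemma qPoch_ne_zero {Q : ℂ} (hQ : ‖Q‖ < 1) (n : ℕ) : qPoch Q n ≠ 0 :=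
  Finset.prod_ne_zero_iff.mpr fun i _ => one_sub_pow_ne_zero hQ i

lemma tendsto_qPoch {Q : ℂ} (hQ : ‖Q‖ < 1) :
    Tendsto (qPoch Q) atTop (𝓝 (eulerProd Q)) := by
  have := (multipliable_one_add_mul_pow hQ (-1)).tendsto_prod_tprod_nat
  have e : qPoch Q = fun n => ∏ i ∈ Finset.range n, (1 + -Q ^ (i + 1)) := by
    funext n; simp [qPoch, sub_eq_add_neg]
  rw [e]
  simpa [eulerProd, sub_eq_add_neg] using this

/-- The extension by zero is consistent with the recursion: at n = −1 the factor 1 − Q⁰ vanishes.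
One formula thus serves all integers, and sums over all of ℤ need no boundary cases. -/
lemma qPochInv_rec {Q : ℂ} (hQ : ‖Q‖ < 1) (n : ℤ) :
    qPochInv Q n = (1 - Q ^ (n + 1)) * qPochInv Q (n + 1) := by
  rcases lt_trichotomy n (-1) with h | h | h
  · rw [qPochInv, qPochInv, if_neg (by lia), if_neg (by lia), mul_zero]
  · subst h; simp [qPochInv]
  · obtain ⟨m, rfl⟩ : ∃ m : ℕ, n = m := ⟨n.toNat, by lia⟩
    have e : ((m : ℤ) + 1).toNat = m + 1 := by lia
    rw [qPochInv, qPochInv, if_pos (by lia), if_pos (by lia), e]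
    have h1 := one_sub_pow_ne_zero hQ m
    have h2 := qPoch_ne_zero hQ m
    simp only [Int.toNat_natCast, qPoch, Finset.prod_range_succ] at *
    have : Q ^ ((m : ℤ) + 1) = Q ^ (m + 1) := by norm_cast
    rw [this]; field_simp

/-- The coefficient of `w ^ k` in the `N`-th partial triple product. -/
def tripleCoeff (q : ℂ) (N : ℕ) (k : ℤ) : ℂ :=
  qPoch (q ^ 2) (2 * N) * qPochInv (q ^ 2) (N - k) * qPochInv (q ^ 2) (N + k)

lemma norm_sq_lt_one {q : ℂ} (hq : ‖q‖ < 1) : ‖q ^ 2‖ < 1 := by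
  rw [norm_pow]; exact pow_lt_one₀ (norm_nonneg _) hq two_ne_zero

/-- `tripleCoeff` is the Gaussian binomial coefficient "2N over N + k" in base q². This is the
double Pascal rule that comes from multiplying by two further factors of the product. -/
lemma tripleCoeff_succ {q : ℂ} (hq : ‖q‖ < 1) (h0 : q ≠ 0) (N : ℕ) (k : ℤ) :
    tripleCoeff q (N + 1) k = tripleCoeff q N k * (1 + (q ^ 2) ^ (2 * N + 1))
      + tripleCoeff q N (k - 1) * (q ^ 2) ^ (N + 1 - k)
      + tripleCoeff q N (k + 1) * (q ^ 2) ^ (N + 1 + k) := by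
  have hQ := norm_sq_lt_one hq
  have hQ0 : q ^ 2 ≠ 0 := pow_ne_zero 2 h0
  simp only [tripleCoeff]
  generalize q ^ 2 = Q at *
  have a1 := qPochInv_rec hQ (N - k)
  have a2 := qPochInv_rec hQ (N + k)
  have a3 := qPochInv_rec hQ (N - k - 1)
  have a4 := qPochInv_rec hQ (N + k - 1)
  have e0 : 2 * (N + 1) = 2 * N + 1 + 1 := by ring
  rw [e0, qPoch, Finset.prod_range_succ, Finset.prod_range_succ, ← qPoch]
  push_cast
  rw [show (N : ℤ) - (k - 1) = N - k + 1 by ring, show (N : ℤ) + (k - 1) = N + k - 1 by ring,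
    show (N : ℤ) - (k + 1) = N - k - 1 by ring, show (N : ℤ) + (k + 1) = N + k + 1 by ring,
    show (N : ℤ) + 1 - k = N - k + 1 by ring, show (N : ℤ) + 1 + k = N + k + 1 by ring, a3, a4]
  rw [sub_add_cancel, sub_add_cancel, a1, a2]
  generalize qPochInv Q (N - k + 1) = A
  generalize qPochInv Q (N + k + 1) = B
  have e1 : Q ^ (2 * N + 1 + 1) = Q ^ ((N : ℤ) - k + 1) * Q ^ ((N : ℤ) + k + 1) := by
    rw [← zpow_add₀ hQ0, ← zpow_natCast]; congr 1; push_cast; ring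
  have e2 : Q ^ (2 * N + 1) = Q ^ ((N : ℤ) - k) * Q ^ ((N : ℤ) + k) * Q := by
    rw [← zpow_add₀ hQ0, ← zpow_natCast, ← zpow_add_one₀ hQ0]; congr 1; push_cast; ring
  rw [e1, e2, zpow_add_one₀ hQ0, zpow_add_one₀ hQ0]
  ring

/-- The finite triple product, that is, the q-binomial theorem in symmetric form. In the induction
the terms w and w⁻¹ of the new factors shift the summation index by one in either direction. -/
lemma hasSum_tripleCoeff {q w : ℂ} (hq : ‖q‖ < 1) (h0 : q ≠ 0) (hw : w ≠ 0) (N : ℕ) :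
    HasSum (fun k : ℤ => tripleCoeff q N k * (q ^ (k ^ 2) * w ^ k))
      (∏ n ∈ Finset.range N, ((1 + w * q ^ (2 * n + 1)) * (1 + w⁻¹ * q ^ (2 * n + 1)))) := by
  induction N with
  | zero =>
    have key : (fun k : ℤ => tripleCoeff q 0 k * (q ^ (k ^ 2) * w ^ k)) =
        fun k => if k = 0 then 1 else 0 := by
      funext k
      split_ifs with h
      · subst h; simp [tripleCoeff, qPochInv, qPoch]
      · have : ¬ (0 ≤ -k ∧ 0 ≤ k) := by lia
        rcases not_and_or.mp this with h' | h'
        · have : qPochInv (q ^ 2) (-k) = 0 := if_neg h'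
          simp [tripleCoeff, this]
        · simp [tripleCoeff, qPochInv, h']
    rw [key]
    simpa using hasSum_ite_eq (0 : ℤ) (1 : ℂ)
  | succ N ih =>
    have i1 := (Equiv.subRight (1 : ℤ)).hasSum_iff.mpr ih
    have i2 := (Equiv.addRight (1 : ℤ)).hasSum_iff.mpr ih
    have := ((ih.mul_left (1 + (q ^ 2) ^ (2 * N + 1))).add
      (i1.mul_left (w * q ^ (2 * N + 1)))).add (i2.mul_left (w⁻¹ * q ^ (2 * N + 1)))
    rw [Finset.prod_range_succ]
    have key : (fun k : ℤ => tripleCoeff q (N + 1) k * (q ^ (k ^ 2) * w ^ k)) = fun k : ℤ =>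
        (1 + (q ^ 2) ^ (2 * N + 1)) * (tripleCoeff q N k * (q ^ (k ^ 2) * w ^ k))
        + w * q ^ (2 * N + 1) * (tripleCoeff q N (k - 1) * (q ^ ((k - 1) ^ 2) * w ^ (k - 1)))
        + w⁻¹ * q ^ (2 * N + 1) * (tripleCoeff q N (k + 1) * (q ^ ((k + 1) ^ 2) * w ^ (k + 1))) := by
      funext k
      rw [tripleCoeff_succ hq h0]
      have e1 : q ^ (2 * N + 1) * q ^ ((k - 1) ^ 2) = (q ^ 2) ^ ((N : ℤ) + 1 - k) * q ^ (k ^ 2) := by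
        rw [← zpow_natCast, ← zpow_natCast, ← zpow_mul, ← zpow_add₀ h0, ← zpow_add₀ h0]
        congr 1; push_cast; ring
      have e2 : q ^ (2 * N + 1) * q ^ ((k + 1) ^ 2) = (q ^ 2) ^ ((N : ℤ) + 1 + k) * q ^ (k ^ 2) := by
        rw [← zpow_natCast, ← zpow_natCast, ← zpow_mul, ← zpow_add₀ h0, ← zpow_add₀ h0]
        congr 1; push_cast; ring
      have e3 : w ^ k = w * w ^ (k - 1) := by rw [← zpow_one_add₀ hw]; congr 1; ring
      have e4 : w ^ k = w⁻¹ * w ^ (k + 1) := by rw [zpow_add_one₀ hw]; field_simp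
      have f1 : w * q ^ (2 * N + 1) * (tripleCoeff q N (k - 1) * (q ^ ((k - 1) ^ 2) * w ^ (k - 1)))
          = tripleCoeff q N (k - 1) * (q ^ 2) ^ ((N : ℤ) + 1 - k) * (q ^ (k ^ 2) * w ^ k) := by
        rw [e3]
        linear_combination tripleCoeff q N (k - 1) * w * w ^ (k - 1) * e1
      have f2 : w⁻¹ * q ^ (2 * N + 1) * (tripleCoeff q N (k + 1) * (q ^ ((k + 1) ^ 2) * w ^ (k + 1)))
          = tripleCoeff q N (k + 1) * (q ^ 2) ^ ((N : ℤ) + 1 + k) * (q ^ (k ^ 2) * w ^ k) := by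
        rw [e4]
        linear_combination tripleCoeff q N (k + 1) * w⁻¹ * w ^ (k + 1) * e2
      rw [f1, f2]; ring
    rw [key]
    refine (congrArg (HasSum _) ?_).mpr this
    have : w * w⁻¹ = 1 := mul_inv_cancel₀ hw
    rw [← pow_mul, show 2 * (2 * N + 1) = (2 * N + 1) + (2 * N + 1) by ring, pow_add]
    generalize ∏ n ∈ Finset.range N, ((1 + w * q ^ (2 * n + 1)) * (1 + w⁻¹ * q ^ (2 * n + 1))) = p
    linear_combination p * q ^ (2 * N + 1) * q ^ (2 * N + 1) * this

lemma exists_bound_of_tendsto {u : ℕ → ℂ} {a : ℂ} (h : Tendsto u atTop (𝓝 a)) :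
    ∃ C : ℝ, 0 ≤ C ∧ ∀ n, ‖u n‖ ≤ C := by
  obtain ⟨C, hC⟩ := h.norm.bddAbove_range
  exact ⟨C, (norm_nonneg _).trans (hC ⟨0, rfl⟩), fun n => hC ⟨n, rfl⟩⟩

lemma norm_cexp_pi_lt_one {τ : ℂ} (hτ : 0 < τ.im) : ‖Complex.exp (Real.pi * Complex.I * τ)‖ < 1 := by
  rw [Complex.norm_exp]
  simp only [Complex.mul_re, Complex.ofReal_re, Complex.I_re, mul_zero, Complex.ofReal_im,
    Complex.I_im, mul_one, sub_self, zero_mul, Complex.mul_im, zero_sub, add_zero]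
  rw [Real.exp_lt_one_iff]
  have := mul_pos Real.pi_pos hτ
  linarith

/-- Jacobi's triple product. -/
theorem jacobiTheta₂_eq_prod (z : ℂ) {τ : ℂ} (hτ : 0 < τ.im) {q w : ℂ}
    (hq : q = Complex.exp (Real.pi * Complex.I * τ))
    (hw : w = Complex.exp (2 * Real.pi * Complex.I * z)) :
    jacobiTheta₂ z τ = eulerProd (q ^ 2) * (oddProd q w * oddProd q w⁻¹) := by
  have h1 : ‖q‖ < 1 := hq ▸ norm_cexp_pi_lt_one hτ
  have h0 : q ≠ 0 := hq ▸ Complex.exp_ne_zero _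
  have hw0 : w ≠ 0 := hw ▸ Complex.exp_ne_zero _
  have hQ := norm_sq_lt_one h1
  have hE := eulerProd_ne_zero hQ
  have term : ∀ k : ℤ, q ^ (k ^ 2) * w ^ k = jacobiTheta₂_term k z τ := fun k => by
    rw [hq, hw, ← Complex.exp_int_mul, ← Complex.exp_int_mul, ← Complex.exp_add, jacobiTheta₂_term]
    congr 1; push_cast; ring
  have hinv : Tendsto (fun n : ℕ => (qPoch (q ^ 2) n)⁻¹) atTop (𝓝 (eulerProd (q ^ 2))⁻¹) :=
    (tendsto_qPoch hQ).inv₀ hE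
  obtain ⟨C, hC0, hC⟩ := exists_bound_of_tendsto (tendsto_qPoch hQ)
  obtain ⟨C', hC0', hC'⟩ := exists_bound_of_tendsto hinv
  have hC'' : ∀ n : ℤ, ‖qPochInv (q ^ 2) n‖ ≤ C' := fun n => by
    rw [qPochInv]; split_ifs
    · exact hC' _
    · simpa using hC0'
  have lim : ∀ k : ℤ, Tendsto (fun N => tripleCoeff q N k) atTop (𝓝 (eulerProd (q ^ 2))⁻¹) := by
    intro k
    have g : ∀ k : ℤ, Tendsto (fun N : ℕ => qPochInv (q ^ 2) (N + k)) atTop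
        (𝓝 (eulerProd (q ^ 2))⁻¹) := fun k => by
      have t : Tendsto (fun N : ℕ => ((N : ℤ) + k).toNat) atTop atTop :=
        tendsto_atTop.mpr fun b => by
          filter_upwards [eventually_ge_atTop (b + k.natAbs)] with N hN
          lia
      refine (hinv.comp t).congr' ?_
      filter_upwards [eventually_ge_atTop k.natAbs] with N hN
      simp only [Function.comp_apply, qPochInv]
      rw [if_pos (by lia)]
    have t2 : Tendsto (fun N : ℕ => 2 * N) atTop atTop :=
      tendsto_id.const_mul_atTop' (by norm_num)
    have := (((tendsto_qPoch hQ).comp t2).mul (g (-k))).mul (g k)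
    rw [mul_inv_cancel₀ hE, one_mul] at this
    exact this
  -- Each coefficient tends to 1/∏(1 − q²ⁿ) and all of them are bounded uniformly in N and k. The
  -- absolutely convergent theta series is therefore a dominating series.
  have L1 := tendsto_tsum_of_dominated_convergence
    (f := fun (N : ℕ) (k : ℤ) => tripleCoeff q N k * (q ^ (k ^ 2) * w ^ k)) (𝓕 := atTop)
    (g := fun k : ℤ => (eulerProd (q ^ 2))⁻¹ * (q ^ (k ^ 2) * w ^ k))
    (bound := fun k => C * C' * C' * ‖jacobiTheta₂_term k z τ‖)
    (((summable_jacobiTheta₂_term_iff z τ).mpr hτ).norm.mul_left _)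
    (fun k => (lim k).mul_const _)
    (Eventually.of_forall fun N k => by
      rw [term, norm_mul, tripleCoeff, norm_mul, norm_mul]
      have := hC (2 * N); have := hC'' (N - k); have := hC'' (N + k)
      gcongr)
  have L2 := (multipliable_one_add_mul_pow_odd h1 w).mul
    (multipliable_one_add_mul_pow_odd h1 w⁻¹) |>.tendsto_prod_tprod_nat
  rw [(multipliable_one_add_mul_pow_odd h1 w).tprod_mul
    (multipliable_one_add_mul_pow_odd h1 w⁻¹)] at L2
  have := tendsto_nhds_unique (L1.congr fun N => (hasSum_tripleCoeff h1 h0 hw0 N).tsum_eq) L2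
  rw [tsum_mul_left, tsum_congr term] at this
  rw [oddProd, oddProd, ← this, jacobiTheta₂]
  field_simp

end

noncomputable section

/-! ### Product formulas for the theta functions -/

/-- The nome `exp (π i τ)`. -/
def nome (τ : ℂ) : ℂ := Complex.exp (Real.pi * Complex.I * τ)

lemma nome_ne_zero (τ : ℂ) : nome τ ≠ 0 := Complex.exp_ne_zero _

lemma norm_nome_lt_one {τ : ℂ} (hτ : 0 < τ.im) : ‖nome τ‖ < 1 := norm_cexp_pi_lt_one hτ

lemma nome_three_mul (τ : ℂ) : nome (3 * τ) = nome τ ^ 3 := by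
  rw [nome, nome, ← Complex.exp_nat_mul]; congr 1; push_cast; ring

lemma im_three_mul {τ : ℂ} (hτ : 0 < τ.im) : 0 < (3 * τ).im := by simpa using hτ

lemma thetaChar_eq (α β : ℤ) (z τ : ℂ) : thetaChar α β z τ =
    Complex.exp (Real.pi * Complex.I * (α / 2) ^ 2 * τ
      + 2 * Real.pi * Complex.I * (α / 2) * (z + β / 2)) *
      jacobiTheta₂ (z + β / 2 + α * τ / 2) τ := by
  rw [thetaChar, jacobiTheta₂, ← tsum_mul_left]
  refine tsum_congr fun k => ?_
  rw [jacobiTheta₂_term, ← Complex.exp_add]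
  congr 1; ring

lemma theta3_eq_jacobi (z τ : ℂ) : theta3 z τ = jacobiTheta₂ z τ := by
  simp [theta3, thetaChar_eq]

lemma theta4_eq_jacobi (z τ : ℂ) : theta4 z τ = jacobiTheta₂ (z + 1 / 2) τ := by
  simp [theta4, thetaChar_eq]

lemma theta2_eq_jacobi (z τ : ℂ) : theta2 z τ =
    Complex.exp (Real.pi * Complex.I * τ / 4) * Complex.exp (Real.pi * Complex.I * z) *
      jacobiTheta₂ (z + τ / 2) τ := by
  rw [theta2, thetaChar_eq, ← Complex.exp_add]
  push_cast
  congr 2 <;> ring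

lemma theta1_eq_theta2 (z τ : ℂ) : theta1 z τ = -theta2 (z + 1 / 2) τ := by
  simp only [theta1, theta2, thetaChar]
  congr 1
  refine tsum_congr fun k => ?_
  congr 1; push_cast; ring

lemma oddProd_mul_self (q w : ℂ) : oddProd q (w * q) = plusProd (q ^ 2) w :=
  tprod_congr fun n => by ring

/-- Here the exponents of q² start at 0 instead of 1. The surplus factor 1 + w⁻¹ is what later
produces 2cos(πz) in ϑ₂ and 2sin(πz) in ϑ₁. -/
lemma oddProd_inv_mul_self {q w : ℂ} (hq : ‖q‖ < 1) (h0 : q ≠ 0) :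
    oddProd q (w * q)⁻¹ = (1 + w⁻¹) * plusProd (q ^ 2) w⁻¹ := by
  have e : ∀ n : ℕ, 1 + (w * q)⁻¹ * q ^ (2 * n + 1) = 1 + w⁻¹ * (q ^ 2) ^ n := fun n => by
    rw [mul_inv, pow_succ, ← pow_mul]; field_simp
  rw [oddProd, tprod_congr e]
  have := tprod_eq_zero_mul' (f := fun n => 1 + w⁻¹ * (q ^ 2) ^ n)
    (multipliable_one_add_mul_pow (norm_sq_lt_one hq) w⁻¹)
  rw [this, plusProd, pow_zero, mul_one]

lemma theta3_eq_prod (z : ℂ) {τ : ℂ} (hτ : 0 < τ.im) {w : ℂ}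
    (hw : w = Complex.exp (2 * Real.pi * Complex.I * z)) :
    theta3 z τ = eulerProd (nome τ ^ 2) * (oddProd (nome τ) w * oddProd (nome τ) w⁻¹) := by
  rw [theta3_eq_jacobi, jacobiTheta₂_eq_prod z hτ rfl hw, nome]

lemma theta4_eq_prod (z : ℂ) {τ : ℂ} (hτ : 0 < τ.im) {w : ℂ}
    (hw : w = Complex.exp (2 * Real.pi * Complex.I * z)) :
    theta4 z τ = eulerProd (nome τ ^ 2) * (oddProd (nome τ) (-w) * oddProd (nome τ) (-w)⁻¹) := by
  rw [theta4_eq_jacobi]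
  refine jacobiTheta₂_eq_prod _ hτ rfl ?_
  rw [hw, show 2 * (Real.pi : ℂ) * Complex.I * (z + 1 / 2)
    = 2 * Real.pi * Complex.I * z + Real.pi * Complex.I by ring, Complex.exp_add_pi_mul_I]

lemma theta2_eq_prod (z : ℂ) {τ : ℂ} (hτ : 0 < τ.im) {w : ℂ}
    (hw : w = Complex.exp (2 * Real.pi * Complex.I * z)) :
    theta2 z τ = Complex.exp (Real.pi * Complex.I * τ / 4) * (2 * Complex.cos (Real.pi * z)) *
      (eulerProd (nome τ ^ 2) * (plusProd (nome τ ^ 2) w * plusProd (nome τ ^ 2) w⁻¹)) := by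
  have hw' : w * nome τ = Complex.exp (2 * Real.pi * Complex.I * (z + τ / 2)) := by
    rw [hw, nome, ← Complex.exp_add]; congr 1; ring
  rw [theta2_eq_jacobi, jacobiTheta₂_eq_prod _ hτ (q := nome τ) rfl hw', oddProd_mul_self,
    oddProd_inv_mul_self (norm_nome_lt_one hτ) (nome_ne_zero τ)]
  have : Complex.exp (Real.pi * Complex.I * z) * (1 + w⁻¹) = 2 * Complex.cos (Real.pi * z) := by
    rw [Complex.two_cos, hw, ← Complex.exp_neg, mul_add, ← Complex.exp_add]
    congr 1
    · rw [mul_one]; congr 1; ring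
    · congr 1; ring
  rw [← this]; ring

lemma theta1_eq_prod (z : ℂ) {τ : ℂ} (hτ : 0 < τ.im) {w : ℂ}
    (hw : w = Complex.exp (2 * Real.pi * Complex.I * z)) :
    theta1 z τ = Complex.exp (Real.pi * Complex.I * τ / 4) * (2 * Complex.sin (Real.pi * z)) *
      (eulerProd (nome τ ^ 2) * (plusProd (nome τ ^ 2) (-w) * plusProd (nome τ ^ 2) (-w)⁻¹)) := by
  have hw' : -w = Complex.exp (2 * Real.pi * Complex.I * (z + 1 / 2)) := by
    rw [hw, show 2 * (Real.pi : ℂ) * Complex.I * (z + 1 / 2)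
      = 2 * Real.pi * Complex.I * z + Real.pi * Complex.I by ring, Complex.exp_add_pi_mul_I]
  rw [theta1_eq_theta2, theta2_eq_prod _ hτ hw', show (Real.pi : ℂ) * (z + 1 / 2)
    = Real.pi * z + Real.pi / 2 by ring, Complex.cos_add_pi_div_two]
  ring

lemma cexp_pi_mul_div_four_ne_zero (τ : ℂ) : Complex.exp (Real.pi * Complex.I * τ / 4) ≠ 0 :=
  Complex.exp_ne_zero _

section values
variable {τ : ℂ}

lemma theta3_zero_eq (hτ : 0 < τ.im) :
    theta3 0 τ = eulerProd (nome τ ^ 2) * oddProd (nome τ) 1 ^ 2 := by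
  rw [theta3_eq_prod 0 hτ (w := 1) (by simp), inv_one]; ring

lemma theta4_zero_eq (hτ : 0 < τ.im) :
    theta4 0 τ = eulerProd (nome τ ^ 2) * oddProd (nome τ) (-1) ^ 2 := by
  rw [theta4_eq_prod 0 hτ (w := 1) (by simp), inv_neg_one]; ring

lemma theta2_zero_eq (hτ : 0 < τ.im) :
    theta2 0 τ = 2 * Complex.exp (Real.pi * Complex.I * τ / 4) *
      (eulerProd (nome τ ^ 2) * plusProd (nome τ ^ 2) 1 ^ 2) := by
  rw [theta2_eq_prod 0 hτ (w := 1) (by simp), inv_one, mul_zero,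
    Complex.cos_zero]; ring

lemma theta3_ne_zero (hτ : 0 < τ.im) : theta3 0 τ ≠ 0 := by
  have h := norm_nome_lt_one hτ
  rw [theta3_zero_eq hτ]
  exact mul_ne_zero (eulerProd_ne_zero (norm_sq_lt_one h))
    (pow_ne_zero 2 (oddProd_ne_zero h (by simp)))

lemma theta4_ne_zero (hτ : 0 < τ.im) : theta4 0 τ ≠ 0 := by
  have h := norm_nome_lt_one hτ
  rw [theta4_zero_eq hτ]
  exact mul_ne_zero (eulerProd_ne_zero (norm_sq_lt_one h))
    (pow_ne_zero 2 (oddProd_ne_zero h (by simp)))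

lemma theta2_ne_zero (hτ : 0 < τ.im) : theta2 0 τ ≠ 0 := by
  have h := norm_nome_lt_one hτ
  rw [theta2_zero_eq hτ]
  exact mul_ne_zero (mul_ne_zero two_ne_zero (Complex.exp_ne_zero _))
    (mul_ne_zero (eulerProd_ne_zero (norm_sq_lt_one h))
      (pow_ne_zero 2 (plusProd_ne_zero (norm_sq_lt_one h) (by simp))))

/-- Euler's identity ∏(1+q²ⁿ)(1+q²ⁿ⁻¹)(1−q²ⁿ⁻¹) = 1. After multiplication by ∏(1−q²ⁿ), both sides
split the factors 1 − q²ⁿ by the parity of n. -/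
lemma plusProd_one_mul_oddProd {q : ℂ} (hq : ‖q‖ < 1) :
    plusProd (q ^ 2) 1 * (oddProd q 1 * oddProd q (-1)) = 1 := by
  have hQ := norm_sq_lt_one hq
  have hQ2 := norm_sq_lt_one hQ
  have e1 : oddProd q 1 * oddProd q (-1) = oddProd (q ^ 2) (-1) := by
    rw [oddProd, oddProd, ← (multipliable_one_add_mul_pow_odd hq 1).tprod_mul
      (multipliable_one_add_mul_pow_odd hq (-1))]
    exact tprod_congr fun n => by ring
  have e2 : plusProd (q ^ 2) 1 * plusProd (q ^ 2) (-1) = plusProd ((q ^ 2) ^ 2) (-1) := by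
    rw [plusProd, plusProd, ← (multipliable_one_add_mul_pow hQ 1).tprod_mul
      (multipliable_one_add_mul_pow hQ (-1))]
    exact tprod_congr fun n => by ring
  have e3 : oddProd (q ^ 2) (-1) * plusProd ((q ^ 2) ^ 2) (-1) = plusProd (q ^ 2) (-1) := by
    have a : ∀ n : ℕ, 1 + -1 * ((q ^ 2) ^ 2) ^ (n + 1) = 1 + -1 * (q ^ 2) ^ (2 * n + 1 + 1) :=
      fun n => by ring
    rw [oddProd, plusProd, plusProd, tprod_congr a]
    exact tprod_even_mul_odd (f := fun n => 1 + -1 * (q ^ 2) ^ (n + 1))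
      (multipliable_one_add_mul_pow_odd hQ (-1))
      ((multipliable_one_add_mul_pow hQ2 (-1)).congr a)
  have h := plusProd_ne_zero hQ (w := -1) (by simp)
  rw [← e2, ← e1] at e3
  apply mul_right_cancel₀ h
  linear_combination e3

lemma theta_mul_theta_mul_theta (hτ : 0 < τ.im) :
    theta2 0 τ * theta3 0 τ * theta4 0 τ =
      2 * Complex.exp (Real.pi * Complex.I * τ / 4) * eulerProd (nome τ ^ 2) ^ 3 := by
  have h := plusProd_one_mul_oddProd (norm_nome_lt_one hτ)
  rw [theta2_zero_eq hτ, theta3_zero_eq hτ, theta4_zero_eq hτ]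
  linear_combination (2 * Complex.exp (Real.pi * Complex.I * τ / 4) * eulerProd (nome τ ^ 2) ^ 3) *
    (plusProd (nome τ ^ 2) 1 * (oddProd (nome τ) 1 * oddProd (nome τ) (-1)) + 1) * h

/-- A primitive cube root of unity. -/
def omega : ℂ := Complex.exp (2 * Real.pi * Complex.I * (1 / 3))

lemma omega_pow_three : omega ^ 3 = 1 := by
  rw [omega, ← Complex.exp_nat_mul]
  refine Eq.trans (congrArg _ ?_) Complex.exp_two_pi_mul_I
  push_cast; ring

lemma omega_sq_add : omega ^ 2 + omega + 1 = 0 := by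
  have h : (omega - 1) * (omega ^ 2 + omega + 1) = 0 := by linear_combination omega_pow_three
  refine (mul_eq_zero.mp h).resolve_left fun h1 => ?_
  rw [sub_eq_zero, omega, Complex.exp_eq_one_iff] at h1
  obtain ⟨n, hn⟩ := h1
  have h2 : (1 / 3 : ℂ) = n := by
    have := Complex.two_pi_I_ne_zero
    apply mul_left_cancel₀ this
    linear_combination hn
  have h3 : (1 : ℤ) = 3 * n := by
    have : (1 : ℂ) = 3 * n := by linear_combination 3 * h2
    exact_mod_cast this
  lia

lemma omega_inv : omega⁻¹ = omega ^ 2 := by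
  rw [inv_eq_of_mul_eq_one_right]; linear_combination omega_pow_three

lemma one_add_mul_one_add_omega (t : ℂ) :
    (1 + t) * ((1 + omega * t) * (1 + omega⁻¹ * t)) = 1 + t ^ 3 := by
  rw [omega_inv]
  linear_combination (t + t ^ 2) * omega_sq_add + (t ^ 2 + t ^ 3) * omega_pow_three

/-- The factors for w, wω, wω⁻¹ combine by (1+t)(1+ωt)(1+ω⁻¹t) = 1+t³, so that q becomes q³, the
nome of 3τ. The condition w³ = w covers the two cases w = ±1 that occur. -/
lemma oddProd_omega {q : ℂ} (hq : ‖q‖ < 1) {w : ℂ} (hw : w ^ 3 = w) :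
    oddProd q w * (oddProd q (w * omega) * oddProd q (w * omega⁻¹)) = oddProd (q ^ 3) w := by
  rw [oddProd, oddProd, oddProd, ← (multipliable_one_add_mul_pow_odd hq _).tprod_mul
    (multipliable_one_add_mul_pow_odd hq _), ← (multipliable_one_add_mul_pow_odd hq _).tprod_mul
    ((multipliable_one_add_mul_pow_odd hq _).mul (multipliable_one_add_mul_pow_odd hq _))]
  refine tprod_congr fun n => ?_
  have := one_add_mul_one_add_omega (w * q ^ (2 * n + 1))
  rw [mul_pow, hw, ← pow_mul, mul_comm _ 3, pow_mul] at this
  rw [← this]; ring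

lemma plusProd_omega {q : ℂ} (hq : ‖q‖ < 1) {w : ℂ} (hw : w ^ 3 = w) :
    plusProd q w * (plusProd q (w * omega) * plusProd q (w * omega⁻¹)) = plusProd (q ^ 3) w := by
  rw [plusProd, plusProd, plusProd, ← (multipliable_one_add_mul_pow hq _).tprod_mul
    (multipliable_one_add_mul_pow hq _), ← (multipliable_one_add_mul_pow hq _).tprod_mul
    ((multipliable_one_add_mul_pow hq _).mul (multipliable_one_add_mul_pow hq _))]
  refine tprod_congr fun n => ?_
  have := one_add_mul_one_add_omega (w * q ^ (n + 1))
  rw [mul_pow, hw, ← pow_mul, mul_comm _ 3, pow_mul] at this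
  rw [← this]; ring

lemma neg_omega_inv : (-omega)⁻¹ = -1 * omega⁻¹ := by rw [inv_neg]; ring

/-- The product formula is used once at z = 0 and twice at z = 1/3, since the latter contains ω and
ω⁻¹ once each. The factors depending on w merge into those of 3τ; the Euler products do not, and
remain on both sides. -/
lemma theta3_third (hτ : 0 < τ.im) : eulerProd (nome (3 * τ) ^ 2) *
    (theta3 (1 / 3) τ ^ 2 * theta3 0 τ) = eulerProd (nome τ ^ 2) ^ 3 * theta3 0 (3 * τ) := by
  have h := oddProd_omega (norm_nome_lt_one hτ) (w := 1) (by simp)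
  rw [theta3_eq_prod _ hτ (w := omega) rfl, theta3_zero_eq hτ, theta3_zero_eq (im_three_mul hτ),
    nome_three_mul, ← h]
  simp only [one_mul]; ring

lemma theta4_third (hτ : 0 < τ.im) : eulerProd (nome (3 * τ) ^ 2) *
    (theta4 (1 / 3) τ ^ 2 * theta4 0 τ) = eulerProd (nome τ ^ 2) ^ 3 * theta4 0 (3 * τ) := by
  have h := oddProd_omega (norm_nome_lt_one hτ) (w := -1) (by norm_num)
  rw [theta4_eq_prod _ hτ (w := omega) rfl, theta4_zero_eq hτ, theta4_zero_eq (im_three_mul hτ),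
    nome_three_mul, ← h, neg_omega_inv, neg_one_mul omega]
  ring

lemma cexp_quarter_three (τ : ℂ) : Complex.exp (Real.pi * Complex.I * (3 * τ) / 4) =
    Complex.exp (Real.pi * Complex.I * τ / 4) ^ 3 := by
  rw [← Complex.exp_nat_mul]; congr 1; push_cast; ring

lemma cos_pi_third : Complex.cos (Real.pi * (1 / 3)) = 1 / 2 := by
  have := Real.cos_pi_div_three
  rw [show (Real.pi : ℂ) * (1 / 3) = ((Real.pi / 3 : ℝ) : ℂ) by push_cast; ring,
    ← Complex.ofReal_cos, this]; norm_num

lemma sin_pi_third_sq : Complex.sin (Real.pi * (1 / 3)) ^ 2 = 3 / 4 := by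
  have := Complex.sin_sq_add_cos_sq (Real.pi * (1 / 3))
  rw [cos_pi_third] at this; linear_combination this

lemma theta2_third (hτ : 0 < τ.im) : eulerProd (nome (3 * τ) ^ 2) *
    (theta2 (1 / 3) τ ^ 2 * theta2 0 τ) = eulerProd (nome τ ^ 2) ^ 3 * theta2 0 (3 * τ) := by
  have h := plusProd_omega (norm_sq_lt_one (norm_nome_lt_one hτ)) (w := 1) (by simp)
  rw [theta2_eq_prod _ hτ (w := omega) rfl, theta2_zero_eq hτ, theta2_zero_eq (im_three_mul hτ),
    nome_three_mul, cexp_quarter_three, cos_pi_third, ← pow_mul, mul_comm 3 2, pow_mul, ← h]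
  simp only [one_mul]; ring

/-- For ϑ₁ the factor with w = −1 is the Euler product itself, so ϑ₁(1/3) reduces to the Euler
product of 3τ alone. The constant is 4 sin²(π/3) = 3. -/
lemma theta1_third_sq (hτ : 0 < τ.im) : theta1 (1 / 3) τ ^ 2 =
    3 * Complex.exp (Real.pi * Complex.I * τ / 4) ^ 2 * eulerProd (nome (3 * τ) ^ 2) ^ 2 := by
  have h := plusProd_omega (norm_sq_lt_one (norm_nome_lt_one hτ)) (w := -1) (by norm_num)
  rw [theta1_eq_prod _ hτ (w := omega) rfl, nome_three_mul, ← pow_mul _ 3, mul_comm 3 2, pow_mul,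
    neg_omega_inv, ← neg_one_mul omega, eulerProd_eq_plusProd, eulerProd_eq_plusProd, ← h]
  linear_combination (4 * Complex.exp (Real.pi * Complex.I * τ / 4) ^ 2 *
    (plusProd (nome τ ^ 2) (-1) * (plusProd (nome τ ^ 2) (-1 * omega) *
      plusProd (nome τ ^ 2) (-1 * omega⁻¹))) ^ 2) * sin_pi_third_sq

lemma theta_third_ne_zero (hτ : 0 < τ.im) : theta1 (1 / 3) τ ≠ 0 ∧ theta2 (1 / 3) τ ≠ 0 ∧
    theta3 (1 / 3) τ ≠ 0 ∧ theta4 (1 / 3) τ ≠ 0 := by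
  have h3 := im_three_mul hτ
  have hE := eulerProd_ne_zero (norm_sq_lt_one (norm_nome_lt_one hτ))
  have hE3 := eulerProd_ne_zero (norm_sq_lt_one (norm_nome_lt_one h3))
  refine ⟨fun h => ?_, fun h => ?_, fun h => ?_, fun h => ?_⟩
  · have := theta1_third_sq hτ
    rw [h] at this
    simp [hE3] at this
  · have := theta2_third hτ
    rw [h] at this
    simp [hE, theta2_ne_zero h3] at this
  · have := theta3_third hτ
    rw [h] at this
    simp [hE, theta3_ne_zero h3] at this
  · have := theta4_third hτ
    rw [h] at this
    simp [hE, theta4_ne_zero h3] at this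

lemma hauptS_eq_third (hτ : 0 < τ.im) : hauptS τ =
    theta1 (1 / 3) τ ^ 4 * theta3 (1 / 3) τ ^ 4 / (theta2 (1 / 3) τ ^ 4 * theta4 (1 / 3) τ ^ 4) := by
  have h3 := im_three_mul hτ
  have hE := eulerProd_ne_zero (norm_sq_lt_one (norm_nome_lt_one hτ))
  have hE3 := eulerProd_ne_zero (norm_sq_lt_one (norm_nome_lt_one h3))
  obtain ⟨-, n2, -, n4⟩ := theta_third_ne_zero hτ
  have e1 := theta1_third_sq hτ
  have e2 := theta2_third hτ
  have e3 := theta3_third hτ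
  have e4 := theta4_third hτ
  have p := theta_mul_theta_mul_theta hτ
  have p3 := theta_mul_theta_mul_theta h3
  rw [cexp_quarter_three] at p3
  have a2 := theta2_ne_zero hτ
  have a3 := theta3_ne_zero hτ
  have a4 := theta4_ne_zero hτ
  have b2 := theta2_ne_zero h3
  have b3 := theta3_ne_zero h3
  have b4 := theta4_ne_zero h3
  have hx := cexp_pi_mul_div_four_ne_zero τ
  rw [hauptS]
  generalize theta2 0 (3 * τ) = B2 at *
  generalize theta3 0 (3 * τ) = B3 at *
  generalize theta4 0 (3 * τ) = B4 at *
  generalize theta2 0 τ = A2 at *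
  generalize theta3 0 τ = A3 at *
  generalize theta4 0 τ = A4 at *
  generalize eulerProd (nome τ ^ 2) = E at *
  generalize eulerProd (nome (3 * τ) ^ 2) = E3 at *
  generalize Complex.exp (Real.pi * Complex.I * τ / 4) = r at *
  have f2 : theta2 (1 / 3) τ ^ 2 = E ^ 3 * B2 / (E3 * A2) := by field_simp; linear_combination e2
  have f3 : theta3 (1 / 3) τ ^ 2 = E ^ 3 * B3 / (E3 * A3) := by field_simp; linear_combination e3
  have f4 : theta4 (1 / 3) τ ^ 2 = E ^ 3 * B4 / (E3 * A4) := by field_simp; linear_combination e4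
  have sq : ∀ a : ℂ, a ^ 4 = (a ^ 2) ^ 2 := fun a => by ring
  rw [sq (theta1 _ _), sq (theta2 (1 / 3) _), sq (theta3 (1 / 3) _), sq (theta4 (1 / 3) _), e1, f2,
    f3, f4]
  -- The products ϑ₂ϑ₃ϑ₄ at τ and at 3τ eliminate both ϑ₄, after which the identity is purely
  -- rational.
  have hA : A4 = 2 * r * E ^ 3 / (A2 * A3) := by field_simp; linear_combination p
  have hB : B4 = 2 * r ^ 3 * E3 ^ 3 / (B2 * B3) := by field_simp; linear_combination p3
  rw [hA, hB]
  field_simp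
  norm_num

/-- A shift by 1/2 exchanges the types, and evenness together with the (anti)period 1 moves 1/6 +
1/2 to 1/3. -/
lemma theta_sixth (τ : ℂ) : theta1 (1 / 6) τ = theta2 (1 / 3) τ ∧
    theta2 (1 / 6) τ = theta1 (1 / 3) τ ∧ theta4 (1 / 6) τ = theta3 (1 / 3) τ := by
  have neg : ∀ z, theta2 (-z) τ = theta2 z τ := fun z => by
    rw [theta2, thetaChar, ← (Equiv.subLeft (-1 : ℤ)).tsum_eq]
    refine tsum_congr fun k => ?_
    congr 1; simp only [Equiv.subLeft_apply]; push_cast; ring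
  have add_one : ∀ z, theta2 (z + 1) τ = -theta2 z τ := fun z => by
    rw [theta2_eq_jacobi, theta2_eq_jacobi, show z + 1 + τ / 2 = z + τ / 2 + 1 by ring,
      jacobiTheta₂_add_left, mul_add, Complex.exp_add, mul_one, Complex.exp_pi_mul_I]
    ring
  refine ⟨?_, ?_, ?_⟩
  · rw [theta1_eq_theta2, ← neg (1 / 3), show (1 : ℂ) / 6 + 1 / 2 = -(1 / 3) + 1 by norm_num, add_one,
      neg_neg]
  · rw [theta1_eq_theta2, ← neg (1 / 6), show (1 : ℂ) / 3 + 1 / 2 = -(1 / 6) + 1 by norm_num, add_one,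
      neg_neg]
  · rw [theta4_eq_jacobi, theta3_eq_jacobi, ← jacobiTheta₂_neg_left (1 / 3),
      ← jacobiTheta₂_add_left (-(1 / 3))]
    norm_num

/-- The value of `hauptZ` in terms of theta constants at `τ` and `3 τ`. -/
lemma hauptZ_eq (hτ : 0 < τ.im) : hauptZ τ = 2 + theta4 0 τ ^ 3 /
    (theta3 0 τ * theta3 0 (3 * τ) * theta4 0 (3 * τ)) -
    theta2 0 τ * theta2 0 (3 * τ) / (theta3 0 τ * theta3 0 (3 * τ)) := by
  have h3 := im_three_mul hτ
  have hE := eulerProd_ne_zero (norm_sq_lt_one (norm_nome_lt_one hτ))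
  have hE3 := eulerProd_ne_zero (norm_sq_lt_one (norm_nome_lt_one h3))
  have e1 := theta1_third_sq hτ
  have e2 := theta2_third hτ
  have e3 := theta3_third hτ
  have p := theta_mul_theta_mul_theta hτ
  have p3 := theta_mul_theta_mul_theta h3
  rw [cexp_quarter_three] at p3
  have a2 := theta2_ne_zero hτ
  have a3 := theta3_ne_zero hτ
  have a4 := theta4_ne_zero hτ
  have b2 := theta2_ne_zero h3
  have b3 := theta3_ne_zero h3
  have b4 := theta4_ne_zero h3
  have hx := cexp_pi_mul_div_four_ne_zero τ
  obtain ⟨s1, s2, s4⟩ := theta_sixth τ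
  rw [hauptZ, s1, s2, s4]
  generalize theta2 0 (3 * τ) = B2 at *
  generalize theta3 0 (3 * τ) = B3 at *
  generalize theta4 0 (3 * τ) = B4 at *
  generalize theta2 0 τ = A2 at *
  generalize theta3 0 τ = A3 at *
  generalize theta4 0 τ = A4 at *
  generalize eulerProd (nome τ ^ 2) = E at *
  generalize eulerProd (nome (3 * τ) ^ 2) = E3 at *
  generalize Complex.exp (Real.pi * Complex.I * τ / 4) = r at *
  have f2 : theta2 (1 / 3) τ ^ 2 = E ^ 3 * B2 / (E3 * A2) := by field_simp; linear_combination e2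
  have f3 : theta3 (1 / 3) τ ^ 2 = E ^ 3 * B3 / (E3 * A3) := by field_simp; linear_combination e3
  have hA : A2 = 2 * r * E ^ 3 / (A3 * A4) := by field_simp; linear_combination p
  have hB : B2 = 2 * r ^ 3 * E3 ^ 3 / (B3 * B4) := by field_simp; linear_combination p3
  rw [e1, f2, f3, hA, hB]
  field_simp

end values
end

noncomputable section

/-! ### Transformation laws and expansions of the theta constants -/

/-- Since k² − k is even, e^{πik²} may be replaced by e^{πik}. This is how τ ↦ τ + 1 exchanges ϑ₃
and ϑ₄. -/
lemma cexp_pi_mul_sq_sub (k : ℤ) : Complex.exp (Real.pi * Complex.I * ((k : ℂ) ^ 2 - k)) = 1 := by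
  obtain ⟨m, hm⟩ := Int.even_mul_pred_self k
  have : ((k : ℂ) ^ 2 - k) = 2 * m := by
    have h : ((k * (k - 1) : ℤ) : ℂ) = ((m + m : ℤ) : ℂ) := by rw [hm]
    push_cast at h; linear_combination h
  rw [this, ← Complex.exp_int_mul_two_pi_mul_I m]; congr 1; ring

lemma theta3_add_one (τ : ℂ) : theta3 0 (τ + 1) = theta4 0 τ := by
  simp only [theta3, theta4, thetaChar]
  refine tsum_congr fun k => ?_
  conv_rhs => rw [← mul_one (Complex.exp (_ + _)), ← cexp_pi_mul_sq_sub k, ← Complex.exp_add]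
  congr 1; push_cast; ring

lemma theta4_add_one (τ : ℂ) : theta4 0 (τ + 1) = theta3 0 τ := by
  simp only [theta3, theta4, thetaChar]
  refine tsum_congr fun k => ?_
  conv_rhs => rw [← mul_one (Complex.exp (_ + _)), ← cexp_pi_mul_sq_sub (-k), ← Complex.exp_add]
  congr 1; push_cast; ring

/-- The eighth root of unity `exp (π i / 4)`. -/
def zeta8 : ℂ := Complex.exp (Real.pi * Complex.I / 4)

lemma zeta8_pow_four : zeta8 ^ 4 = -1 := by
  rw [zeta8, ← Complex.exp_nat_mul]
  refine Eq.trans (congrArg _ ?_) Complex.exp_pi_mul_I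
  push_cast; ring

lemma zeta8_ne_zero : zeta8 ≠ 0 := Complex.exp_ne_zero _

lemma theta2_add_one (τ : ℂ) : theta2 0 (τ + 1) = zeta8 * theta2 0 τ := by
  simp only [theta2, thetaChar, zeta8, ← tsum_mul_left]
  refine tsum_congr fun k => ?_
  conv_rhs => rw [← mul_one (Complex.exp (_ + _)), ← cexp_pi_mul_sq_sub (-k), ← Complex.exp_add,
    ← Complex.exp_add]
  congr 1; push_cast; ring

variable {τ : ℂ}

lemma im_neg_inv (hτ : 0 < τ.im) : 0 < (-1 / τ).im := by
  have h0 : τ ≠ 0 := by rintro rfl; simp at hτ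
  rw [neg_div, Complex.neg_im, one_div, Complex.inv_im, neg_div, neg_neg]
  exact div_pos hτ (Complex.normSq_pos.mpr h0)

lemma ne_zero_of_im_pos (hτ : 0 < τ.im) : τ ≠ 0 := by rintro rfl; simp at hτ

/-- The square root that occurs in the transformation law of the theta constants. -/
def sqrtFactor (τ : ℂ) : ℂ := (-Complex.I * τ) ^ (1 / 2 : ℂ)

lemma sqrtFactor_sq (τ : ℂ) : sqrtFactor τ ^ 2 = -Complex.I * τ := by
  rw [sqrtFactor, one_div]; exact Complex.cpow_nat_inv_pow _ two_ne_zero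

lemma sqrtFactor_ne_zero (hτ : 0 < τ.im) : sqrtFactor τ ≠ 0 := by
  have := sqrtFactor_sq τ
  intro h
  rw [h] at this
  simp [ne_zero_of_im_pos hτ] at this

lemma theta3_neg_inv (hτ : 0 < τ.im) : theta3 0 (-1 / τ) = sqrtFactor τ * theta3 0 τ := by
  have h := jacobiTheta₂_functional_equation 0 τ
  rw [theta3_eq_jacobi, theta3_eq_jacobi, h, ← sqrtFactor]
  have := sqrtFactor_ne_zero hτ
  simp; field_simp

lemma theta2_neg_inv (hτ : 0 < τ.im) : theta2 0 (-1 / τ) = sqrtFactor τ * theta4 0 τ := by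
  have h := jacobiTheta₂_functional_equation (1 / 2) τ
  have h0 := ne_zero_of_im_pos hτ
  rw [theta4_eq_jacobi, theta2_eq_jacobi, zero_add, zero_add, h, ← sqrtFactor, ← jacobiTheta₂_neg_left]
  have := sqrtFactor_ne_zero hτ
  rw [show -(-1 / τ / 2) = 1 / 2 / τ by ring, mul_zero, Complex.exp_zero,
    show -Real.pi * Complex.I * (1 / 2) ^ 2 / τ = Real.pi * Complex.I * (-1 / τ) / 4 by ring]
  field_simp

lemma theta4_neg_inv (hτ : 0 < τ.im) : theta4 0 (-1 / τ) = sqrtFactor τ * theta2 0 τ := by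
  have h := jacobiTheta₂_functional_equation (τ / 2) τ
  have h0 := ne_zero_of_im_pos hτ
  rw [theta4_eq_jacobi, theta2_eq_jacobi, zero_add, zero_add, h, ← sqrtFactor, mul_zero, Complex.exp_zero,
    mul_one]
  have := sqrtFactor_ne_zero hτ
  rw [show τ / 2 / τ = 1 / 2 by field_simp,
    show -Real.pi * Complex.I * (τ / 2) ^ 2 / τ = -(Real.pi * Complex.I * τ / 4) by field_simp; norm_num,
    Complex.exp_neg]
  have := Complex.exp_ne_zero (Real.pi * Complex.I * τ / 4)
  field_simp

/-! Holomorphy. -/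

lemma differentiableAt_jacobiTheta₂_comp {f : ℂ → ℂ} (hf : DifferentiableAt ℂ f τ) (hτ : 0 < τ.im) :
    DifferentiableAt ℂ (fun t => jacobiTheta₂ (f t) t) τ :=
  ((hasFDerivAt_jacobiTheta₂ (f τ) hτ).differentiableAt).comp (f := fun t => (f t, t)) τ
    (hf.prodMk differentiableAt_id)

lemma differentiableAt_theta3 (hτ : 0 < τ.im) : DifferentiableAt ℂ (theta3 0) τ := by
  have : theta3 0 = fun t => jacobiTheta₂ 0 t := funext fun t => theta3_eq_jacobi 0 t
  rw [this]; exact differentiableAt_jacobiTheta₂_comp (by fun_prop) hτ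

lemma differentiableAt_theta4 (hτ : 0 < τ.im) : DifferentiableAt ℂ (theta4 0) τ := by
  have : theta4 0 = fun t => jacobiTheta₂ (0 + 1 / 2) t := funext fun t => theta4_eq_jacobi 0 t
  rw [this]; exact differentiableAt_jacobiTheta₂_comp (f := fun _ => 0 + 1 / 2) (by fun_prop) hτ

lemma differentiableAt_theta2 (hτ : 0 < τ.im) : DifferentiableAt ℂ (theta2 0) τ := by
  have : theta2 0 = fun t => Complex.exp (Real.pi * Complex.I * t / 4) *
      Complex.exp (Real.pi * Complex.I * 0) * jacobiTheta₂ (0 + t / 2) t :=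
    funext fun t => theta2_eq_jacobi 0 t
  rw [this]
  exact DifferentiableAt.mul (by fun_prop)
    (differentiableAt_jacobiTheta₂_comp (f := fun t => 0 + t / 2) (by fun_prop) hτ)

lemma differentiableAt_comp_three {f : ℂ → ℂ} (hf : ∀ {t : ℂ}, 0 < t.im → DifferentiableAt ℂ f t)
    (hτ : 0 < τ.im) : DifferentiableAt ℂ (fun t => f (3 * t)) τ :=
  (hf (im_three_mul hτ)).comp (f := fun t => 3 * t) τ (by fun_prop)

/-! Power series. -/

/-- The series `1 + 2 ∑ v ^ (n + 1) ^ 2`. -/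
def sqSeries (v : ℂ) : ℂ := 1 + 2 * v * ∑' n : ℕ, v ^ (n * (n + 2))

/-- The series `∑ v ^ (n (n + 1) / 2)`. -/
def triSeries (v : ℂ) : ℂ := ∑' n : ℕ, v ^ (n * (n + 1) / 2)

/-- The condition n ≤ e n lets a geometric series dominate on smaller discs. -/
lemma analyticAt_tsum_pow {e : ℕ → ℕ} (he : ∀ n, n ≤ e n) {v : ℂ} (hv : ‖v‖ < 1) :
    AnalyticAt ℂ (fun v : ℂ => ∑' n : ℕ, v ^ e n) v := by
  obtain ⟨r, hvr, hr⟩ := exists_between hv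
  have h0 : 0 ≤ r := (norm_nonneg v).trans hvr.le
  have hs : Summable fun n : ℕ => r ^ n := summable_geometric_of_lt_one h0 hr
  have := Complex.differentiableOn_tsum_of_summable_norm (F := fun n (v : ℂ) => v ^ e n)
    (U := Metric.ball 0 r) hs (fun n => by fun_prop) Metric.isOpen_ball (fun n v hv => by
      rw [norm_pow]
      rw [mem_ball_zero_iff] at hv
      calc ‖v‖ ^ e n ≤ r ^ e n := by gcongr
        _ ≤ r ^ n := pow_le_pow_of_le_one h0 hr.le (he n))
  exact this.analyticAt (Metric.isOpen_ball.mem_nhds (mem_ball_zero_iff.mpr hvr))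

lemma tsum_zero_pow {e : ℕ → ℕ} (h0 : e 0 = 0) (he : ∀ n, n ≤ e n) :
    ∑' n : ℕ, (0 : ℂ) ^ e n = 1 := by
  rw [tsum_eq_single 0 fun n hn => zero_pow (by have := he n; lia), h0, pow_zero]

lemma le_triangle (n : ℕ) : n ≤ n * (n + 1) / 2 := by
  rw [Nat.le_div_iff_mul_le two_pos]
  rcases n with _ | n
  · simp
  · gcongr; lia

lemma analyticAt_sqSeries_of_norm_lt {v : ℂ} (hv : ‖v‖ < 1) : AnalyticAt ℂ sqSeries v := by
  have := analyticAt_tsum_pow (e := fun n => n * (n + 2))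
    (fun n => Nat.le_mul_of_pos_right n (by lia)) hv
  unfold sqSeries
  fun_prop

lemma analyticAt_triSeries_of_norm_lt {v : ℂ} (hv : ‖v‖ < 1) : AnalyticAt ℂ triSeries v :=
  analyticAt_tsum_pow le_triangle hv

lemma analyticAt_sqSeries : AnalyticAt ℂ sqSeries 0 := analyticAt_sqSeries_of_norm_lt (by simp)

lemma analyticAt_triSeries : AnalyticAt ℂ triSeries 0 := analyticAt_triSeries_of_norm_lt (by simp)

lemma sqSeries_zero : sqSeries 0 = 1 := by simp [sqSeries]

lemma triSeries_zero : triSeries 0 = 1 :=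
  tsum_zero_pow (e := fun n => n * (n + 1) / 2) (by simp) le_triangle

lemma deriv_sqSeries_zero : deriv sqSeries 0 = 2 := by
  have h := analyticAt_tsum_pow (e := fun n => n * (n + 2))
    (fun n => Nat.le_mul_of_pos_right n (by lia)) (v := 0) (by simp)
  have h0 := tsum_zero_pow (e := fun n => n * (n + 2)) (by simp) fun n =>
    Nat.le_mul_of_pos_right n (by lia)
  have := (((hasDerivAt_id (0 : ℂ)).const_mul 2).mul h.differentiableAt.hasDerivAt).const_add 1
  refine this.deriv.trans ?_
  simp only [id, mul_one, mul_zero, zero_mul, add_zero]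
  rw [h0, mul_one]

lemma theta3_eq_sqSeries (hτ : 0 < τ.im) : theta3 0 τ = sqSeries (nome τ) := by
  have e : ∑' n : ℕ, Complex.exp (Real.pi * Complex.I * ((n : ℂ) + 1) ^ 2 * τ) =
      nome τ * ∑' n : ℕ, nome τ ^ (n * (n + 2)) := by
    rw [← tsum_mul_left]
    refine tsum_congr fun n => ?_
    rw [nome, ← Complex.exp_nat_mul, ← Complex.exp_add]
    congr 1; push_cast; ring
  rw [theta3_eq_jacobi, ← jacobiTheta_eq_jacobiTheta₂, jacobiTheta_eq_tsum_nat hτ, sqSeries, e,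
    mul_assoc]

lemma nome_add_one (τ : ℂ) : nome (τ + 1) = -nome τ := by
  rw [nome, mul_add, mul_one, Complex.exp_add_pi_mul_I, nome]

lemma theta4_eq_sqSeries (hτ : 0 < τ.im) : theta4 0 τ = sqSeries (-nome τ) := by
  rw [← theta3_add_one, theta3_eq_sqSeries (by simpa using hτ), nome_add_one]

/-- The indices k and −(k+1) give equal terms, which folds the sum over ℤ into twice a sum over ℕ.
The exponents n(n+1) are even, so halving them in ℕ loses nothing. -/
lemma theta2_eq_triSeries (hτ : 0 < τ.im) : theta2 0 τ =
    2 * Complex.exp (Real.pi * Complex.I * τ / 4) * triSeries (nome τ ^ 2) := by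
  have e : ∀ n : ℕ, (nome τ ^ 2) ^ (n * (n + 1) / 2) =
      Complex.exp (Real.pi * Complex.I * (n * (n + 1)) * τ) := fun n => by
    rw [← pow_mul, Nat.mul_div_cancel' (Nat.even_mul_succ_self n).two_dvd, nome, ← Complex.exp_nat_mul]
    congr 1; push_cast; ring
  have hs : Summable fun k : ℤ => jacobiTheta₂_term k (τ / 2) τ :=
    (summable_jacobiTheta₂_term_iff (τ / 2) τ).mpr hτ
  have s1 : Summable fun n : ℕ => jacobiTheta₂_term (n : ℤ) (τ / 2) τ :=
    hs.comp_injective (i := fun n : ℕ => (n : ℤ)) fun a b h => by simpa using h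
  have s2 : Summable fun n : ℕ => jacobiTheta₂_term (-((n : ℤ) + 1)) (τ / 2) τ :=
    hs.comp_injective (i := fun n : ℕ => -((n : ℤ) + 1)) fun a b h => by simpa using h
  have e1 : ∀ n : ℕ, jacobiTheta₂_term (n : ℤ) (τ / 2) τ = (nome τ ^ 2) ^ (n * (n + 1) / 2) :=
    fun n => by rw [e, jacobiTheta₂_term]; congr 1; push_cast; ring
  have e2 : ∀ n : ℕ, jacobiTheta₂_term (-((n : ℤ) + 1)) (τ / 2) τ =
      (nome τ ^ 2) ^ (n * (n + 1) / 2) :=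
    fun n => by rw [e, jacobiTheta₂_term]; congr 1; push_cast; ring
  have key : jacobiTheta₂ (τ / 2) τ = 2 * triSeries (nome τ ^ 2) := by
    have h := tsum_of_nat_of_neg_add_one (f := fun k : ℤ => jacobiTheta₂_term k (τ / 2) τ) s1 s2
    exact h.trans ((congrArg₂ (· + ·) (tsum_congr e1)
      (tsum_congr e2)).trans (two_mul (triSeries (nome τ ^ 2))).symm)
  rw [theta2_eq_jacobi, zero_add, mul_zero, Complex.exp_zero, mul_one, key]
  ring

/-! The quotients of theta constants. -/

/-- The quotient `ϑ₂ / ϑ₃`. -/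
def thetaX (τ : ℂ) : ℂ := theta2 0 τ / theta3 0 τ

/-- The quotient `ϑ₄ / ϑ₃`. -/
def thetaY (τ : ℂ) : ℂ := theta4 0 τ / theta3 0 τ

/-- The multiplier `3 ϑ₃² (3 τ) / ϑ₃² (τ)`, a square root of `hauptS`. -/
def multZ (τ : ℂ) : ℂ := 3 * theta3 0 (3 * τ) ^ 2 / theta3 0 τ ^ 2

lemma thetaX_ne_zero (hτ : 0 < τ.im) : thetaX τ ≠ 0 :=
  div_ne_zero (theta2_ne_zero hτ) (theta3_ne_zero hτ)

lemma thetaY_ne_zero (hτ : 0 < τ.im) : thetaY τ ≠ 0 :=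
  div_ne_zero (theta4_ne_zero hτ) (theta3_ne_zero hτ)

lemma multZ_ne_zero (hτ : 0 < τ.im) : multZ τ ≠ 0 :=
  div_ne_zero (mul_ne_zero three_ne_zero (pow_ne_zero 2 (theta3_ne_zero (im_three_mul hτ))))
    (pow_ne_zero 2 (theta3_ne_zero hτ))

lemma multZ_sq (τ : ℂ) : multZ τ ^ 2 = hauptS τ := by
  rw [multZ, hauptS, div_pow]; congr 1 <;> ring

lemma thetaX_add_one (hτ : 0 < τ.im) : thetaX (τ + 1) = zeta8 * (thetaX τ / thetaY τ) := by
  have := theta3_ne_zero hτ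
  have := theta4_ne_zero hτ
  rw [thetaX, thetaX, thetaY, theta2_add_one, theta3_add_one]; field_simp

lemma thetaY_add_one (τ : ℂ) : thetaY (τ + 1) = (thetaY τ)⁻¹ := by
  rw [thetaY, thetaY, theta4_add_one, theta3_add_one, inv_div]

lemma thetaX_neg_inv (hτ : 0 < τ.im) : thetaX (-1 / τ) = thetaY τ := by
  have := theta3_ne_zero hτ
  have := sqrtFactor_ne_zero hτ
  rw [thetaX, thetaY, theta2_neg_inv hτ, theta3_neg_inv hτ]; field_simp

lemma thetaY_neg_inv (hτ : 0 < τ.im) : thetaY (-1 / τ) = thetaX τ := by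
  have := theta3_ne_zero hτ
  have := sqrtFactor_ne_zero hτ
  rw [thetaX, thetaY, theta4_neg_inv hτ, theta3_neg_inv hτ]; field_simp

lemma differentiableAt_thetaX (hτ : 0 < τ.im) : DifferentiableAt ℂ thetaX τ :=
  (differentiableAt_theta2 hτ).div (differentiableAt_theta3 hτ) (theta3_ne_zero hτ)

lemma differentiableAt_thetaY (hτ : 0 < τ.im) : DifferentiableAt ℂ thetaY τ :=
  (differentiableAt_theta4 hτ).div (differentiableAt_theta3 hτ) (theta3_ne_zero hτ)

lemma differentiableAt_multZ (hτ : 0 < τ.im) : DifferentiableAt ℂ multZ τ :=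
  (((differentiableAt_comp_three differentiableAt_theta3 hτ).pow 2).const_mul 3).div
    ((differentiableAt_theta3 hτ).pow 2) (pow_ne_zero 2 (theta3_ne_zero hτ))

lemma differentiableAt_hauptS (hτ : 0 < τ.im) : DifferentiableAt ℂ hauptS τ :=
  ((differentiableAt_multZ hτ).pow 2).congr_of_eventuallyEq
    (Eventually.of_forall fun t => (multZ_sq t).symm)

lemma hauptS_ne_zero (hτ : 0 < τ.im) : hauptS τ ≠ 0 := by
  rw [← multZ_sq]; exact pow_ne_zero 2 (multZ_ne_zero hτ)

end

noncomputable section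

/-! ### The group and its coset decomposition -/

/-- The integral form of `T0`. -/
def intT0 : SL(2, ℤ) := ⟨!![4, -1; 9, -2], by norm_num [Matrix.det_fin_two]⟩
/-- The integral form of `Tinf`. -/
def intTinf : SL(2, ℤ) := ⟨!![4, -3; 3, -2], by norm_num [Matrix.det_fin_two]⟩
/-- The integral form of `T9`. -/
def intT9 : SL(2, ℤ) := ⟨!![1, -2; 0, 1], by norm_num [Matrix.det_fin_two]⟩

/-- The integral form of `heunGroup`. -/
def intHeunGroup : Subgroup SL(2, ℤ) := Subgroup.closure {intT0, intTinf, intT9}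

/-- Matrices that map `∞` to the cusps `∞, 0, 1, 1 / 3`. -/
def cuspMat : Fin 4 → SL(2, ℤ) :=
  ![1, ModularGroup.S, ⟨!![1, -1; 1, 0], by norm_num [Matrix.det_fin_two]⟩,
    ⟨!![1, 0; 3, 1], by norm_num [Matrix.det_fin_two]⟩]

/-- The widths of the cusps `∞, 0, 1, 1 / 3`. -/
def cuspWidth : Fin 4 → ℕ := ![2, 6, 3, 1]

/-- Generators of the stabilizers of the cusps. -/
def cuspGen : Fin 4 → SL(2, ℤ) :=
  ![intT9, (intT9 * intTinf * intT0)⁻¹, intTinf, intT0]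

lemma intT0_mem : intT0 ∈ intHeunGroup := Subgroup.subset_closure (by simp)
lemma intTinf_mem : intTinf ∈ intHeunGroup := Subgroup.subset_closure (by simp)
lemma intT9_mem : intT9 ∈ intHeunGroup := Subgroup.subset_closure (by simp)

lemma cuspGen_mem (c : Fin 4) : cuspGen c ∈ intHeunGroup := by
  fin_cases c
  · exact intT9_mem
  · exact inv_mem (mul_mem (mul_mem intT9_mem intTinf_mem) intT0_mem)
  · exact intTinf_mem
  · exact intT0_mem

/-- In the coordinate at each cusp the chosen generator is translation by minus the width. The sign
matters later: clockwise circles correspond to negative translations. -/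
lemma cuspMat_mul_T_pow (c : Fin 4) :
    cuspGen c * cuspMat c * ModularGroup.T ^ cuspWidth c = cuspMat c := by
  fin_cases c <;> decide

lemma cuspMat_mul_T_zpow (c : Fin 4) (k : ℤ) :
    cuspMat c * ModularGroup.T ^ (cuspWidth c * k) = (cuspGen c)⁻¹ ^ k * cuspMat c := by
  have h : (cuspMat c)⁻¹ * (cuspGen c)⁻¹ * cuspMat c = ModularGroup.T ^ cuspWidth c := by
    rw [← mul_right_inj (cuspGen c * cuspMat c), cuspMat_mul_T_pow]; group
  rw [zpow_mul, zpow_natCast, ← h]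
  have := conj_zpow (i := k) (a := (cuspMat c)⁻¹) (b := (cuspGen c)⁻¹)
  rw [inv_inv] at this
  rw [this]; group

lemma cuspMat_mul_T_reduce (c : Fin 4) (n : ℤ) : ∃ g ∈ intHeunGroup, ∃ j : ℕ, j < cuspWidth c ∧
    cuspMat c * ModularGroup.T ^ n = g * cuspMat c * ModularGroup.T ^ j := by
  have hw : 0 < (cuspWidth c : ℤ) := by fin_cases c <;> decide
  refine ⟨(cuspGen c)⁻¹ ^ (n / cuspWidth c), zpow_mem (inv_mem (cuspGen_mem c)) _,
    (n % cuspWidth c).toNat, by have := Int.emod_lt_of_pos n hw; have := Int.emod_nonneg n hw.ne'; lia, ?_⟩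
  rw [← cuspMat_mul_T_zpow, ← zpow_natCast, Int.toNat_of_nonneg (Int.emod_nonneg n hw.ne'), mul_assoc,
    ← zpow_add, Int.mul_ediv_add_emod]

/-- The union of the double cosets `± G σ_c ⟨T⟩`. -/
def IsCuspCoset (γ : SL(2, ℤ)) : Prop :=
  ∃ g ∈ intHeunGroup, ∃ (c : Fin 4) (j : ℤ),
    γ = g * cuspMat c * ModularGroup.T ^ j ∨ γ = -(g * cuspMat c * ModularGroup.T ^ j)

lemma IsCuspCoset.neg {γ : SL(2, ℤ)} (h : IsCuspCoset γ) : IsCuspCoset (-γ) := by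
  obtain ⟨g, hg, c, j, h | h⟩ := h
  · exact ⟨g, hg, c, j, Or.inr (by rw [h])⟩
  · exact ⟨g, hg, c, j, Or.inl (by rw [h, neg_neg])⟩

lemma IsCuspCoset.mul_left {γ g : SL(2, ℤ)} (h : IsCuspCoset γ) (hg : g ∈ intHeunGroup) :
    IsCuspCoset (g * γ) := by
  obtain ⟨g', hg', c, j, h | h⟩ := h
  · exact ⟨g * g', mul_mem hg hg', c, j, Or.inl (by rw [h]; group)⟩
  · exact ⟨g * g', mul_mem hg hg', c, j, Or.inr (by rw [h, mul_neg]; group)⟩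

lemma IsCuspCoset.mul_T_zpow {γ : SL(2, ℤ)} (h : IsCuspCoset γ) (k : ℤ) :
    IsCuspCoset (γ * ModularGroup.T ^ k) := by
  obtain ⟨g', hg', c, j, h | h⟩ := h
  · exact ⟨g', hg', c, j + k, Or.inl (by rw [h]; group)⟩
  · exact ⟨g', hg', c, j + k, Or.inr (by rw [h, neg_mul]; group)⟩

/-- The finite core of the coset enumeration. There are 2 + 6 + 3 + 1 = 12 representatives σ_c Tʲ,
and right multiplication by S sends each back to the list, up to sign, a power of T and an explicit
word in the generators. -/
lemma isCuspCoset_cuspMat_mul_T_mul_S (c : Fin 4) {j : ℕ} (hj : j < cuspWidth c) :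
    IsCuspCoset (cuspMat c * ModularGroup.T ^ j * ModularGroup.S) := by
  fin_cases c
  · replace hj : j < 2 := hj
    interval_cases j
    · exact ⟨1, one_mem _, 1, 0, Or.inl (by decide)⟩
    · exact ⟨1, one_mem _, 2, 0, Or.inl (by decide)⟩
  · replace hj : j < 6 := hj
    interval_cases j
    · exact ⟨1, one_mem _, 0, 0, Or.inr (by decide)⟩
    · exact ⟨intT9, intT9_mem, 2, -1, Or.inl (by decide)⟩
    · exact ⟨intT9 * intTinf, mul_mem intT9_mem intTinf_mem, 1, -2, Or.inr (by decide)⟩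
    · exact ⟨intT9 * intTinf, mul_mem intT9_mem intTinf_mem, 3, -1, Or.inr (by decide)⟩
    · exact ⟨intT9 * intTinf * intT0 * intT0, mul_mem (mul_mem (mul_mem intT9_mem intTinf_mem)
        intT0_mem) intT0_mem, 1, -4, Or.inl (by decide)⟩
    · exact ⟨intT9 * intTinf * intT0, mul_mem (mul_mem intT9_mem intTinf_mem)
        intT0_mem, 2, 1, Or.inr (by decide)⟩
  · replace hj : j < 3 := hj
    interval_cases j
    · exact ⟨1, one_mem _, 0, 1, Or.inr (by decide)⟩
    · exact ⟨1, one_mem _, 1, -1, Or.inl (by decide)⟩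
    · exact ⟨intT0, intT0_mem, 1, -5, Or.inr (by decide)⟩
  · replace hj : j < 1 := hj
    interval_cases j
    · exact ⟨1, one_mem _, 1, -3, Or.inl (by decide)⟩

lemma IsCuspCoset.mul_S {γ : SL(2, ℤ)} (h : IsCuspCoset γ) : IsCuspCoset (γ * ModularGroup.S) := by
  obtain ⟨g, hg, c, j, h⟩ := h
  obtain ⟨g', hg', j', hj', e⟩ := cuspMat_mul_T_reduce c j
  have key : IsCuspCoset (g * cuspMat c * ModularGroup.T ^ j * ModularGroup.S) := by
    have := (isCuspCoset_cuspMat_mul_T_mul_S c hj').mul_left (mul_mem hg hg')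
    convert this using 1
    rw [mul_assoc g, e]; group
  rcases h with h | h
  · rwa [h]
  · rw [h, neg_mul]; exact key.neg

/-- `SL(2, ℤ)` is the union of the cosets `± G σ_c T ^ j`. -/
lemma isCuspCoset (γ : SL(2, ℤ)) : IsCuspCoset γ := by
  have h : γ ∈ Subgroup.closure {ModularGroup.S, ModularGroup.T} := by
    rw [SpecialLinearGroup.SL2Z_generators]; trivial
  induction h using Subgroup.closure_induction_right with
  | one => exact ⟨1, one_mem _, 0, 0, Or.inl (by decide)⟩
  | mul_right x _ y hy ih =>
    rcases hy with rfl | rfl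
    · exact ih.mul_S
    · simpa using ih.mul_T_zpow 1
  | mul_inv_cancel x _ y hy ih =>
    rcases hy with rfl | rfl
    · have : ModularGroup.S⁻¹ = -ModularGroup.S := by decide
      rw [this, mul_neg]; exact ih.mul_S.neg
    · simpa using ih.mul_T_zpow (-1)

lemma exists_coset_rep (γ : SL(2, ℤ)) : ∃ g ∈ intHeunGroup, ∃ (c : Fin 4) (j : ℕ), j < 6 ∧
    (γ = g * cuspMat c * ModularGroup.T ^ j ∨ γ = -(g * cuspMat c * ModularGroup.T ^ j)) := by
  obtain ⟨g, hg, c, j, h⟩ := isCuspCoset γ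
  obtain ⟨g', hg', j', hj', e⟩ := cuspMat_mul_T_reduce c j
  have hw : cuspWidth c ≤ 6 := by fin_cases c <;> decide
  refine ⟨g * g', mul_mem hg hg', c, j', by lia, ?_⟩
  rwa [mul_assoc g, mul_assoc g, ← e, ← mul_assoc]

/-- The 4·6·2 candidates overcount the cosets, since only surjectivity is needed. Inverses appear
because the quotient consists of left cosets while the representatives describe right ones. -/
instance : intHeunGroup.FiniteIndex := by
  let f : Fin 4 × Fin 6 × Bool → SL(2, ℤ) ⧸ intHeunGroup := fun p =>
    ((cond p.2.2 (1 : SL(2, ℤ)) (-1) * (cuspMat p.1 * ModularGroup.T ^ (p.2.1 : ℕ)))⁻¹ : SL(2, ℤ))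
  have hf : Function.Surjective f := fun x => by
    obtain ⟨γ, rfl⟩ := QuotientGroup.mk_surjective x
    obtain ⟨g, hg, c, j, hj, h | h⟩ := exists_coset_rep γ⁻¹
    · refine ⟨(c, ⟨j, hj⟩, true), ?_⟩
      rw [QuotientGroup.eq]
      rw [inv_eq_iff_eq_inv] at h
      rw [h]
      simpa [mul_assoc] using hg
    · refine ⟨(c, ⟨j, hj⟩, false), ?_⟩
      rw [QuotientGroup.eq]
      rw [inv_eq_iff_eq_inv] at h
      rw [h]
      simpa [mul_assoc] using hg
  have := Finite.of_surjective f hf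
  exact Subgroup.finiteIndex_of_finite_quotient

/-- Every point of the upper half plane is equivalent under the group to a point of one of four
cusp neighbourhoods. -/
lemma exists_cusp_region (τ : ℍ) : ∃ g ∈ intHeunGroup, ∃ (c : Fin 4) (u : ℍ),
    |u.re| ≤ 7 ∧ 1 / 2 ≤ u.im ∧ τ = g • cuspMat c • u := by
  obtain ⟨γ, hγ⟩ := ModularGroup.exists_smul_mem_fd τ
  obtain ⟨g, hg, c, j, hj, h⟩ := exists_coset_rep γ⁻¹
  -- In the standard fundamental domain |Re| ≤ 1/2 and Im² ≥ 3/4. A translation by j < 6 keeps the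
  -- real part below 7, and Im ≥ 1/2 is a convenient weaker bound.
  refine ⟨g, hg, c, ModularGroup.T ^ j • γ • τ, ?_, ?_, ?_⟩
  · have h1 := hγ.2
    have h2 : (ModularGroup.T ^ j • γ • τ).re = j + (γ • τ).re := by
      have := modular_T_zpow_smul (γ • τ) j
      rw [zpow_natCast] at this
      rw [this]; simp
    rw [h2]
    have h3 : (j : ℝ) ≤ 6 := by exact_mod_cast hj.le
    have h4 : (0 : ℝ) ≤ j := by positivity
    rw [abs_le] at h1 ⊢
    constructor <;> linarith
  · have h2 : (ModularGroup.T ^ j • γ • τ).im = (γ • τ).im := by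
      have := modular_T_zpow_smul (γ • τ) j
      rw [zpow_natCast] at this
      rw [this]; simp
    rw [h2]
    have h3 := ModularGroup.three_le_four_mul_im_sq_of_mem_fd hγ
    nlinarith [(γ • τ).im_pos]
  · have : τ = γ⁻¹ • γ • τ := (inv_smul_smul γ τ).symm
    rcases h with h | h
    · rw [h] at this
      conv_lhs => rw [this]
      simp only [mul_smul]
    · rw [h, ModularGroup.SL_neg_smul] at this
      conv_lhs => rw [this]
      simp only [mul_smul]

open scoped ModularForm in
/-- A holomorphic function on the upper half plane that is invariant under the group and bounded at
its four cusps is constant. -/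
theorem eq_const_of_bounded {f : ℍ → ℂ} (hd : ∀ τ : ℍ, DifferentiableAt ℂ (f ∘ ofComplex) τ)
    (hinv : ∀ g ∈ intHeunGroup, ∀ τ, f (g • τ) = f τ)
    (hb : ∀ c, IsBoundedAtImInfty fun τ => f (cuspMat c • τ)) : ∃ a, ∀ τ, f τ = a := by
  let F : ModularForm (intHeunGroup : Subgroup (GL (Fin 2) ℝ)) 0 :=
    { toFun := f
      slash_action_eq' := fun γ hγ => by
        obtain ⟨g, hg, rfl⟩ := hγ
        funext τ
        have := ModularForm.SL_slash_apply (f := f) (k := 0) g τ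
        rw [ModularForm.SL_slash] at this
        refine this.trans ?_
        rw [hinv g hg]; simp
      holo' := by
        rw [UpperHalfPlane.mdifferentiable_iff]
        exact fun z hz => (hd ⟨z, hz⟩).differentiableWithinAt
      bdd_at_cusps' := fun {c} hc => by
        rw [Subgroup.IsArithmetic.isCusp_iff_isCusp_SL2Z] at hc
        rw [OnePoint.isBoundedAt_iff_forall_SL2Z hc]
        intro γ _
        -- By the coset decomposition, boundedness at any rational cusp is boundedness at one of the
        -- four, after a harmless horizontal translation.
        obtain ⟨g, hg, c, j, h⟩ := isCuspCoset γ
        have e : (fun τ => f (γ • τ)) = fun τ => f (cuspMat c • ((j : ℝ) +ᵥ τ)) := by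
          funext τ
          rcases h with h | h
          · rw [h, mul_smul, mul_smul, hinv g hg, modular_T_zpow_smul]
          · rw [h, ModularGroup.SL_neg_smul, mul_smul, mul_smul, hinv g hg, modular_T_zpow_smul]
        have e' : (f ∣[(0 : ℤ)] γ) = fun τ => f (cuspMat c • ((j : ℝ) +ᵥ τ)) := by
          rw [← e]; funext τ; rw [ModularForm.SL_slash_apply]; simp
        rw [e']
        have := hb c
        rw [isBoundedAtImInfty_iff] at this ⊢
        obtain ⟨M, A, h⟩ := this
        exact ⟨M, A, fun z hz => h _ (by simpa using hz)⟩ }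
  obtain ⟨a, ha⟩ := ModularForm.eq_const_of_weight_zero F
  exact ⟨a, fun τ => congrFun ha τ⟩

end

noncomputable section

/-! ### The functions at the cusps -/

/-- The quotient `(ϑ₂³ (τ) / ϑ₂ (3 τ)) / (ϑ₃³ (τ) / ϑ₃ (3 τ))`. -/
def cubP (τ : ℂ) : ℂ := thetaX τ ^ 3 / thetaX (3 * τ)

/-- The quotient `(ϑ₄³ (τ) / ϑ₄ (3 τ)) / (ϑ₃³ (τ) / ϑ₃ (3 τ))`. -/
def cubQ (τ : ℂ) : ℂ := thetaY τ ^ 3 / thetaY (3 * τ)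

/-- The quotient `(ϑ₂³ (3 v) / ϑ₂ (v)) / (ϑ₃³ (3 v) / ϑ₃ (v))`. -/
def cubP' (v : ℂ) : ℂ := thetaX (3 * v) ^ 3 / thetaX v

/-- The quotient `(ϑ₄³ (3 v) / ϑ₄ (v)) / (ϑ₃³ (3 v) / ϑ₃ (v))`. -/
def cubQ' (v : ℂ) : ℂ := thetaY (3 * v) ^ 3 / thetaY v

section
variable {u v : ℂ}

lemma cubP_ne_zero (hu : 0 < u.im) : cubP u ≠ 0 :=
  div_ne_zero (pow_ne_zero 3 (thetaX_ne_zero hu)) (thetaX_ne_zero (im_three_mul hu))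
lemma cubQ_ne_zero (hu : 0 < u.im) : cubQ u ≠ 0 :=
  div_ne_zero (pow_ne_zero 3 (thetaY_ne_zero hu)) (thetaY_ne_zero (im_three_mul hu))
lemma cubP'_ne_zero (hu : 0 < u.im) : cubP' u ≠ 0 :=
  div_ne_zero (pow_ne_zero 3 (thetaX_ne_zero (im_three_mul hu))) (thetaX_ne_zero hu)
lemma cubQ'_ne_zero (hu : 0 < u.im) : cubQ' u ≠ 0 :=
  div_ne_zero (pow_ne_zero 3 (thetaY_ne_zero (im_three_mul hu))) (thetaY_ne_zero hu)

lemma im_add_one (hu : 0 < u.im) : 0 < (u + 1).im := by simpa using hu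
lemma im_sub_one (hu : 0 < u.im) : 0 < (u - 1).im := by simpa using hu

lemma thetaX_sub_one (hu : 0 < u.im) : thetaX (u - 1) = zeta8⁻¹ * (thetaX u / thetaY u) := by
  have h1 := thetaX_add_one (im_sub_one hu)
  have h2 := thetaY_add_one (u - 1)
  rw [sub_add_cancel] at h1 h2
  have := thetaY_ne_zero (im_sub_one hu)
  have := zeta8_ne_zero
  rw [h1, h2]; field_simp

lemma thetaY_sub_one (u : ℂ) : thetaY (u - 1) = (thetaY u)⁻¹ := by
  have h2 := thetaY_add_one (u - 1)
  rw [sub_add_cancel] at h2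
  rw [h2, inv_inv]

lemma thetaX_three (hu : 0 < u.im) : thetaX (u + 3) = zeta8 ^ 3 * (thetaX u / thetaY u) := by
  have h1 := im_add_one hu
  have := thetaY_ne_zero hu
  rw [show u + 3 = u + 1 + 1 + 1 by ring, thetaX_add_one (im_add_one h1), thetaX_add_one h1,
    thetaX_add_one hu]
  simp only [thetaY_add_one]
  generalize thetaY u = y at *
  field_simp

lemma thetaY_three (u : ℂ) : thetaY (u + 3) = (thetaY u)⁻¹ := by
  rw [show u + 3 = u + 1 + 1 + 1 by ring, thetaY_add_one, thetaY_add_one, thetaY_add_one, inv_inv]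

/-- The cube contributes ζ₈³ and the argument 3u + 3 contributes ζ₈³ as well, so the roots of unity
cancel. This is why the cubes are formed. -/
lemma cubP_add_one (hu : 0 < u.im) : cubP (u + 1) = cubP u / cubQ u := by
  have := thetaY_ne_zero hu
  have := thetaX_ne_zero hu
  have := thetaY_ne_zero (im_three_mul hu)
  have := thetaX_ne_zero (im_three_mul hu)
  have := zeta8_ne_zero
  rw [cubP, cubP, cubQ, thetaX_add_one hu, show 3 * (u + 1) = 3 * u + 3 by ring,
    thetaX_three (im_three_mul hu)]
  field_simp

lemma cubQ_add_one (hu : 0 < u.im) : cubQ (u + 1) = (cubQ u)⁻¹ := by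
  have := thetaY_ne_zero hu
  have := thetaY_ne_zero (im_three_mul hu)
  rw [cubQ, cubQ, thetaY_add_one, show 3 * (u + 1) = 3 * u + 3 by ring, thetaY_three]
  field_simp

lemma cubP'_add_one (hu : 0 < u.im) : cubP' (u + 1) = cubP' u / cubQ' u := by
  have := thetaY_ne_zero hu
  have := thetaX_ne_zero hu
  have := thetaY_ne_zero (im_three_mul hu)
  have := thetaX_ne_zero (im_three_mul hu)
  have := zeta8_ne_zero
  have h : zeta8 ^ 9 = zeta8 := by linear_combination (zeta8 ^ 5 - zeta8) * zeta8_pow_four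
  rw [cubP', cubP', cubQ', thetaX_add_one hu, show 3 * (u + 1) = 3 * u + 3 by ring,
    thetaX_three (im_three_mul hu), mul_pow, ← pow_mul, h]
  field_simp

lemma cubQ'_add_one (hu : 0 < u.im) : cubQ' (u + 1) = (cubQ' u)⁻¹ := by
  have := thetaY_ne_zero hu
  have := thetaY_ne_zero (im_three_mul hu)
  rw [cubQ', cubQ', thetaY_add_one, show 3 * (u + 1) = 3 * u + 3 by ring, thetaY_three]
  field_simp

/-! Images under the matrices of the cusps. -/

/-- Writing a point near the cusp 0 as −1/(3v) makes inversion exchange the arguments τ and 3τ. The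
coordinates at the cusps 0 and 1 are therefore v = u/3. -/
lemma three_mul_neg_inv (v : ℂ) : 3 * (-1 / (3 * v)) = -1 / v := by
  rw [mul_div, mul_div_mul_left _ _ (three_ne_zero' ℂ)]

lemma thetaX_cusp_third (hu : 0 < u.im) : thetaX (u / (u + 1)) = (thetaX u)⁻¹ ∧
    thetaY (u / (u + 1)) = zeta8⁻¹ * (thetaY u / thetaX u) := by
  have h0 := ne_zero_of_im_pos hu
  have h1 := ne_zero_of_im_pos (im_add_one hu)
  have hw := im_neg_inv hu
  have e : u / (u + 1) = -1 / (-1 / u - 1) := by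
    have : -1 / u - 1 ≠ 0 := ne_zero_of_im_pos (im_sub_one hw)
    rw [div_eq_div_iff h1 this]; field_simp; ring
  rw [e, thetaX_neg_inv (im_sub_one hw), thetaY_neg_inv (im_sub_one hw), thetaY_sub_one,
    thetaX_sub_one hw, thetaY_neg_inv hu, thetaX_neg_inv hu]
  exact ⟨rfl, rfl⟩

lemma im_sub_three (hu : 0 < u.im) : 0 < (u - 3).im := by simpa using hu
lemma im_three_add_one (hu : 0 < u.im) : 0 < (3 * u + 1).im := by simpa using hu

lemma div_three_mul_add_one (hu : 0 < u.im) : u / (3 * u + 1) = -1 / (-1 / u - 3) := by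
  have h0 := ne_zero_of_im_pos hu
  have h1 := ne_zero_of_im_pos (im_three_add_one hu)
  have : -1 / u - 3 ≠ 0 := ne_zero_of_im_pos (im_sub_three (im_neg_inv hu))
  rw [div_eq_div_iff h1 this]; field_simp; ring

lemma thetaX_cusp_three (hu : 0 < u.im) : thetaX (u / (3 * u + 1)) = (thetaX u)⁻¹ ∧
    thetaY (u / (3 * u + 1)) = zeta8⁻¹ ^ 3 * (thetaY u / thetaX u) := by
  have hw := im_neg_inv hu
  have hw3 := im_sub_three hw
  have h2 := thetaX_three hw3
  have h3 := thetaY_three (-1 / u - 3)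
  rw [sub_add_cancel] at h2 h3
  rw [thetaX_neg_inv hu] at h2
  rw [thetaY_neg_inv hu] at h3
  have := thetaY_ne_zero hw3
  have := zeta8_ne_zero
  rw [div_three_mul_add_one hu, thetaX_neg_inv hw3, thetaY_neg_inv hw3, h3, h2]
  generalize thetaY (-1 / u - 3) = y at *
  constructor
  · rw [inv_inv]
  · field_simp

/-- To be used at 3u, because 3 · u/(3u+1) = 3u/(3u+1). The automorphy factors of ϑ₃(τ) and ϑ₃(3τ)
at the cusp 1/3 then have the same square 3u + 1, and cancel in s. -/
lemma theta3_cusp_third (hu : 0 < u.im) :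
    ∃ c : ℂ, c ^ 2 = u + 1 ∧ theta3 0 (u / (u + 1)) = c * theta2 0 u := by
  have h0 := ne_zero_of_im_pos hu
  have h1 := ne_zero_of_im_pos (im_add_one hu)
  have hw := im_neg_inv hu
  have e : u / (u + 1) = -1 / (-1 / u - 1) := by
    have : -1 / u - 1 ≠ 0 := ne_zero_of_im_pos (im_sub_one hw)
    rw [div_eq_div_iff h1 this]; field_simp; ring
  have h3 := theta4_add_one (-1 / u - 1)
  rw [sub_add_cancel] at h3
  refine ⟨sqrtFactor (-1 / u - 1) * sqrtFactor u, ?_, ?_⟩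
  · rw [mul_pow, sqrtFactor_sq, sqrtFactor_sq]
    field_simp
    rw [Complex.I_sq]; ring
  · rw [e, theta3_neg_inv (im_sub_one hw), ← h3, theta4_neg_inv hu]; ring

lemma theta3_cusp_three (hu : 0 < u.im) :
    ∃ c : ℂ, c ^ 2 = 3 * u + 1 ∧ theta3 0 (u / (3 * u + 1)) = c * theta2 0 u := by
  have h0 := ne_zero_of_im_pos hu
  have hw := im_neg_inv hu
  have h3 := theta4_add_one (-1 / u - 1)
  have h4 := theta3_add_one (-1 / u - 2)
  have h5 := theta4_add_one (-1 / u - 3)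
  rw [sub_add_cancel] at h3
  rw [show -1 / u - 2 + 1 = -1 / u - 1 by ring] at h4
  rw [show -1 / u - 3 + 1 = -1 / u - 2 by ring] at h5
  refine ⟨sqrtFactor (-1 / u - 3) * sqrtFactor u, ?_, ?_⟩
  · rw [mul_pow, sqrtFactor_sq, sqrtFactor_sq]
    field_simp
    rw [Complex.I_sq]; ring
  · rw [div_three_mul_add_one hu, theta3_neg_inv (im_sub_three hw), ← h5, ← h4, ← h3,
      theta4_neg_inv hu]
    ring

lemma hauptS_cusp_zero (hv : 0 < v.im) :
    hauptS (-1 / (3 * v)) = theta3 0 v ^ 4 / theta3 0 (3 * v) ^ 4 := by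
  have h3 := im_three_mul hv
  have e : ∀ w, sqrtFactor w ^ 4 = (-Complex.I * w) ^ 2 := fun w => by rw [← sqrtFactor_sq]; ring
  have := ne_zero_of_im_pos hv
  have := theta3_ne_zero h3
  rw [hauptS, three_mul_neg_inv, theta3_neg_inv hv, theta3_neg_inv h3, mul_pow, mul_pow, e, e]
  field_simp
  ring

lemma hauptS_cusp_one (hv : 0 < v.im) :
    hauptS (1 - 1 / (3 * v)) = theta2 0 v ^ 4 / theta2 0 (3 * v) ^ 4 := by
  have h3 := im_three_mul hv
  have e : ∀ w, sqrtFactor w ^ 4 = (-Complex.I * w) ^ 2 := fun w => by rw [← sqrtFactor_sq]; ring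
  have := ne_zero_of_im_pos hv
  have := theta2_ne_zero h3
  rw [hauptS, show 3 * (1 - 1 / (3 * v)) = 3 * (-1 / (3 * v)) + 1 + 1 + 1 by ring,
    three_mul_neg_inv, show 1 - 1 / (3 * v) = -1 / (3 * v) + 1 by ring,
    theta3_add_one, theta3_add_one, theta4_add_one, theta3_add_one, theta4_neg_inv hv,
    theta4_neg_inv h3, mul_pow, mul_pow, e, e]
  field_simp
  ring

lemma hauptS_cusp_third (hu : 0 < u.im) :
    hauptS (u / (3 * u + 1)) = 9 * theta2 0 (3 * u) ^ 4 / theta2 0 u ^ 4 := by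
  have h3 := im_three_mul hu
  have h31 := ne_zero_of_im_pos (im_three_add_one hu)
  have := theta2_ne_zero hu
  obtain ⟨c, hc, e⟩ := theta3_cusp_three hu
  obtain ⟨c', hc', e'⟩ := theta3_cusp_third h3
  have f : c ^ 4 = (3 * u + 1) ^ 2 := by rw [← hc]; ring
  have f' : c' ^ 4 = (3 * u + 1) ^ 2 := by rw [← hc']; ring
  rw [hauptS, mul_div, e, e', mul_pow, mul_pow, f, f']
  field_simp

lemma cub_cusp_zero (hv : 0 < v.im) :
    cubP (-1 / (3 * v)) = cubQ' v ∧ cubQ (-1 / (3 * v)) = cubP' v := by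
  have h3 := im_three_mul hv
  rw [cubP, cubQ, cubP', cubQ', three_mul_neg_inv, thetaX_neg_inv hv, thetaX_neg_inv h3,
    thetaY_neg_inv hv, thetaY_neg_inv h3]
  exact ⟨rfl, rfl⟩

lemma cub_cusp_one (hv : 0 < v.im) :
    cubP (1 - 1 / (3 * v)) = cubQ' v / cubP' v ∧ cubQ (1 - 1 / (3 * v)) = (cubP' v)⁻¹ := by
  have h3 := im_neg_inv (im_three_mul hv)
  obtain ⟨e1, e2⟩ := cub_cusp_zero hv
  rw [show 1 - 1 / (3 * v) = -1 / (3 * v) + 1 by ring, cubP_add_one h3, cubQ_add_one h3, e1, e2]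
  exact ⟨rfl, rfl⟩

lemma cub_cusp_third (hu : 0 < u.im) :
    cubP (u / (3 * u + 1)) = (cubP u)⁻¹ ∧ cubQ (u / (3 * u + 1)) = cubQ u / cubP u := by
  have h3 := im_three_mul hu
  obtain ⟨e1, e2⟩ := thetaX_cusp_three hu
  obtain ⟨e3, e4⟩ := thetaX_cusp_third h3
  have := thetaX_ne_zero hu
  have := thetaX_ne_zero h3
  have := thetaY_ne_zero hu
  have := thetaY_ne_zero h3
  have := zeta8_ne_zero
  have h : zeta8 ^ 9 = zeta8 := by linear_combination (zeta8 ^ 5 - zeta8) * zeta8_pow_four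
  constructor
  · rw [cubP, cubP, mul_div, e1, e3]; field_simp
  · rw [cubQ, cubQ, cubP, mul_div, e2, e4, mul_pow, ← pow_mul, inv_pow, h]; field_simp

lemma theta3_add_two (u : ℂ) : theta3 0 (u + 2) = theta3 0 u := by
  rw [show u + 2 = u + 1 + 1 by ring, theta3_add_one, theta4_add_one]

lemma theta3_add_six (u : ℂ) : theta3 0 (u + 6) = theta3 0 u := by
  rw [show u + 6 = u + 2 + 2 + 2 by ring, theta3_add_two, theta3_add_two, theta3_add_two]

lemma hauptS_add_two (u : ℂ) : hauptS (u + 2) = hauptS u := by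
  rw [hauptS, hauptS, show 3 * (u + 2) = 3 * u + 6 by ring, theta3_add_two, theta3_add_six]

end

/-! The action on the upper half plane. -/

lemma cuspMat_zero_smul (u : ℍ) : cuspMat 0 • u = u := by simp [cuspMat]

lemma coe_cuspMat_one_smul (u : ℍ) : ((cuspMat 1 • u : ℍ) : ℂ) = -1 / u := by
  rw [coe_specialLinearGroup_apply]; simp [cuspMat, ModularGroup.S]

lemma coe_cuspMat_two_smul (u : ℍ) : ((cuspMat 2 • u : ℍ) : ℂ) = 1 - 1 / u := by
  have := u.ne_zero
  rw [coe_specialLinearGroup_apply]; simp [cuspMat]; field_simp; ring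

lemma coe_cuspMat_three_smul (u : ℍ) : ((cuspMat 3 • u : ℍ) : ℂ) = u / (3 * u + 1) := by
  rw [coe_specialLinearGroup_apply]; simp [cuspMat]

/-- A function that is periodic at the cusps `∞, 1, 1 / 3` is invariant under the group. -/
lemma invariant_of_periodic {f : ℍ → ℂ} (h0 : ∀ u, f (cuspMat 0 • ((2 : ℝ) +ᵥ u)) = f (cuspMat 0 • u))
    (h2 : ∀ u, f (cuspMat 2 • ((3 : ℝ) +ᵥ u)) = f (cuspMat 2 • u))
    (h3 : ∀ u, f (cuspMat 3 • ((1 : ℝ) +ᵥ u)) = f (cuspMat 3 • u)) :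
    ∀ g ∈ intHeunGroup, ∀ τ, f (g • τ) = f τ := by
  have key : ∀ c : Fin 4, (∀ u, f (cuspMat c • ((cuspWidth c : ℝ) +ᵥ u)) = f (cuspMat c • u)) →
      ∀ τ, f (cuspGen c • τ) = f τ := by
    intro c h τ
    obtain ⟨u, rfl⟩ : ∃ u : ℍ, τ = cuspMat c • ModularGroup.T ^ cuspWidth c • u :=
      ⟨(ModularGroup.T ^ cuspWidth c)⁻¹ • (cuspMat c)⁻¹ • τ, by simp⟩
    have e := modular_T_zpow_smul u (cuspWidth c)
    rw [zpow_natCast, Int.cast_natCast] at e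
    rw [← mul_smul, ← mul_smul, cuspMat_mul_T_pow, e, h]
  intro g hg
  -- No condition at the cusp 0 is needed: its generator is a product of the other three.
  induction hg using Subgroup.closure_induction with
  | mem x hx =>
    rcases hx with rfl | rfl | rfl
    · exact key 3 (by simpa [cuspWidth] using h3)
    · exact key 2 (by simpa [cuspWidth] using h2)
    · exact key 0 (by simpa [cuspWidth] using h0)
  | one => simp
  | mul x y _ _ hx hy => intro τ; rw [mul_smul, hx, hy]
  | inv x _ hx => intro τ; rw [← hx (x⁻¹ • τ), smul_inv_smul]

end

noncomputable section

/-! ### Modular identities -/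

lemma tendsto_nome_atImInfty : Tendsto (fun u : ℍ => nome u) atImInfty (𝓝[≠] 0) := by
  refine tendsto_nhdsWithin_iff.mpr ⟨?_, Eventually.of_forall fun u => nome_ne_zero u⟩
  rw [tendsto_zero_iff_norm_tendsto_zero]
  have e : (fun u : ℍ => ‖nome u‖) = fun u : ℍ => Real.exp (-(Real.pi * u.im)) := by
    funext u; rw [nome, Complex.norm_exp]; congr 1; simp
  rw [e]
  exact Real.tendsto_exp_neg_atTop_nhds_zero.comp
    ((tendsto_comap (f := UpperHalfPlane.im)).const_mul_atTop Real.pi_pos)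

lemma im_div_three {u : ℂ} (hu : 0 < u.im) : 0 < (u / 3).im := by simpa using hu

lemma tendsto_nome_div_three_atImInfty : Tendsto (fun u : ℍ => nome (u / 3)) atImInfty (𝓝[≠] 0) := by
  let f : ℍ → ℍ := fun u => ⟨u / 3, im_div_three u.im_pos⟩
  have hf : Tendsto f atImInfty atImInfty := by
    rw [atImInfty, tendsto_comap_iff]
    have : UpperHalfPlane.im ∘ f = fun u => u.im / 3 := by
      funext u; change ((u : ℂ) / 3).im = _; simp
    rw [this]
    exact (tendsto_comap (f := UpperHalfPlane.im)).atTop_div_const (by norm_num)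
  exact tendsto_nome_atImInfty.comp hf

lemma isBoundedAtImInfty_comp {F : ℂ → ℂ} (hF : ContinuousAt F 0) {n : ℍ → ℂ}
    (hn : Tendsto n atImInfty (𝓝[≠] 0)) {f : ℍ → ℂ} (h : ∀ u, f u = F (n u)) :
    IsBoundedAtImInfty f := by
  rw [funext h, IsBoundedAtImInfty, BoundedAtFilter]
  exact (hF.tendsto.isBigO_one ℝ).comp_tendsto (hn.mono_right nhdsWithin_le_nhds)

lemma differentiableAt_comp_ofComplex {g : ℂ → ℂ} {τ : ℍ} (h : DifferentiableAt ℂ g τ) :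
    DifferentiableAt ℂ ((fun t : ℍ => g t) ∘ ofComplex) τ := by
  refine h.congr_of_eventuallyEq ?_
  filter_upwards [isOpen_upperHalfPlaneSet.mem_nhds τ.im_pos] with z hz
  simp only [Function.comp_apply, ofComplex_apply_of_im_pos hz]

lemma nome_add_two (u : ℂ) : nome (u + 2) = nome u := by
  rw [show u + 2 = u + 1 + 1 by ring, nome_add_one, nome_add_one, neg_neg]

/-- A modular function that is regular at all cusps equals its value at the cusp `∞`. -/
theorem eq_value_of_regular {g F0 F1 F2 F3 : ℂ → ℂ}
    (hd : ∀ τ : ℂ, 0 < τ.im → DifferentiableAt ℂ g τ)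
    (p2 : ∀ v : ℂ, 0 < v.im → g (1 - 1 / (3 * (v + 1))) = g (1 - 1 / (3 * v)))
    (p3 : ∀ u : ℂ, 0 < u.im → g ((u + 1) / (3 * (u + 1) + 1)) = g (u / (3 * u + 1)))
    (c0 : ContinuousAt F0 0) (c1 : ContinuousAt F1 0) (c2 : ContinuousAt F2 0)
    (c3 : ContinuousAt F3 0)
    (e0 : ∀ u : ℂ, 0 < u.im → g u = F0 (nome u))
    (e1 : ∀ v : ℂ, 0 < v.im → g (-1 / (3 * v)) = F1 (nome v))
    (e2 : ∀ v : ℂ, 0 < v.im → g (1 - 1 / (3 * v)) = F2 (nome v))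
    (e3 : ∀ u : ℂ, 0 < u.im → g (u / (3 * u + 1)) = F3 (nome u)) {τ : ℂ} (hτ : 0 < τ.im) :
    g τ = F0 0 := by
  -- At ∞ the width 2 is the period of the nome, so the expansion alone gives invariance. At 1 and
  -- 1/3 the nome merely changes sign under a full width, which is why `p2` and `p3` are separate
  -- hypotheses.
  obtain ⟨a, ha⟩ := eq_const_of_bounded (f := fun t : ℍ => g t)
    (fun t => differentiableAt_comp_ofComplex (hd t t.im_pos))
    (invariant_of_periodic (f := fun t : ℍ => g t)
      (fun u => by
        rw [cuspMat_zero_smul, cuspMat_zero_smul]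
        have h2 : 0 < ((u : ℂ) + 2).im := by simpa using u.im_pos
        have : (((2 : ℝ) +ᵥ u : ℍ) : ℂ) = u + 2 := by simp [add_comm]
        rw [this, e0 _ u.im_pos, e0 _ h2, nome_add_two])
      (fun u => by
        rw [coe_cuspMat_two_smul, coe_cuspMat_two_smul]
        have h := p2 _ (im_div_three u.im_pos)
        have : (((3 : ℝ) +ᵥ u : ℍ) : ℂ) = 3 * (u / 3 + 1) := by simp; ring
        rw [this, h, mul_div_cancel₀ _ (three_ne_zero' ℂ)])
      (fun u => by
        rw [coe_cuspMat_three_smul, coe_cuspMat_three_smul]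
        have : (((1 : ℝ) +ᵥ u : ℍ) : ℂ) = u + 1 := by simp [add_comm]
        rw [this, p3 _ u.im_pos]))
    (fun c => by
      have h3 : ∀ u : ℍ, 3 * ((u : ℂ) / 3) = u := fun u => mul_div_cancel₀ _ (three_ne_zero' ℂ)
      fin_cases c
      · exact isBoundedAtImInfty_comp c0 tendsto_nome_atImInfty fun u => by
          rw [← e0 _ u.im_pos]
          exact congrArg (fun t : ℍ => g t) (cuspMat_zero_smul u)
      · exact isBoundedAtImInfty_comp c1 tendsto_nome_div_three_atImInfty fun u => by
          rw [← e1 _ (im_div_three u.im_pos), h3]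
          exact congrArg g (coe_cuspMat_one_smul u)
      · exact isBoundedAtImInfty_comp c2 tendsto_nome_div_three_atImInfty fun u => by
          rw [← e2 _ (im_div_three u.im_pos), h3]
          exact congrArg g (coe_cuspMat_two_smul u)
      · exact isBoundedAtImInfty_comp c3 tendsto_nome_atImInfty fun u => by
          rw [← e3 _ u.im_pos]
          exact congrArg g (coe_cuspMat_three_smul u))
  have hlim : Tendsto (fun u : ℍ => g u) atImInfty (𝓝 (F0 0)) := by
    have : (fun u : ℍ => g u) = fun u : ℍ => F0 (nome u) := funext fun u => e0 u u.im_pos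
    rw [this]
    exact c0.tendsto.comp (tendsto_nome_atImInfty.mono_right nhdsWithin_le_nhds)
  rw [funext ha] at hlim
  have := tendsto_nhds_unique hlim tendsto_const_nhds
  rw [this]; exact ha ⟨τ, hτ⟩

/-! Expansions at the cusps. -/

/-- `ϑ₃ (3 τ) / ϑ₃ (τ)` as a function of the nome. -/
def phi3 (r : ℂ) : ℂ := sqSeries (r ^ 3) / sqSeries r

/-- `q⁻¹ᐟ² ϑ₂ (3 τ) / ϑ₂ (τ)` as a function of the square of the nome. -/
def phi2 (R : ℂ) : ℂ := triSeries (R ^ 3) / triSeries R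

/-- `cubP / 4` as a function of the nome. -/
def expP (r : ℂ) : ℂ := (triSeries (r ^ 2) / sqSeries r) ^ 3 * (sqSeries (r ^ 3) / triSeries (r ^ 6))

/-- `cubQ` as a function of the nome. -/
def expQ (r : ℂ) : ℂ := (sqSeries (-r) / sqSeries r) ^ 3 * (sqSeries (r ^ 3) / sqSeries (-r ^ 3))

/-- `cubP' / (4 q²)` as a function of the nome. -/
def expP' (r : ℂ) : ℂ :=
  (triSeries (r ^ 6) / sqSeries (r ^ 3)) ^ 3 * (sqSeries r / triSeries (r ^ 2))

/-- `cubQ'` as a function of the nome. -/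
def expQ' (r : ℂ) : ℂ := (sqSeries (-r ^ 3) / sqSeries (r ^ 3)) ^ 3 * (sqSeries r / sqSeries (-r))

lemma AnalyticAt.comp_fixing_zero {f g : ℂ → ℂ} (hf : AnalyticAt ℂ f 0) (hg : AnalyticAt ℂ g 0)
    (h0 : g 0 = 0) : AnalyticAt ℂ (fun r => f (g r)) 0 :=
  AnalyticAt.fun_comp (by rwa [h0]) hg

section analytic

lemma sqSeries_analytic_pow (n : ℕ) (hn : n ≠ 0) : AnalyticAt ℂ (fun r => sqSeries (r ^ n)) 0 :=
  analyticAt_sqSeries.comp_fixing_zero (by fun_prop) (zero_pow hn)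
lemma sqSeries_analytic_neg_pow (n : ℕ) (hn : n ≠ 0) :
    AnalyticAt ℂ (fun r => sqSeries (-r ^ n)) 0 :=
  analyticAt_sqSeries.comp_fixing_zero (by fun_prop) (by simp [hn])
lemma sqSeries_analytic_neg : AnalyticAt ℂ (fun r => sqSeries (-r)) 0 :=
  analyticAt_sqSeries.comp_fixing_zero (by fun_prop) (by simp)
lemma triSeries_analytic_pow (n : ℕ) (hn : n ≠ 0) : AnalyticAt ℂ (fun r => triSeries (r ^ n)) 0 :=
  analyticAt_triSeries.comp_fixing_zero (by fun_prop) (zero_pow hn)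

lemma analyticAt_phi3 : AnalyticAt ℂ phi3 0 :=
  (sqSeries_analytic_pow 3 (by norm_num)).div analyticAt_sqSeries (by simp [sqSeries_zero])
lemma analyticAt_phi2 : AnalyticAt ℂ phi2 0 :=
  (triSeries_analytic_pow 3 (by norm_num)).div analyticAt_triSeries (by simp [triSeries_zero])
lemma analyticAt_expP : AnalyticAt ℂ expP 0 :=
  (((triSeries_analytic_pow 2 (by norm_num)).div analyticAt_sqSeries (by simp [sqSeries_zero])).pow
    3).mul ((sqSeries_analytic_pow 3 (by norm_num)).div (triSeries_analytic_pow 6 (by norm_num))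
      (by simp [triSeries_zero]))
lemma analyticAt_expQ : AnalyticAt ℂ expQ 0 :=
  ((sqSeries_analytic_neg.div analyticAt_sqSeries (by simp [sqSeries_zero])).pow
    3).mul ((sqSeries_analytic_pow 3 (by norm_num)).div (sqSeries_analytic_neg_pow 3 (by norm_num))
      (by simp [sqSeries_zero]))
lemma analyticAt_expP' : AnalyticAt ℂ expP' 0 :=
  (((triSeries_analytic_pow 6 (by norm_num)).div (sqSeries_analytic_pow 3 (by norm_num))
    (by simp [sqSeries_zero])).pow 3).mul (analyticAt_sqSeries.div
      (triSeries_analytic_pow 2 (by norm_num)) (by simp [triSeries_zero]))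
lemma analyticAt_expQ' : AnalyticAt ℂ expQ' 0 :=
  (((sqSeries_analytic_neg_pow 3 (by norm_num)).div (sqSeries_analytic_pow 3 (by norm_num))
    (by simp [sqSeries_zero])).pow 3).mul (analyticAt_sqSeries.div
      sqSeries_analytic_neg (by simp [sqSeries_zero]))

lemma phi3_zero : phi3 0 = 1 := by simp [phi3, sqSeries_zero]
lemma phi2_zero : phi2 0 = 1 := by simp [phi2, triSeries_zero]
lemma expP_zero : expP 0 = 1 := by simp [expP, sqSeries_zero, triSeries_zero]
lemma expQ_zero : expQ 0 = 1 := by simp [expQ, sqSeries_zero]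
lemma expP'_zero : expP' 0 = 1 := by simp [expP', sqSeries_zero, triSeries_zero]
lemma expQ'_zero : expQ' 0 = 1 := by simp [expQ', sqSeries_zero]

/-- The quotient `(f r - f 0) / r`, extended continuously to `r = 0`. -/
lemma sub_eq_mul_dslope (f : ℂ → ℂ) (r : ℂ) : f r - f 0 = r * dslope f 0 r := by
  have := sub_smul_dslope f 0 r
  rw [sub_zero, smul_eq_mul] at this
  exact this.symm

lemma continuousAt_dslope {f : ℂ → ℂ} (hf : AnalyticAt ℂ f 0) : ContinuousAt (dslope f 0) 0 :=
  continuousAt_dslope_same.mpr hf.differentiableAt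

end analytic

section expansions
variable {u : ℂ}

lemma cexp_quarter_pow_four (u : ℂ) : Complex.exp (Real.pi * Complex.I * u / 4) ^ 4 = nome u := by
  rw [nome, ← Complex.exp_nat_mul]; congr 1; push_cast; ring

lemma theta_expansions (hu : 0 < u.im) : theta3 0 u = sqSeries (nome u) ∧
    theta3 0 (3 * u) = sqSeries (nome u ^ 3) ∧ theta4 0 u = sqSeries (-nome u) ∧
    theta4 0 (3 * u) = sqSeries (-nome u ^ 3) ∧
    theta2 0 u = 2 * Complex.exp (Real.pi * Complex.I * u / 4) * triSeries (nome u ^ 2) ∧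
    theta2 0 (3 * u) = 2 * Complex.exp (Real.pi * Complex.I * u / 4) ^ 3 * triSeries (nome u ^ 6) := by
  have h3 := im_three_mul hu
  refine ⟨theta3_eq_sqSeries hu, ?_, theta4_eq_sqSeries hu, ?_, theta2_eq_triSeries hu, ?_⟩
  · rw [theta3_eq_sqSeries h3, nome_three_mul]
  · rw [theta4_eq_sqSeries h3, nome_three_mul]
  · rw [theta2_eq_triSeries h3, nome_three_mul, cexp_quarter_three, ← pow_mul]

lemma series_ne_zero (hu : 0 < u.im) : sqSeries (nome u) ≠ 0 ∧ sqSeries (nome u ^ 3) ≠ 0 ∧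
    sqSeries (-nome u) ≠ 0 ∧ sqSeries (-nome u ^ 3) ≠ 0 ∧ triSeries (nome u ^ 2) ≠ 0 ∧
    triSeries (nome u ^ 6) ≠ 0 := by
  have h3 := im_three_mul hu
  obtain ⟨e1, e2, e3, e4, e5, e6⟩ := theta_expansions hu
  refine ⟨e1 ▸ theta3_ne_zero hu, e2 ▸ theta3_ne_zero h3, e3 ▸ theta4_ne_zero hu,
    e4 ▸ theta4_ne_zero h3, fun h => ?_, fun h => ?_⟩
  · exact theta2_ne_zero hu (by rw [e5, h, mul_zero])
  · exact theta2_ne_zero h3 (by rw [e6, h, mul_zero])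

lemma cub_expansions (hu : 0 < u.im) : cubP u = 4 * expP (nome u) ∧ cubQ u = expQ (nome u) ∧
    cubP' u = 4 * nome u ^ 2 * expP' (nome u) ∧ cubQ' u = expQ' (nome u) := by
  obtain ⟨e1, e2, e3, e4, e5, e6⟩ := theta_expansions hu
  obtain ⟨n1, n2, n3, n4, n5, n6⟩ := series_ne_zero hu
  have hr := cexp_quarter_pow_four u
  have hr0 : Complex.exp (Real.pi * Complex.I * u / 4) ≠ 0 := Complex.exp_ne_zero _
  refine ⟨?_, ?_, ?_, ?_⟩
  · rw [cubP, thetaX, thetaX, e1, e2, e5, e6, expP]; field_simp; norm_num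
  · rw [cubQ, thetaY, thetaY, e1, e2, e3, e4, expQ]; field_simp
  · rw [cubP', thetaX, thetaX, e1, e2, e5, e6, expP']
    have h8 : Complex.exp (Real.pi * Complex.I * u / 4) ^ 8 = nome u ^ 2 := by rw [← hr]; ring
    field_simp
    linear_combination 4 * h8
  · rw [cubQ', thetaY, thetaY, e1, e2, e3, e4, expQ']; field_simp

lemma hauptS_expansion (hu : 0 < u.im) : hauptS u = 9 * phi3 (nome u) ^ 4 := by
  obtain ⟨e1, e2, -⟩ := theta_expansions hu
  rw [hauptS, e1, e2, phi3, div_pow, mul_div]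

lemma hauptS_cusp_zero_expansion (hu : 0 < u.im) :
    hauptS (-1 / (3 * u)) = (phi3 (nome u) ^ 4)⁻¹ := by
  obtain ⟨e1, e2, -⟩ := theta_expansions hu
  rw [hauptS_cusp_zero hu, e1, e2, phi3, div_pow, inv_div]

lemma theta2_pow_four_expansion (hu : 0 < u.im) :
    theta2 0 u ^ 4 = 16 * nome u * triSeries (nome u ^ 2) ^ 4 := by
  rw [theta2_eq_triSeries hu, mul_pow, mul_pow, cexp_quarter_pow_four]; norm_num

lemma theta2_three_pow_four_expansion (hu : 0 < u.im) :
    theta2 0 (3 * u) ^ 4 = 16 * nome u ^ 3 * triSeries (nome u ^ 6) ^ 4 := by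
  rw [theta2_pow_four_expansion (im_three_mul hu), nome_three_mul, ← pow_mul]

lemma hauptS_cusp_one_expansion (hu : 0 < u.im) :
    hauptS (1 - 1 / (3 * u)) = (nome u ^ 2 * phi2 (nome u ^ 2) ^ 4)⁻¹ := by
  obtain ⟨n1, n2, n3, n4, n5, n6⟩ := series_ne_zero hu
  have h0 := nome_ne_zero u
  rw [hauptS_cusp_one hu, theta2_pow_four_expansion hu, theta2_three_pow_four_expansion hu, phi2,
    ← pow_mul]
  field_simp

lemma hauptS_cusp_third_expansion (hu : 0 < u.im) :
    hauptS (u / (3 * u + 1)) = 9 * nome u ^ 2 * phi2 (nome u ^ 2) ^ 4 := by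
  obtain ⟨n1, n2, n3, n4, n5, n6⟩ := series_ne_zero hu
  have h0 := nome_ne_zero u
  rw [hauptS_cusp_third hu, theta2_pow_four_expansion hu, theta2_three_pow_four_expansion hu, phi2,
    ← pow_mul]
  field_simp

lemma phi_ne_zero (hu : 0 < u.im) : phi3 (nome u) ≠ 0 ∧ phi2 (nome u ^ 2) ≠ 0 := by
  obtain ⟨n1, n2, n3, n4, n5, n6⟩ := series_ne_zero hu
  rw [phi3, phi2, ← pow_mul]
  exact ⟨div_ne_zero n2 n1, div_ne_zero n6 n5⟩

end expansions

lemma differentiableAt_cubP {τ : ℂ} (hτ : 0 < τ.im) : DifferentiableAt ℂ cubP τ :=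
  ((differentiableAt_thetaX hτ).pow 3).div (differentiableAt_comp_three differentiableAt_thetaX hτ)
    (thetaX_ne_zero (im_three_mul hτ))

lemma differentiableAt_cubQ {τ : ℂ} (hτ : 0 < τ.im) : DifferentiableAt ℂ cubQ τ :=
  ((differentiableAt_thetaY hτ).pow 3).div (differentiableAt_comp_three differentiableAt_thetaY hτ)
    (thetaY_ne_zero (im_three_mul hτ))

lemma hauptS_cusp_one_periodic {v : ℂ} (hv : 0 < v.im) :
    hauptS (1 - 1 / (3 * (v + 1))) = hauptS (1 - 1 / (3 * v)) := by
  rw [hauptS_cusp_one_expansion hv, hauptS_cusp_one_expansion (im_add_one hv), nome_add_one, neg_sq]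

lemma hauptS_cusp_third_periodic {u : ℂ} (hu : 0 < u.im) :
    hauptS ((u + 1) / (3 * (u + 1) + 1)) = hauptS (u / (3 * u + 1)) := by
  rw [hauptS_cusp_third_expansion hu, hauptS_cusp_third_expansion (im_add_one hu), nome_add_one, neg_sq]

lemma cub_cusp_one_periodic {v : ℂ} (hv : 0 < v.im) :
    cubP (1 - 1 / (3 * (v + 1))) = cubQ (1 - 1 / (3 * v)) ∧
    cubQ (1 - 1 / (3 * (v + 1))) = cubP (1 - 1 / (3 * v)) := by
  have := cubP'_ne_zero hv
  have := cubQ'_ne_zero hv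
  obtain ⟨e1, e2⟩ := cub_cusp_one hv
  obtain ⟨e3, e4⟩ := cub_cusp_one (im_add_one hv)
  rw [e1, e2, e3, e4, cubP'_add_one hv, cubQ'_add_one hv]
  constructor <;> field_simp

lemma cub_cusp_third_periodic {u : ℂ} (hu : 0 < u.im) :
    cubP ((u + 1) / (3 * (u + 1) + 1)) = cubQ (u / (3 * u + 1)) ∧
    cubQ ((u + 1) / (3 * (u + 1) + 1)) = cubP (u / (3 * u + 1)) := by
  have := cubP_ne_zero hu
  have := cubQ_ne_zero hu
  obtain ⟨e1, e2⟩ := cub_cusp_third hu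
  obtain ⟨e3, e4⟩ := cub_cusp_third (im_add_one hu)
  rw [e1, e2, e3, e4, cubP_add_one hu, cubQ_add_one hu]
  constructor <;> field_simp

/-- The generators at the cusps 1 and 1/3 exchange P and Q, so only the square of P − Q is
invariant. The quotient by s is regular at all four cusps, and at ∞ it equals (4−1)²/9 = 1. -/
lemma cubP_sub_cubQ_sq {τ : ℂ} (hτ : 0 < τ.im) : (cubP τ - cubQ τ) ^ 2 = hauptS τ := by
  have cp := analyticAt_expP.continuousAt
  have cq := analyticAt_expQ.continuousAt
  have cp' := analyticAt_expP'.continuousAt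
  have cq' := analyticAt_expQ'.continuousAt
  have c3 := analyticAt_phi3.continuousAt
  have c2 : ContinuousAt (fun r => phi2 (r ^ 2)) 0 :=
    (analyticAt_phi2.comp_fixing_zero (g := fun r => r ^ 2) (by fun_prop) (by simp)).continuousAt
  have cd := continuousAt_dslope analyticAt_expQ
  have cd' := continuousAt_dslope analyticAt_expQ'
  have h := eq_value_of_regular (g := fun t => (cubP t - cubQ t) ^ 2 / hauptS t)
    (F0 := fun r => (4 * expP r - expQ r) ^ 2 / (9 * phi3 r ^ 4))
    (F1 := fun r => (expQ' r - 4 * r ^ 2 * expP' r) ^ 2 * phi3 r ^ 4)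
    -- At the cusp 1, P − Q = (Q′ − 1)/P′. The numerator is divisible by r, P′ is divisible by r²
    -- and 1/s by r²; all powers of r cancel in the square. `dslope` carries out the division at r =
    -- 0.
    (F2 := fun r => dslope expQ' 0 r ^ 2 / (16 * expP' r ^ 2) * phi2 (r ^ 2) ^ 4)
    (F3 := fun r => dslope expQ 0 r ^ 2 / (16 * expP r ^ 2 * (9 * phi2 (r ^ 2) ^ 4)))
    (fun t ht => (((differentiableAt_cubP ht).sub (differentiableAt_cubQ ht)).pow 2).div
      (differentiableAt_hauptS ht) (hauptS_ne_zero ht))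
    (fun v hv => by
      obtain ⟨e1, e2⟩ := cub_cusp_one_periodic hv
      simp only [e1, e2, hauptS_cusp_one_periodic hv]; ring)
    (fun u hu => by
      obtain ⟨e1, e2⟩ := cub_cusp_third_periodic hu
      simp only [e1, e2, hauptS_cusp_third_periodic hu]; ring)
    (by apply ContinuousAt.div₀ <;> first | fun_prop | simp [phi3_zero])
    (by fun_prop)
    (by
      refine ContinuousAt.mul (ContinuousAt.div₀ (by fun_prop) (by fun_prop) ?_) (by fun_prop)
      simp [expP'_zero])
    (by apply ContinuousAt.div₀ <;> first | fun_prop | simp [expP_zero, phi2_zero])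
    (fun u hu => by
      obtain ⟨e1, e2, -⟩ := cub_expansions hu
      simp only [e1, e2, hauptS_expansion hu])
    (fun v hv => by
      obtain ⟨-, -, e1, e2⟩ := cub_expansions hv
      obtain ⟨f1, f2⟩ := cub_cusp_zero hv
      simp only [f1, f2, e1, e2, hauptS_cusp_zero_expansion hv, div_inv_eq_mul])
    (fun v hv => by
      obtain ⟨-, -, e1, e2⟩ := cub_expansions hv
      obtain ⟨f1, f2⟩ := cub_cusp_one hv
      have n1 := cubP'_ne_zero hv
      have n2 := nome_ne_zero v
      rw [e1] at n1
      have n3 : expP' (nome v) ≠ 0 := right_ne_zero_of_mul n1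
      have d := sub_eq_mul_dslope expQ' (nome v)
      rw [expQ'_zero] at d
      simp only [f1, f2, e1, e2, hauptS_cusp_one_expansion hv, div_inv_eq_mul]
      rw [show expQ' (nome v) = 1 + nome v * dslope expQ' 0 (nome v) by rw [← d]; ring]
      field_simp
      ring)
    (fun u hu => by
      obtain ⟨e1, e2, -⟩ := cub_expansions hu
      obtain ⟨f1, f2⟩ := cub_cusp_third hu
      have n1 := cubP_ne_zero hu
      have n2 := nome_ne_zero u
      have n4 := (phi_ne_zero hu).2
      rw [e1] at n1
      have n3 : expP (nome u) ≠ 0 := right_ne_zero_of_mul n1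
      have d := sub_eq_mul_dslope expQ (nome u)
      rw [expQ_zero] at d
      simp only [f1, f2, e1, e2, hauptS_cusp_third_expansion hu]
      rw [show expQ (nome u) = 1 + nome u * dslope expQ 0 (nome u) by rw [← d]; ring]
      field_simp
      ring) hτ
  simp only [expP_zero, expQ_zero, phi3_zero] at h
  rw [div_eq_iff (hauptS_ne_zero hτ)] at h
  rw [h]; norm_num

/-- The same principle, with PQ invariant and free of zeros. At ∞ the quotient is (9−1)²/(4·1) = 16.
-/
lemma hauptS_sub_one_sq {τ : ℂ} (hτ : 0 < τ.im) : (hauptS τ - 1) ^ 2 = 16 * cubP τ * cubQ τ := by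
  have cp := analyticAt_expP.continuousAt
  have cq := analyticAt_expQ.continuousAt
  have cp' := analyticAt_expP'.continuousAt
  have cq' := analyticAt_expQ'.continuousAt
  have c3 := analyticAt_phi3.continuousAt
  have c2 : ContinuousAt (fun r => phi2 (r ^ 2)) 0 :=
    (analyticAt_phi2.comp_fixing_zero (g := fun r => r ^ 2) (by fun_prop) (by simp)).continuousAt
  have cd := continuousAt_dslope ((analyticAt_phi3.pow 4).inv (by simp [phi3_zero]))
  have h := eq_value_of_regular (g := fun t => (hauptS t - 1) ^ 2 / (cubP t * cubQ t))
    (F0 := fun r => (9 * phi3 r ^ 4 - 1) ^ 2 / (4 * expP r * expQ r))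
    -- At the cusp 0 the value of s is 1, so s − 1 is divisible by r; its square cancels the factor
    -- r² of PQ.
    (F1 := fun r => dslope (phi3 ^ 4)⁻¹ 0 r ^ 2 / (4 * expQ' r * expP' r))
    (F2 := fun r => 16 * expP' r ^ 2 * ((phi2 (r ^ 2) ^ 4)⁻¹ - r ^ 2) ^ 2 / expQ' r)
    (F3 := fun r => (9 * r ^ 2 * phi2 (r ^ 2) ^ 4 - 1) ^ 2 * (16 * expP r ^ 2) / expQ r)
    (fun t ht => (((differentiableAt_hauptS ht).sub_const 1).pow 2).div
      ((differentiableAt_cubP ht).mul (differentiableAt_cubQ ht))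
      (mul_ne_zero (cubP_ne_zero ht) (cubQ_ne_zero ht)))
    (fun v hv => by
      obtain ⟨e1, e2⟩ := cub_cusp_one_periodic hv
      simp only [e1, e2, hauptS_cusp_one_periodic hv]; ring)
    (fun u hu => by
      obtain ⟨e1, e2⟩ := cub_cusp_third_periodic hu
      simp only [e1, e2, hauptS_cusp_third_periodic hu]; ring)
    (by apply ContinuousAt.div₀ <;> first | fun_prop | simp [expP_zero, expQ_zero])
    (by apply ContinuousAt.div₀ <;> first | fun_prop | simp [expP'_zero, expQ'_zero])
    (by
      have : ContinuousAt (fun r => (phi2 (r ^ 2) ^ 4)⁻¹) 0 :=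
        ContinuousAt.inv₀ (by fun_prop) (by simp [phi2_zero])
      apply ContinuousAt.div₀ <;> first | fun_prop | simp [expQ'_zero])
    (by apply ContinuousAt.div₀ <;> first | fun_prop | simp [expQ_zero])
    (fun u hu => by
      obtain ⟨e1, e2, -⟩ := cub_expansions hu
      simp only [e1, e2, hauptS_expansion hu])
    (fun v hv => by
      obtain ⟨-, -, e1, e2⟩ := cub_expansions hv
      obtain ⟨f1, f2⟩ := cub_cusp_zero hv
      have n2 := nome_ne_zero v
      have d := sub_eq_mul_dslope (phi3 ^ 4)⁻¹ (nome v)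
      simp only [Pi.inv_apply, Pi.pow_apply, phi3_zero, one_pow, inv_one] at d
      simp only [f1, f2, e1, e2, hauptS_cusp_zero_expansion hv]
      rw [d]
      field_simp)
    (fun v hv => by
      obtain ⟨-, -, e1, e2⟩ := cub_expansions hv
      obtain ⟨f1, f2⟩ := cub_cusp_one hv
      have n1 := cubP'_ne_zero hv
      have n2 := nome_ne_zero v
      have n4 := (phi_ne_zero hv).2
      rw [e1] at n1
      have n3 : expP' (nome v) ≠ 0 := right_ne_zero_of_mul n1
      simp only [f1, f2, e1, e2, hauptS_cusp_one_expansion hv]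
      field_simp
      ring)
    (fun u hu => by
      obtain ⟨e1, e2, -⟩ := cub_expansions hu
      obtain ⟨f1, f2⟩ := cub_cusp_third hu
      have n1 := cubP_ne_zero hu
      rw [e1] at n1
      have n3 : expP (nome u) ≠ 0 := right_ne_zero_of_mul n1
      simp only [f1, f2, e1, e2, hauptS_cusp_third_expansion hu]
      field_simp
      ring) hτ
  simp only [expP_zero, expQ_zero, phi3_zero] at h
  rw [div_eq_iff (mul_ne_zero (cubP_ne_zero hτ) (cubQ_ne_zero hτ))] at h
  rw [h]; norm_num; ring

end

noncomputable section

/-! ### The rational parametrization by `multZ` -/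

lemma convex_im_pos : Convex ℝ {z : ℂ | 0 < z.im} := convex_halfSpace_im_gt 0

lemma isPreconnected_im_pos : IsPreconnected {z : ℂ | 0 < z.im} := convex_im_pos.isPreconnected

lemma analyticOnNhd_im_pos {f : ℂ → ℂ} (hf : ∀ τ : ℂ, 0 < τ.im → DifferentiableAt ℂ f τ) :
    AnalyticOnNhd ℂ f {z : ℂ | 0 < z.im} :=
  DifferentiableOn.analyticOnNhd (fun τ hτ => (hf τ hτ).differentiableWithinAt)
    isOpen_upperHalfPlaneSet

/-- Two holomorphic functions with the same square and the same nonzero limit at `i ∞` agree. -/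
lemma eq_of_sq_eq_of_tendsto {f g : ℂ → ℂ} (hf : ∀ τ : ℂ, 0 < τ.im → DifferentiableAt ℂ f τ)
    (hg : ∀ τ : ℂ, 0 < τ.im → DifferentiableAt ℂ g τ)
    (hsq : ∀ τ : ℂ, 0 < τ.im → f τ ^ 2 = g τ ^ 2) {l : ℂ} (hl : l ≠ 0)
    (lf : Tendsto (fun u : ℍ => f u) atImInfty (𝓝 l))
    (lg : Tendsto (fun u : ℍ => g u) atImInfty (𝓝 l)) {τ : ℂ} (hτ : 0 < τ.im) : f τ = g τ := by
  -- (f − g)(f + g) = 0, and analytic functions on a connected set have no zero divisors. The case f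
  -- = −g is excluded by the nonzero common limit.
  have h := ((analyticOnNhd_im_pos hf).sub (analyticOnNhd_im_pos hg)).eq_zero_or_eq_zero_of_mul_eq_zero
    ((analyticOnNhd_im_pos hf).add (analyticOnNhd_im_pos hg))
    (fun z hz => by simp only [Pi.sub_apply, Pi.add_apply]; linear_combination hsq z hz)
    isPreconnected_im_pos
  rcases h with h | h
  · exact sub_eq_zero.mp (h τ hτ)
  · have e : (fun u : ℍ => f u) = fun u : ℍ => -g u :=
      funext fun u => eq_neg_of_add_eq_zero_left (h u u.im_pos)
    rw [e] at lf
    exact absurd (tendsto_nhds_unique lf lg.neg) (by rwa [self_eq_neg])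

lemma tendsto_of_expansion {F f : ℂ → ℂ} (hF : ContinuousAt F 0)
    (h : ∀ u : ℂ, 0 < u.im → f u = F (nome u)) :
    Tendsto (fun u : ℍ => f u) atImInfty (𝓝 (F 0)) := by
  rw [show (fun u : ℍ => f u) = fun u : ℍ => F (nome u) from funext fun u => h u u.im_pos]
  exact hF.tendsto.comp (tendsto_nome_atImInfty.mono_right nhdsWithin_le_nhds)

lemma multZ_expansion {u : ℂ} (hu : 0 < u.im) : multZ u = 3 * phi3 (nome u) ^ 2 := by
  obtain ⟨e1, e2, -⟩ := theta_expansions hu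
  rw [multZ, e1, e2, phi3, div_pow, mul_div]

lemma tendsto_multZ : Tendsto (fun u : ℍ => multZ u) atImInfty (𝓝 3) := by
  have := tendsto_of_expansion (F := fun r => 3 * phi3 r ^ 2)
    (by have := analyticAt_phi3.continuousAt; fun_prop) fun u hu => multZ_expansion hu
  simpa [phi3_zero] using this

lemma tendsto_cubP : Tendsto (fun u : ℍ => cubP u) atImInfty (𝓝 4) := by
  have := tendsto_of_expansion (F := fun r => 4 * expP r)
    (by have := analyticAt_expP.continuousAt; fun_prop) fun u hu => (cub_expansions hu).1
  simpa [expP_zero] using this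

lemma tendsto_cubQ : Tendsto (fun u : ℍ => cubQ u) atImInfty (𝓝 1) := by
  have := tendsto_of_expansion analyticAt_expQ.continuousAt fun u hu => (cub_expansions hu).2.1
  simpa [expQ_zero] using this

lemma tendsto_thetaY_mul : Tendsto (fun u : ℍ => thetaY u * thetaY (3 * u)) atImInfty (𝓝 1) := by
  have := tendsto_of_expansion (f := fun u => thetaY u * thetaY (3 * u))
    (F := fun r => sqSeries (-r) / sqSeries r * (sqSeries (-r ^ 3) / sqSeries (r ^ 3)))
    (by
      have h1 := analyticAt_sqSeries.continuousAt
      have h2 := sqSeries_analytic_neg.continuousAt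
      have h3 := (sqSeries_analytic_pow 3 (by norm_num)).continuousAt
      have h4 := (sqSeries_analytic_neg_pow 3 (by norm_num)).continuousAt
      exact (h2.div₀ h1 (by simp [sqSeries_zero])).mul (h4.div₀ h3 (by simp [sqSeries_zero])))
    fun u hu => by
      obtain ⟨e1, e2, e3, e4, -⟩ := theta_expansions hu
      simp only [thetaY, e1, e2, e3, e4]
  simpa [sqSeries_zero] using this

section identities
variable {τ : ℂ}

lemma multZ_eq_cub (hτ : 0 < τ.im) : multZ τ = cubP τ - cubQ τ := by
  refine eq_of_sq_eq_of_tendsto (f := multZ) (g := fun t => cubP t - cubQ t) (l := 3)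
    (fun t ht => differentiableAt_multZ ht)
    (fun t ht => (differentiableAt_cubP ht).sub (differentiableAt_cubQ ht))
    (fun t ht => by rw [multZ_sq, cubP_sub_cubQ_sq ht]) three_ne_zero tendsto_multZ ?_ hτ
  have := tendsto_cubP.sub tendsto_cubQ
  norm_num at this
  exact this

/-- (P+Q)² = (P−Q)² + 4PQ = s + (s−1)²/4 = ((s+1)/2)², and the limit 4 + 1 = 5 at i∞ fixes the sign.
With P − Q = z both P and Q become squares of linear polynomials in z. -/
lemma cubP_add_cubQ (hτ : 0 < τ.im) : cubP τ + cubQ τ = (hauptS τ + 1) / 2 := by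
  refine eq_of_sq_eq_of_tendsto (f := fun t => cubP t + cubQ t) (g := fun t => (hauptS t + 1) / 2)
    (l := 5) (fun t ht => (differentiableAt_cubP ht).add (differentiableAt_cubQ ht))
    (fun t ht => ((differentiableAt_hauptS ht).add_const 1).div_const 2)
    (fun t ht => by linear_combination cubP_sub_cubQ_sq ht - hauptS_sub_one_sq ht / 4)
    (by norm_num) ?_ ?_ hτ
  · have := tendsto_cubP.add tendsto_cubQ
    norm_num at this
    exact this
  · have := ((tendsto_multZ.pow 2).add_const 1).div_const 2
    norm_num [multZ_sq] at this
    exact this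

lemma cubP_eq (hτ : 0 < τ.im) : cubP τ = (multZ τ + 1) ^ 2 / 4 := by
  linear_combination (cubP_add_cubQ hτ) / 2 - (multZ_eq_cub hτ) / 2 - multZ_sq τ / 4

lemma cubQ_eq (hτ : 0 < τ.im) : cubQ τ = (multZ τ - 1) ^ 2 / 4 := by
  linear_combination (cubP_add_cubQ hτ) / 2 + (multZ_eq_cub hτ) / 2 - multZ_sq τ / 4

/-- The involution `τ ↦ -1 / (3 τ)`. -/
lemma im_fricke (hτ : 0 < τ.im) : 0 < (-1 / (3 * τ)).im := im_neg_inv (im_three_mul hτ)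

/-- Inversion exchanges ϑ₃(τ) and ϑ₃(3τ) up to factors. Each identity in z therefore has a companion
under z ↦ 3/z, which supplies the formulas for P′, Q′ and ϑ₂ without new cusp computations. -/
lemma multZ_fricke (hτ : 0 < τ.im) : multZ (-1 / (3 * τ)) = 3 / multZ τ := by
  have h0 := ne_zero_of_im_pos hτ
  have := theta3_ne_zero hτ
  have := theta3_ne_zero (im_three_mul hτ)
  rw [multZ, multZ, three_mul_neg_inv, theta3_neg_inv hτ, theta3_neg_inv (im_three_mul hτ), mul_pow,
    mul_pow, sqrtFactor_sq, sqrtFactor_sq]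
  have := Complex.I_ne_zero
  field_simp

lemma cubQ'_eq (hτ : 0 < τ.im) : cubQ' τ = (3 + multZ τ) ^ 2 / (4 * multZ τ ^ 2) := by
  have := multZ_ne_zero hτ
  rw [← (cub_cusp_zero hτ).1, cubP_eq (im_fricke hτ), multZ_fricke hτ]
  field_simp

lemma cubP'_eq (hτ : 0 < τ.im) : cubP' τ = (3 - multZ τ) ^ 2 / (4 * multZ τ ^ 2) := by
  have := multZ_ne_zero hτ
  rw [← (cub_cusp_zero hτ).2, cubQ_eq (im_fricke hτ), multZ_fricke hτ]
  field_simp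

/-- The square of the left side is Q·Q′, already known in terms of z and a perfect square; the limit
1 at i∞ selects the root. -/
lemma thetaY_mul (hτ : 0 < τ.im) :
    thetaY τ * thetaY (3 * τ) = (multZ τ - 1) * (multZ τ + 3) / (4 * multZ τ) := by
  refine eq_of_sq_eq_of_tendsto (f := fun t => thetaY t * thetaY (3 * t))
    (g := fun t => (multZ t - 1) * (multZ t + 3) / (4 * multZ t)) (l := 1)
    (fun t ht => (differentiableAt_thetaY ht).mul (differentiableAt_comp_three differentiableAt_thetaY ht))
    (fun t ht => ?_) (fun t ht => ?_) one_ne_zero tendsto_thetaY_mul ?_ hτ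
  · have := differentiableAt_multZ ht
    have h0 := multZ_ne_zero ht
    fun_prop (disch := simpa using h0)
  · have h1 := multZ_ne_zero ht
    have h2 := thetaY_ne_zero ht
    have h3 := thetaY_ne_zero (im_three_mul ht)
    have : (thetaY t * thetaY (3 * t)) ^ 2 = cubQ t * cubQ' t := by
      rw [cubQ, cubQ']; field_simp
    rw [this, cubQ_eq ht, cubQ'_eq ht]
    field_simp; ring
  · have := ((tendsto_multZ.sub_const 1).mul (tendsto_multZ.add_const 3)).div
      (tendsto_multZ.const_mul 4) (by norm_num)
    norm_num at this
    exact this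

lemma thetaX_mul (hτ : 0 < τ.im) :
    thetaX τ * thetaX (3 * τ) = (3 - multZ τ) * (multZ τ + 1) / (4 * multZ τ) := by
  have h0 := multZ_ne_zero hτ
  have h := thetaY_mul (im_fricke hτ)
  rw [three_mul_neg_inv, thetaY_neg_inv hτ, thetaY_neg_inv (im_three_mul hτ), multZ_fricke hτ] at h
  rw [mul_comm, h]
  field_simp
  ring

/-- At these values one of the products `thetaX_mul`, `thetaY_mul` would vanish, but theta constants
have no zeros. -/
lemma multZ_ne (hτ : 0 < τ.im) : multZ τ ≠ 1 ∧ multZ τ ≠ -1 ∧ multZ τ ≠ 3 ∧ multZ τ ≠ -3 := by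
  have hx := thetaX_mul hτ
  have hy := thetaY_mul hτ
  have nx := mul_ne_zero (thetaX_ne_zero hτ) (thetaX_ne_zero (im_three_mul hτ))
  have ny := mul_ne_zero (thetaY_ne_zero hτ) (thetaY_ne_zero (im_three_mul hτ))
  refine ⟨fun h => ny ?_, fun h => nx ?_, fun h => nx ?_, fun h => ny ?_⟩
  · rw [hy, h]; norm_num
  · rw [hx, h]; norm_num
  · rw [hx, h]; norm_num
  · rw [hy, h]; norm_num

lemma hauptS_ne_one (hτ : 0 < τ.im) : hauptS τ ≠ 1 := by
  obtain ⟨h1, h2, -⟩ := multZ_ne hτ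
  rw [← multZ_sq]
  intro h
  have : (multZ τ - 1) * (multZ τ + 1) = 0 := by linear_combination h
  rcases mul_eq_zero.mp this with h | h
  · exact h1 (sub_eq_zero.mp h)
  · exact h2 (eq_neg_of_add_eq_zero_left h)

lemma hauptS_ne_nine (hτ : 0 < τ.im) : hauptS τ ≠ 9 := by
  obtain ⟨-, -, h1, h2⟩ := multZ_ne hτ
  rw [← multZ_sq]
  intro h
  have : (multZ τ - 3) * (multZ τ + 3) = 0 := by linear_combination h
  rcases mul_eq_zero.mp this with h | h
  · exact h1 (sub_eq_zero.mp h)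
  · exact h2 (eq_neg_of_add_eq_zero_left h)

lemma hauptS_mem_heunDomain (hτ : 0 < τ.im) : hauptS τ ∈ heunDomain := by
  simp [heunDomain, hauptS_ne_zero hτ, hauptS_ne_one hτ, hauptS_ne_nine hτ]

/-- X⁴ is the product of X³/X(3τ) and X·X(3τ), both already rational in z. This is the modular
parametrization behind the modulus in part (2). -/
lemma thetaX_pow_four (hτ : 0 < τ.im) :
    thetaX τ ^ 4 = (multZ τ + 1) ^ 3 * (3 - multZ τ) / (16 * multZ τ) := by
  have h3 := thetaX_ne_zero (im_three_mul hτ)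
  have h0 := multZ_ne_zero hτ
  have : thetaX τ ^ 4 = cubP τ * (thetaX τ * thetaX (3 * τ)) := by rw [cubP]; field_simp
  rw [this, cubP_eq hτ, thetaX_mul hτ]; field_simp; ring

lemma thetaY_pow_four (hτ : 0 < τ.im) :
    thetaY τ ^ 4 = (multZ τ - 1) ^ 3 * (multZ τ + 3) / (16 * multZ τ) := by
  have h3 := thetaY_ne_zero (im_three_mul hτ)
  have h0 := multZ_ne_zero hτ
  have : thetaY τ ^ 4 = cubQ τ * (thetaY τ * thetaY (3 * τ)) := by rw [cubQ]; field_simp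
  rw [this, cubQ_eq hτ, thetaY_mul hτ]; field_simp; ring

lemma thetaX_three_mul_pow_four (hτ : 0 < τ.im) :
    thetaX (3 * τ) ^ 4 = (3 - multZ τ) ^ 3 * (multZ τ + 1) / (16 * multZ τ ^ 3) := by
  have h3 := thetaX_ne_zero hτ
  have h0 := multZ_ne_zero hτ
  have : thetaX (3 * τ) ^ 4 = cubP' τ * (thetaX τ * thetaX (3 * τ)) := by rw [cubP']; field_simp
  rw [this, cubP'_eq hτ, thetaX_mul hτ]; field_simp; ring

lemma hauptZ_eq_multZ (hτ : 0 < τ.im) : hauptZ τ = multZ τ := by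
  have n1 := theta3_ne_zero hτ
  have n2 := theta3_ne_zero (im_three_mul hτ)
  have n3 := theta4_ne_zero (im_three_mul hτ)
  have h0 := multZ_ne_zero hτ
  have hQ := cubQ_eq hτ
  have hX := thetaX_mul hτ
  have e1 : theta4 0 τ ^ 3 / (theta3 0 τ * theta3 0 (3 * τ) * theta4 0 (3 * τ)) =
      3 * cubQ τ / multZ τ := by
    rw [cubQ, thetaY, thetaY, multZ]; field_simp
  have e2 : theta2 0 τ * theta2 0 (3 * τ) / (theta3 0 τ * theta3 0 (3 * τ)) =
      thetaX τ * thetaX (3 * τ) := by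
    rw [thetaX, thetaX]; field_simp
  rw [hauptZ_eq hτ, e1, e2, hQ, hX]
  field_simp
  ring

lemma hauptS_eq_hauptZ_sq (hτ : 0 < τ.im) : hauptS τ = hauptZ τ ^ 2 := by
  rw [hauptZ_eq_multZ hτ, multZ_sq]

end identities

end

noncomputable section

/-! ### The derivative of the uniformizing function -/

lemma hasDerivAt_nome (u : ℂ) : HasDerivAt nome (Real.pi * Complex.I * nome u) u := by
  have := ((hasDerivAt_id u).const_mul (Real.pi * Complex.I)).cexp
  refine this.congr_deriv ?_
  simp only [id, nome]; ring

lemma hasDerivAt_nome_sq (u : ℂ) :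
    HasDerivAt (fun t => nome t ^ 2) (2 * (Real.pi * Complex.I) * nome u ^ 2) u := by
  have := (hasDerivAt_nome u).pow 2
  refine this.congr_deriv ?_
  push_cast; ring

/-- `hauptS` at the cusps `∞` and `0`. -/
def expS (r : ℂ) : ℂ := phi3 r ^ 4

/-- `hauptS` at the cusps `1` and `1 / 3`. -/
def expR (R : ℂ) : ℂ := R * phi2 R ^ 4

lemma norm_pow_lt_one {v : ℂ} (h : ‖v‖ < 1) {n : ℕ} (hn : n ≠ 0) : ‖v ^ n‖ < 1 := by
  rw [norm_pow]; exact pow_lt_one₀ (norm_nonneg _) h hn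

lemma analyticAt_phi3_of_norm_lt {v : ℂ} (h : ‖v‖ < 1) (h0 : sqSeries v ≠ 0) :
    AnalyticAt ℂ phi3 v :=
  (AnalyticAt.fun_comp (g := sqSeries) (f := fun r => r ^ 3)
    (analyticAt_sqSeries_of_norm_lt (norm_pow_lt_one h three_ne_zero)) (by fun_prop)).div (analyticAt_sqSeries_of_norm_lt h) h0

lemma analyticAt_phi2_of_norm_lt {v : ℂ} (h : ‖v‖ < 1) (h0 : triSeries v ≠ 0) :
    AnalyticAt ℂ phi2 v :=
  (AnalyticAt.fun_comp (g := triSeries) (f := fun r => r ^ 3)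
    (analyticAt_triSeries_of_norm_lt (norm_pow_lt_one h three_ne_zero)) (by fun_prop)).div (analyticAt_triSeries_of_norm_lt h) h0

lemma analyticAt_expS_zero : AnalyticAt ℂ expS 0 := analyticAt_phi3.pow 4
lemma analyticAt_expR_zero : AnalyticAt ℂ expR 0 := analyticAt_id.mul (analyticAt_phi2.pow 4)

lemma analyticAt_expS {u : ℂ} (hu : 0 < u.im) : AnalyticAt ℂ expS (nome u) :=
  (analyticAt_phi3_of_norm_lt (norm_nome_lt_one hu) (series_ne_zero hu).1).pow 4

lemma analyticAt_expR {u : ℂ} (hu : 0 < u.im) : AnalyticAt ℂ expR (nome u ^ 2) :=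
  analyticAt_id.mul ((analyticAt_phi2_of_norm_lt (norm_pow_lt_one (norm_nome_lt_one hu) two_ne_zero)
    (series_ne_zero hu).2.2.2.2.1).pow 4)

lemma expS_zero : expS 0 = 1 := by simp [expS, phi3_zero]
lemma expR_zero : expR 0 = 0 := by simp [expR]

lemma deriv_phi3_zero : deriv phi3 0 = -2 := by
  have h := analyticAt_sqSeries.differentiableAt.hasDerivAt
  have h3 : HasDerivAt (fun r : ℂ => sqSeries (r ^ 3)) 0 0 := by
    have hp : HasDerivAt (fun r : ℂ => r ^ 3) 0 0 := by simpa using hasDerivAt_pow 3 (0 : ℂ)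
    have h' : HasDerivAt sqSeries 2 ((0 : ℂ) ^ 3) := by
      rw [zero_pow three_ne_zero, ← deriv_sqSeries_zero]; exact h
    exact (h'.comp 0 hp).congr_deriv (mul_zero _)
  have := (h3.div h (by simp [sqSeries_zero])).deriv
  refine this.trans ?_
  simp [sqSeries_zero, deriv_sqSeries_zero]

lemma deriv_expS_zero : deriv expS 0 = -8 := by
  have := (analyticAt_phi3.differentiableAt.hasDerivAt.pow 4).deriv
  refine this.trans ?_
  simp [phi3_zero, deriv_phi3_zero]; norm_num

lemma phi2_pow_four_eq {R : ℂ} (hR : R ≠ 0) : phi2 R ^ 4 = expR R / R := by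
  rw [expR]; field_simp

/-- The chain rule for `f ∘ σ = A ∘ n`. -/
lemma deriv_mul_of_comp_eq {f σ A n : ℂ → ℂ} {u s' n' : ℂ} (hu : 0 < u.im)
    (hf : DifferentiableAt ℂ f (σ u)) (hσ : HasDerivAt σ s' u) (hA : DifferentiableAt ℂ A (n u))
    (hn : HasDerivAt n n' u) (h : ∀ v : ℂ, 0 < v.im → f (σ v) = A (n v)) :
    deriv f (σ u) * s' = deriv A (n u) * n' := by
  have h1 := hf.hasDerivAt.comp u hσ
  have h2 := hA.hasDerivAt.comp u hn
  refine h1.unique (h2.congr_of_eventuallyEq ?_)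
  filter_upwards [isOpen_upperHalfPlaneSet.mem_nhds hu] with v hv using h v hv

section
variable {u : ℂ}

lemma im_one_sub_inv (hu : 0 < u.im) : 0 < (1 - 1 / (3 * u)).im := by
  have := im_fricke hu
  rw [show 1 - 1 / (3 * u) = -1 / (3 * u) + 1 by ring]; exact im_add_one this

lemma im_div_three_mul_add_one (hu : 0 < u.im) : 0 < (u / (3 * u + 1)).im := by
  rw [div_three_mul_add_one hu]; exact im_neg_inv (im_sub_three (im_neg_inv hu))

lemma deriv_hauptS_expansion (hu : 0 < u.im) :
    deriv hauptS u = 9 * deriv expS (nome u) * (Real.pi * Complex.I * nome u) := by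
  have := deriv_mul_of_comp_eq (f := hauptS) (σ := id) (A := fun r => 9 * expS r) hu
    (differentiableAt_hauptS hu) (hasDerivAt_id u) ((analyticAt_expS hu).differentiableAt.const_mul 9)
    (hasDerivAt_nome u) fun v hv => hauptS_expansion hv
  rwa [mul_one, deriv_const_mul _ (analyticAt_expS hu).differentiableAt] at this

lemma hasDerivAt_fricke (hu : 0 < u.im) :
    HasDerivAt (fun t : ℂ => -1 / (3 * t)) (1 / (3 * u ^ 2)) u := by
  have h0 := ne_zero_of_im_pos hu
  have := ((hasDerivAt_id u).const_mul 3).inv (by simpa using h0)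
  have h2 := this.const_mul (-1)
  refine (h2.congr_deriv ?_).congr_of_eventuallyEq (Eventually.of_forall fun t => ?_)
  · simp; field_simp
  · simp [div_eq_mul_inv]

lemma deriv_inv_comp {A : ℂ → ℂ} {x : ℂ} (hA : DifferentiableAt ℂ A x) (h0 : A x ≠ 0) :
    deriv (fun r => (A r)⁻¹) x = -deriv A x / A x ^ 2 := (hA.hasDerivAt.inv h0).deriv

lemma expS_ne_zero (hu : 0 < u.im) : expS (nome u) ≠ 0 := pow_ne_zero 4 (phi_ne_zero hu).1
lemma expR_ne_zero (hu : 0 < u.im) : expR (nome u ^ 2) ≠ 0 :=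
  mul_ne_zero (pow_ne_zero 2 (nome_ne_zero u)) (pow_ne_zero 4 (phi_ne_zero hu).2)

lemma deriv_hauptS_cusp_zero (hu : 0 < u.im) : deriv hauptS (-1 / (3 * u)) =
    -3 * u ^ 2 * deriv expS (nome u) * (Real.pi * Complex.I * nome u) / expS (nome u) ^ 2 := by
  have h0 := ne_zero_of_im_pos hu
  have hA := (analyticAt_expS hu).differentiableAt
  have hn := expS_ne_zero hu
  have := deriv_mul_of_comp_eq (f := hauptS) (σ := fun t => -1 / (3 * t))
    (A := fun r => (expS r)⁻¹) hu (differentiableAt_hauptS (im_fricke hu)) (hasDerivAt_fricke hu)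
    (hA.inv hn) (hasDerivAt_nome u) fun v hv => hauptS_cusp_zero_expansion hv
  rw [deriv_inv_comp hA hn] at this
  field_simp at this ⊢
  linear_combination this

lemma deriv_hauptS_cusp_one (hu : 0 < u.im) : deriv hauptS (1 - 1 / (3 * u)) =
    -3 * u ^ 2 * deriv expR (nome u ^ 2) * (2 * (Real.pi * Complex.I) * nome u ^ 2) /
      expR (nome u ^ 2) ^ 2 := by
  have h0 := ne_zero_of_im_pos hu
  have hA := (analyticAt_expR hu).differentiableAt
  have hn := expR_ne_zero hu
  have hσ : HasDerivAt (fun t : ℂ => 1 - 1 / (3 * t)) (1 / (3 * u ^ 2)) u := by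
    refine ((hasDerivAt_fricke hu).const_add 1).congr_of_eventuallyEq
      (Eventually.of_forall fun t => ?_)
    simp only; ring
  have := deriv_mul_of_comp_eq (f := hauptS) (σ := fun t => 1 - 1 / (3 * t))
    (A := fun r => (expR r)⁻¹) hu (differentiableAt_hauptS (im_one_sub_inv hu)) hσ
    (hA.inv hn) (hasDerivAt_nome_sq u) fun v hv => hauptS_cusp_one_expansion hv
  rw [deriv_inv_comp hA hn] at this
  field_simp at this ⊢
  linear_combination this

lemma deriv_hauptS_cusp_third (hu : 0 < u.im) : deriv hauptS (u / (3 * u + 1)) =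
    (3 * u + 1) ^ 2 * (9 * deriv expR (nome u ^ 2) * (2 * (Real.pi * Complex.I) * nome u ^ 2)) := by
  have h0 := ne_zero_of_im_pos (im_three_add_one hu)
  have hA := (analyticAt_expR hu).differentiableAt
  have hσ : HasDerivAt (fun t : ℂ => t / (3 * t + 1)) (1 / (3 * u + 1) ^ 2) u := by
    have := (hasDerivAt_id u).div (((hasDerivAt_id u).const_mul 3).add_const 1) (by simpa using h0)
    refine this.congr_deriv ?_
    simp only [id]; congr 1; ring
  have := deriv_mul_of_comp_eq (f := hauptS) (σ := fun t => t / (3 * t + 1))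
    (A := fun r => 9 * expR r) hu (differentiableAt_hauptS (im_div_three_mul_add_one hu)) hσ
    (hA.const_mul 9) (hasDerivAt_nome_sq u) fun v hv => by
      rw [hauptS_cusp_third_expansion hv, expR, mul_assoc]
  rw [deriv_const_mul _ hA, mul_one_div, div_eq_iff (pow_ne_zero 2 h0)] at this
  rw [this, mul_comm]

lemma theta3_pow_eight_cusp_zero (hu : 0 < u.im) :
    theta3 0 (-1 / (3 * u)) ^ 8 = (3 * u) ^ 4 * sqSeries (nome u ^ 3) ^ 8 := by
  obtain ⟨-, e2, -⟩ := theta_expansions hu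
  rw [theta3_neg_inv (im_three_mul hu), mul_pow, e2, show sqrtFactor (3 * u) ^ 8 =
    (sqrtFactor (3 * u) ^ 2) ^ 4 by ring, sqrtFactor_sq, mul_pow (-Complex.I), neg_pow, Complex.I_pow_four]
  norm_num

lemma theta3_pow_eight_cusp_one (hu : 0 < u.im) : theta3 0 (1 - 1 / (3 * u)) ^ 8 =
    (3 * u) ^ 4 * (256 * nome u ^ 6 * triSeries (nome u ^ 6) ^ 8) := by
  rw [show 1 - 1 / (3 * u) = -1 / (3 * u) + 1 by ring, theta3_add_one,
    theta4_neg_inv (im_three_mul hu), mul_pow, show sqrtFactor (3 * u) ^ 8 =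
    (sqrtFactor (3 * u) ^ 2) ^ 4 by ring, sqrtFactor_sq, mul_pow (-Complex.I), neg_pow, Complex.I_pow_four,
    show theta2 0 (3 * u) ^ 8 = (theta2 0 (3 * u) ^ 4) ^ 2 by ring, theta2_three_pow_four_expansion hu]
  ring

lemma theta3_pow_eight_cusp_third (hu : 0 < u.im) : theta3 0 (u / (3 * u + 1)) ^ 8 =
    (3 * u + 1) ^ 4 * (256 * nome u ^ 2 * triSeries (nome u ^ 2) ^ 8) := by
  obtain ⟨c, hc, e⟩ := theta3_cusp_three hu
  rw [e, mul_pow, show c ^ 8 = (c ^ 2) ^ 4 by ring, hc,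
    show theta2 0 u ^ 8 = (theta2 0 u ^ 4) ^ 2 by ring, theta2_pow_four_expansion hu]
  ring

end

/-- The quotient of the two sides of the differential equation for `hauptS`. -/
def derivQuot (t : ℂ) : ℂ :=
  deriv hauptS t ^ 2 / (hauptS t * (hauptS t - 1) ^ 2 * (hauptS t - 9) ^ 2 * theta3 0 t ^ 8)

lemma hauptS_factors_ne_zero {t : ℂ} (ht : 0 < t.im) :
    hauptS t * (hauptS t - 1) ^ 2 * (hauptS t - 9) ^ 2 * theta3 0 t ^ 8 ≠ 0 := by
  have h1 := hauptS_ne_zero ht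
  have h2 := sub_ne_zero.mpr (hauptS_ne_one ht)
  have h3 := sub_ne_zero.mpr (hauptS_ne_nine ht)
  have h4 := theta3_ne_zero ht
  positivity

lemma differentiableAt_derivQuot {t : ℂ} (ht : 0 < t.im) : DifferentiableAt ℂ derivQuot t := by
  have h1 := differentiableAt_hauptS ht
  have h2 : DifferentiableAt ℂ (deriv hauptS) t :=
    (analyticOnNhd_im_pos (fun τ hτ => differentiableAt_hauptS hτ) t ht).deriv.differentiableAt
  have h3 := differentiableAt_theta3 ht
  exact (h2.pow 2).div (((h1.mul ((h1.sub_const 1).pow 2)).mul ((h1.sub_const 9).pow 2)).mul (h3.pow 8))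
    (hauptS_factors_ne_zero ht)

/-- The expansion of `derivQuot` at the cusp `1`. -/
def derivQuotOne (R : ℂ) : ℂ := -36 * Real.pi ^ 2 * deriv expR R ^ 2 * phi2 R ^ 4 /
  (81 * 256 * (1 - expR R) ^ 2 * (1 - 9 * expR R) ^ 2 * triSeries (R ^ 3) ^ 8)

/-- The expansion of `derivQuot` at the cusp `1 / 3`. -/
def derivQuotThird (R : ℂ) : ℂ := -324 * Real.pi ^ 2 * deriv expR R ^ 2 /
  (9 * 81 * 256 * phi2 R ^ 4 * (9 * expR R - 1) ^ 2 * (expR R - 1) ^ 2 * triSeries R ^ 8)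

lemma derivQuot_cusp_one {u : ℂ} (hu : 0 < u.im) :
    derivQuot (1 - 1 / (3 * u)) = derivQuotOne (nome u ^ 2) := by
  have h0 := ne_zero_of_im_pos hu
  have hn := nome_ne_zero u
  have hR := expR_ne_zero hu
  have hs := hauptS_cusp_one_expansion hu
  have h1 := sub_ne_zero.mpr (hauptS_ne_one (im_one_sub_inv hu))
  have h9 := sub_ne_zero.mpr (hauptS_ne_nine (im_one_sub_inv hu))
  have hs' : hauptS (1 - 1 / (3 * u)) = (expR (nome u ^ 2))⁻¹ := hs
  have ht := (series_ne_zero hu).2.2.2.2.2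
  rw [hs'] at h1 h9
  have e6 : (nome u ^ 2) ^ 3 = nome u ^ 6 := by ring
  rw [derivQuot, derivQuotOne, deriv_hauptS_cusp_one hu, hs', theta3_pow_eight_cusp_one hu,
    phi2_pow_four_eq (pow_ne_zero 2 hn), e6]
  generalize expR (nome u ^ 2) = G at *
  have h1' : 1 - G ≠ 0 := fun h => h1 (by rw [show G = 1 by linear_combination -h]; norm_num)
  have h9' : 1 - 9 * G ≠ 0 := fun h => h9 (by rw [show G = 1 / 9 by linear_combination -h / 9]; norm_num)
  rw [show G⁻¹ - 1 = (1 - G) / G by field_simp, show G⁻¹ - 9 = (1 - 9 * G) / G by field_simp]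
  field_simp
  rw [Complex.I_sq]
  ring

lemma derivQuot_cusp_third {u : ℂ} (hu : 0 < u.im) :
    derivQuot (u / (3 * u + 1)) = derivQuotThird (nome u ^ 2) := by
  have h0 := ne_zero_of_im_pos (im_three_add_one hu)
  have hn := nome_ne_zero u
  have hR := expR_ne_zero hu
  have h1 := sub_ne_zero.mpr (hauptS_ne_one (im_div_three_mul_add_one hu))
  have h9 := sub_ne_zero.mpr (hauptS_ne_nine (im_div_three_mul_add_one hu))
  have hs' : hauptS (u / (3 * u + 1)) = 9 * expR (nome u ^ 2) := by
    rw [hauptS_cusp_third_expansion hu, expR, mul_assoc]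
  have ht := (series_ne_zero hu).2.2.2.2.1
  rw [hs'] at h1 h9
  rw [derivQuot, derivQuotThird, deriv_hauptS_cusp_third hu, hs', theta3_pow_eight_cusp_third hu,
    phi2_pow_four_eq (pow_ne_zero 2 hn)]
  generalize expR (nome u ^ 2) = G at *
  have h9' : G - 1 ≠ 0 := fun h => h9 (by linear_combination 9 * h)
  rw [show 9 * G - 9 = 9 * (G - 1) by ring]
  field_simp
  rw [Complex.I_sq]
  ring

lemma derivQuot_cusp_zero {u : ℂ} (hu : 0 < u.im) : derivQuot (-1 / (3 * u)) =
    -9 * Real.pi ^ 2 * deriv expS (nome u) ^ 2 * expS (nome u) / (81 * dslope expS 0 (nome u) ^ 2 *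
      (1 - 9 * expS (nome u)) ^ 2 * sqSeries (nome u ^ 3) ^ 8) := by
  have h0 := ne_zero_of_im_pos hu
  have hn := nome_ne_zero u
  have hR := expS_ne_zero hu
  have h1 := sub_ne_zero.mpr (hauptS_ne_one (im_fricke hu))
  have h9 := sub_ne_zero.mpr (hauptS_ne_nine (im_fricke hu))
  have hs' : hauptS (-1 / (3 * u)) = (expS (nome u))⁻¹ := hauptS_cusp_zero_expansion hu
  have ht := (series_ne_zero hu).2.1
  have hd := sub_eq_mul_dslope expS (nome u)
  rw [expS_zero] at hd
  rw [hs'] at h1 h9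
  rw [derivQuot, deriv_hauptS_cusp_zero hu, hs', theta3_pow_eight_cusp_zero hu]
  generalize expS (nome u) = G at *
  have h1' : dslope expS 0 (nome u) ≠ 0 := fun h => h1 (by
    rw [h, mul_zero, sub_eq_zero] at hd; rw [hd]; norm_num)
  have h9' : 1 - 9 * G ≠ 0 := fun h => h9 (by rw [show G = 1 / 9 by linear_combination -h / 9]; norm_num)
  rw [show G⁻¹ - 1 = -(nome u * dslope expS 0 (nome u)) / G by rw [← hd]; field_simp; ring,
    show G⁻¹ - 9 = (1 - 9 * G) / G by field_simp]
  field_simp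
  rw [Complex.I_sq]
  ring

lemma derivQuot_expansion {u : ℂ} (hu : 0 < u.im) : derivQuot u =
    -Real.pi ^ 2 * deriv expS (nome u) ^ 2 / (9 * dslope expS 0 (nome u) ^ 2 *
      expS (nome u) * (9 * expS (nome u) - 1) ^ 2 * sqSeries (nome u) ^ 8) := by
  have h0 := ne_zero_of_im_pos hu
  have hn := nome_ne_zero u
  have hR := expS_ne_zero hu
  have h1 := sub_ne_zero.mpr (hauptS_ne_one hu)
  have h9 := sub_ne_zero.mpr (hauptS_ne_nine hu)
  have hs' : hauptS u = 9 * expS (nome u) := hauptS_expansion hu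
  have ht := (series_ne_zero hu).1
  have hd := sub_eq_mul_dslope expS (nome u)
  rw [expS_zero] at hd
  rw [hs'] at h1 h9
  rw [derivQuot, deriv_hauptS_expansion hu, hs', (theta_expansions hu).1]
  generalize expS (nome u) = G at *
  have h9' : dslope expS 0 (nome u) ≠ 0 := fun h => h9 (by
    rw [h, mul_zero, sub_eq_zero] at hd; rw [hd]; norm_num)
  rw [show 9 * G - 9 = 9 * (nome u * dslope expS 0 (nome u)) by rw [← hd]; ring]
  field_simp
  rw [Complex.I_sq]
  ring

/-- Both s′² and ϑ₃⁸ have weight 4, so their quotient by the stated factors is a modular function.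
At ∞ and 0 the zeros of (s−9)² and (s−1)² match those of s′²; at 1 and 1/3, where s has a pole and a
zero, the zeros of ϑ₃⁸ restore the balance. The value at ∞ is −π²·64/(9·64·64) = −π²/576. -/
theorem deriv_hauptS_sq {τ : ℂ} (hτ : 0 < τ.im) : deriv hauptS τ ^ 2 =
    -(Real.pi ^ 2 / 576) * (hauptS τ * (hauptS τ - 1) ^ 2 * (hauptS τ - 9) ^ 2 * theta3 0 τ ^ 8) := by
  have cd := continuousAt_dslope analyticAt_expS_zero
  have cS := analyticAt_expS_zero.continuousAt
  have cR := analyticAt_expR_zero.continuousAt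
  have cS' := analyticAt_expS_zero.deriv.continuousAt
  have cR' := analyticAt_expR_zero.deriv.continuousAt
  have c2 := analyticAt_phi2.continuousAt
  have ct := analyticAt_triSeries.continuousAt
  have ct3 := (triSeries_analytic_pow 3 (by norm_num)).continuousAt
  have cs := analyticAt_sqSeries.continuousAt
  have cs3 := (sqSeries_analytic_pow 3 (by norm_num)).continuousAt
  have d0 : dslope expS 0 0 = -8 := by rw [dslope_same, deriv_expS_zero]
  have csq : ContinuousAt (fun r : ℂ => r ^ 2) 0 := by fun_prop
  have h := eq_value_of_regular (g := derivQuot)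
    (F0 := fun r => -Real.pi ^ 2 * deriv expS r ^ 2 / (9 * dslope expS 0 r ^ 2 *
      expS r * (9 * expS r - 1) ^ 2 * sqSeries r ^ 8))
    (F1 := fun r => -9 * Real.pi ^ 2 * deriv expS r ^ 2 * expS r / (81 * dslope expS 0 r ^ 2 *
      (1 - 9 * expS r) ^ 2 * sqSeries (r ^ 3) ^ 8))
    (F2 := fun r => derivQuotOne (r ^ 2)) (F3 := fun r => derivQuotThird (r ^ 2))
    (fun t ht => differentiableAt_derivQuot ht)
    (fun v hv => by
      rw [derivQuot_cusp_one hv, derivQuot_cusp_one (im_add_one hv), nome_add_one, neg_sq])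
    (fun v hv => by
      rw [derivQuot_cusp_third hv, derivQuot_cusp_third (im_add_one hv), nome_add_one, neg_sq])
    (by
      refine ContinuousAt.div₀ (by fun_prop) (by fun_prop) ?_
      simp [deriv_expS_zero, expS_zero, sqSeries_zero]; norm_num)
    (by
      refine ContinuousAt.div₀ (by fun_prop) (by fun_prop) ?_
      simp [deriv_expS_zero, expS_zero, sqSeries_zero]; norm_num)
    (by
      have : ContinuousAt derivQuotOne 0 := by
        refine ContinuousAt.div₀ (by fun_prop) (by fun_prop) ?_
        simp [expR_zero, triSeries_zero]
      exact ContinuousAt.comp (g := derivQuotOne) (by simpa using this) csq)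
    (by
      have : ContinuousAt derivQuotThird 0 := by
        refine ContinuousAt.div₀ (by fun_prop) (by fun_prop) ?_
        simp [expR_zero, triSeries_zero, phi2_zero]
      exact ContinuousAt.comp (g := derivQuotThird) (by simpa using this) csq)
    (fun u hu => derivQuot_expansion hu) (fun u hu => derivQuot_cusp_zero hu)
    (fun u hu => derivQuot_cusp_one hu) (fun u hu => derivQuot_cusp_third hu) hτ
  simp only [d0, expS_zero, sqSeries_zero, deriv_expS_zero] at h
  rw [derivQuot, div_eq_iff (hauptS_factors_ne_zero hτ)] at h
  rw [h]; ring

lemma deriv_hauptS_ne_zero {τ : ℂ} (hτ : 0 < τ.im) : deriv hauptS τ ≠ 0 := by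
  intro h
  have := deriv_hauptS_sq hτ
  rw [h, zero_pow two_ne_zero, eq_comm, mul_eq_zero] at this
  rcases this with h | h
  · simp at h
  · exact hauptS_factors_ne_zero hτ h

end

/-! ### The signed derivative, reality on the imaginary axis, and the square root of s′ -/

noncomputable section

/-- The square root of `deriv_hauptS_sq`. Both sides vanish at i∞, so they are first divided by the
nome; the common limit is then −72πi, which fixes the sign. -/
lemma deriv_hauptS_eq {τ : ℂ} (hτ : 0 < τ.im) : deriv hauptS τ =
    Real.pi * Complex.I / 24 * (multZ τ * (hauptS τ - 1) * (hauptS τ - 9) * theta3 0 τ ^ 4) := by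
  let f : ℂ → ℂ := fun t => deriv hauptS t / nome t
  let g : ℂ → ℂ := fun t => Real.pi * Complex.I / 24 *
    (multZ t * (hauptS t - 1) * ((hauptS t - 9) / nome t) * theta3 0 t ^ 4)
  have hn : ∀ t, DifferentiableAt ℂ nome t := fun t => (hasDerivAt_nome t).differentiableAt
  have c1 := analyticAt_expS_zero.deriv.continuousAt
  have c2 := analyticAt_phi3.continuousAt
  have c3 := continuousAt_dslope analyticAt_expS_zero
  have c4 := analyticAt_sqSeries.continuousAt
  have d0 : dslope expS 0 0 = -8 := by rw [dslope_same, deriv_expS_zero]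
  have key : f τ = g τ := by
    refine eq_of_sq_eq_of_tendsto (l := -72 * (Real.pi * Complex.I)) (fun t ht => ?_) (fun t ht => ?_)
      (fun t ht => ?_) ?_ ?_ ?_ hτ
    · exact (analyticOnNhd_im_pos (fun τ hτ => differentiableAt_hauptS hτ) t
        ht).deriv.differentiableAt.div (hn t) (nome_ne_zero t)
    · have h1 := differentiableAt_hauptS ht
      exact ((((differentiableAt_multZ ht).mul (h1.sub_const 1)).mul
        ((h1.sub_const 9).div (hn t) (nome_ne_zero t))).mul
          ((differentiableAt_theta3 ht).pow 4)).const_mul _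
    · have h0 := nome_ne_zero t
      simp only [f, g]
      rw [div_pow, deriv_hauptS_sq ht, ← multZ_sq]
      field_simp
      rw [Complex.I_sq]; ring
    · simp [Real.pi_ne_zero]
    · have := tendsto_of_expansion (f := f) (F := fun r => 9 * deriv expS r * (Real.pi * Complex.I))
        (by fun_prop) fun u hu => by
          have h0 := nome_ne_zero u
          simp only [f]; rw [deriv_hauptS_expansion hu]; field_simp
      convert this using 2
      simp only [deriv_expS_zero]; ring
    · have := tendsto_of_expansion (f := g) (F := fun r => Real.pi * Complex.I / 24 *
        (3 * phi3 r ^ 2 * (9 * phi3 r ^ 4 - 1) * (9 * dslope expS 0 r) * sqSeries r ^ 4))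
        (by fun_prop) fun u hu => by
          have h0 := nome_ne_zero u
          have hd := sub_eq_mul_dslope expS (nome u)
          rw [expS_zero, expS] at hd
          simp only [g]
          rw [multZ_expansion hu, hauptS_expansion hu, (theta_expansions hu).1,
            show 9 * phi3 (nome u) ^ 4 - 9 = 9 * (nome u * dslope expS 0 (nome u)) by
              rw [← hd]; ring]
          field_simp
      convert this using 2
      simp only [d0, phi3_zero, sqSeries_zero]; ring
  have h0 := nome_ne_zero τ
  simp only [f, g] at key
  field_simp at key ⊢
  linear_combination key

/-! The imaginary axis. -/

lemma im_mul_I_pos {y : ℝ} (hy : 0 < y) : 0 < ((y : ℂ) * Complex.I).im := by simpa using hy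

lemma neg_inv_mul_I (y : ℝ) : -1 / ((y : ℂ) * Complex.I) = ((1 / y : ℝ) : ℂ) * Complex.I := by
  rcases eq_or_ne y 0 with rfl | h
  · simp
  · have : (y : ℂ) ≠ 0 := by exact_mod_cast h
    have := Complex.I_ne_zero
    push_cast
    field_simp
    rw [Complex.I_sq]

lemma nome_mul_I (y : ℝ) : nome (y * Complex.I) = (Real.exp (-(Real.pi * y)) : ℝ) := by
  rw [nome, Complex.ofReal_exp]
  congr 1
  push_cast
  linear_combination Real.pi * y * Complex.I_sq

lemma theta3_mul_I {y : ℝ} (hy : 0 < y) : ∃ a : ℝ, 0 < a ∧ theta3 0 (y * Complex.I) = a := by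
  rw [theta3_eq_sqSeries (im_mul_I_pos hy), nome_mul_I]
  set r := Real.exp (-(Real.pi * y))
  have hr : 0 < r := Real.exp_pos _
  refine ⟨1 + 2 * r * ∑' n : ℕ, r ^ (n * (n + 2)), ?_, ?_⟩
  · have : 0 ≤ ∑' n : ℕ, r ^ (n * (n + 2)) := tsum_nonneg fun n => by positivity
    positivity
  · rw [sqSeries]; push_cast; rfl

lemma theta2_mul_I {y : ℝ} (hy : 0 < y) : ∃ a : ℝ, 0 < a ∧ theta2 0 (y * Complex.I) = a := by
  have h := theta2_ne_zero (im_mul_I_pos hy)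
  rw [theta2_eq_triSeries (im_mul_I_pos hy), nome_mul_I] at *
  set r := Real.exp (-(Real.pi * y))
  have hr : 0 < r := Real.exp_pos _
  have e : Complex.exp (Real.pi * Complex.I * (y * Complex.I) / 4) =
      (Real.exp (-(Real.pi * y) / 4) : ℝ) := by
    rw [Complex.ofReal_exp]; congr 1; push_cast
    linear_combination Real.pi * y / 4 * Complex.I_sq
  have e2 : triSeries ((r : ℂ) ^ 2) = (∑' n : ℕ, (r ^ 2) ^ (n * (n + 1) / 2) : ℝ) := by
    rw [triSeries]; push_cast; rfl
  have h0 : 0 ≤ ∑' n : ℕ, (r ^ 2) ^ (n * (n + 1) / 2) := tsum_nonneg fun n => by positivity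
  rw [e, e2] at h ⊢
  refine ⟨2 * Real.exp (-(Real.pi * y) / 4) * ∑' n : ℕ, (r ^ 2) ^ (n * (n + 1) / 2),
    lt_of_le_of_ne (by positivity) (fun h' => h ?_), by push_cast; rfl⟩
  exact_mod_cast h'.symm

lemma sqrtFactor_mul_I {y : ℝ} (hy : 0 < y) :
    sqrtFactor (y * Complex.I) = (y ^ (1 / 2 : ℝ) : ℝ) := by
  rw [sqrtFactor, show -Complex.I * (y * Complex.I) = y by
    linear_combination (-(y : ℂ)) * Complex.I_sq, Complex.ofReal_cpow hy.le]
  norm_num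

/-- The series of ϑ₄ alternates, so positivity is imported from ϑ₂ through the inversion τ ↦ −1/τ.
-/
lemma theta4_mul_I {y : ℝ} (hy : 0 < y) : ∃ a : ℝ, 0 < a ∧ theta4 0 (y * Complex.I) = a := by
  have hy' : 0 < 1 / y := by positivity
  obtain ⟨a, ha, e⟩ := theta2_mul_I hy'
  refine ⟨(1 / y) ^ (1 / 2 : ℝ) * a, by positivity, ?_⟩
  have := theta4_neg_inv (im_mul_I_pos hy')
  rw [neg_inv_mul_I, one_div_one_div, e, sqrtFactor_mul_I hy'] at this
  rw [this]; push_cast; rfl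

lemma three_mul_mul_I (y : ℝ) : 3 * ((y : ℂ) * Complex.I) = ((3 * y : ℝ) : ℂ) * Complex.I := by
  push_cast; ring

/-- All theta constants are positive on the axis, hence so are (z−1)(z+3) and (3−z)(z+1). -/
lemma multZ_mul_I {y : ℝ} (hy : 0 < y) :
    ∃ z : ℝ, 1 < z ∧ z < 3 ∧ multZ (y * Complex.I) = z := by
  have h3 : 0 < 3 * y := by positivity
  have hτ := im_mul_I_pos hy
  obtain ⟨a2, p2, e2⟩ := theta2_mul_I hy
  obtain ⟨a3, p3, e3⟩ := theta3_mul_I hy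
  obtain ⟨a4, p4, e4⟩ := theta4_mul_I hy
  obtain ⟨b2, q2, f2⟩ := theta2_mul_I h3
  obtain ⟨b3, q3, f3⟩ := theta3_mul_I h3
  obtain ⟨b4, q4, f4⟩ := theta4_mul_I h3
  rw [← three_mul_mul_I] at f2 f3 f4
  have hx := thetaX_mul hτ
  have hy' := thetaY_mul hτ
  have hz : multZ (y * Complex.I) = (3 * b3 ^ 2 / a3 ^ 2 : ℝ) := by
    rw [multZ, e3, f3]; push_cast; rfl
  rw [thetaX, thetaX, e2, e3, f2, f3, hz] at hx
  rw [thetaY, thetaY, e4, e3, f4, f3, hz] at hy'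
  have hz0 : 0 < 3 * b3 ^ 2 / a3 ^ 2 := by positivity
  refine ⟨_, ?_, ?_, hz⟩ <;> generalize 3 * b3 ^ 2 / a3 ^ 2 = z at *
  · have h : a4 / a3 * (b4 / b3) = (z - 1) * (z + 3) / (4 * z) := by exact_mod_cast hy'
    have : 0 < (z - 1) * (z + 3) / (4 * z) := by rw [← h]; positivity
    have : 0 < (z - 1) * (z + 3) := by
      rwa [div_pos_iff_of_pos_right (by positivity)] at this
    nlinarith
  · have h : a2 / a3 * (b2 / b3) = (3 - z) * (z + 1) / (4 * z) := by exact_mod_cast hx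
    have : 0 < (3 - z) * (z + 1) / (4 * z) := by rw [← h]; positivity
    have : 0 < (3 - z) * (z + 1) := by
      rwa [div_pos_iff_of_pos_right (by positivity)] at this
    nlinarith

/-! The square root of the derivative. -/

/-- The difference quotient of D is that of D² divided by D(z) + D(w), which tends to 2D(w) ≠ 0. -/
lemma hasDerivAt_of_sq_eq {D g : ℂ → ℂ} {w g' : ℂ} (hD : ContinuousAt D w) (h0 : D w ≠ 0)
    (hg : HasDerivAt g g' w) (h : ∀ᶠ z in 𝓝 w, D z ^ 2 = g z) :
    HasDerivAt D (g' / (2 * D w)) w := by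
  rw [hasDerivAt_iff_tendsto_slope] at hg ⊢
  have hD' : Tendsto (fun z => D z + D w) (𝓝[≠] w) (𝓝 (2 * D w)) := by
    rw [two_mul]
    exact (hD.tendsto.mono_left nhdsWithin_le_nhds).add_const _
  refine (hg.div hD' (by simpa using h0)).congr' ?_
  filter_upwards [hD'.eventually_ne (by simpa using h0 : 2 * D w ≠ 0), nhdsWithin_le_nhds h]
    with z hz hz2
  simp only [Pi.div_apply, slope_def_field]
  rw [← hz2, ← h.self_of_nhds]
  field_simp
  ring

lemma simplyConnected_im_pos : IsSimplyConnected {z : ℂ | 0 < z.im} := by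
  have := convex_im_pos.contractibleSpace ⟨Complex.I, by simp⟩
  exact (inferInstance : SimplyConnectedSpace {z : ℂ | 0 < z.im})

/-- s′ has no zeros and the half plane is simply connected, so a root exists. On the imaginary axis
the radicand is positive, since 6πi·πi/24 < 0 and s < 9; by connectedness the root has constant sign
there, and the positive one is taken. -/
lemma exists_sqrt_deriv : ∃ D : ℂ → ℂ, (∀ τ : ℂ, 0 < τ.im → DifferentiableAt ℂ D τ) ∧
    (∀ τ, D τ ^ 2 = 6 * Real.pi * Complex.I * deriv hauptS τ) ∧
    ∀ y : ℝ, 0 < y → ∃ d : ℝ, 0 < d ∧ D (y * Complex.I) = d := by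
  have hd : ∀ τ : ℂ, 0 < τ.im →
      DifferentiableAt ℂ (fun τ => 6 * Real.pi * Complex.I * deriv hauptS τ) τ := fun τ hτ =>
    (analyticOnNhd_im_pos (fun τ hτ => differentiableAt_hauptS hτ) τ
      hτ).deriv.differentiableAt.const_mul _
  have hne : ∀ τ : ℂ, 0 < τ.im → 6 * Real.pi * Complex.I * deriv hauptS τ ≠ 0 := fun τ hτ => by
    simp [Real.pi_ne_zero, deriv_hauptS_ne_zero hτ]
  obtain ⟨D, hc, hsq⟩ := Complex.exists_continuousOn_pow_eq simplyConnected_im_pos isOpen_upperHalfPlaneSet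
    (g := fun τ => 6 * Real.pi * Complex.I * deriv hauptS τ)
    (fun τ hτ => (hd τ hτ).continuousAt.continuousWithinAt)
    (by rintro ⟨τ, hτ, h⟩; exact hne τ hτ h) two_ne_zero
  have hdiff : ∀ τ : ℂ, 0 < τ.im → DifferentiableAt ℂ D τ := fun τ hτ =>
    (hasDerivAt_of_sq_eq (hc.continuousAt (isOpen_upperHalfPlaneSet.mem_nhds hτ))
      (fun h => hne τ hτ (by rw [← hsq, h]; simp)) (hd τ hτ).hasDerivAt
      (Eventually.of_forall hsq)).differentiableAt
  have hpos : ∀ y : ℝ, 0 < y → ∃ d : ℝ, 0 < d ∧ D (y * Complex.I) ^ 2 = d := by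
    intro y hy
    obtain ⟨z, h1, h3, hz⟩ := multZ_mul_I hy
    obtain ⟨a, ha, e⟩ := theta3_mul_I hy
    refine ⟨Real.pi ^ 2 / 4 * (z * (z ^ 2 - 1) * (9 - z ^ 2) * a ^ 4), ?_, ?_⟩
    · have : 0 < z ^ 2 - 1 := by nlinarith
      have : 0 < 9 - z ^ 2 := by nlinarith
      positivity
    · rw [hsq, deriv_hauptS_eq (im_mul_I_pos hy), ← multZ_sq, hz, e]
      push_cast
      linear_combination (Real.pi ^ 2 / 4 * (z * (z ^ 2 - 1) * (z ^ 2 - 9) * a ^ 4) : ℂ) * Complex.I_sq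
  choose! d hdpos hdeq using hpos
  have hcd : ContinuousOn (fun y : ℝ => D (y * Complex.I)) (Set.Ioi 0) := fun y hy =>
    ((hdiff _ (im_mul_I_pos hy)).continuousAt.comp (f := fun y : ℝ => (y : ℂ) * Complex.I)
      (by fun_prop)).continuousWithinAt
  have hcr : ContinuousOn (fun y : ℝ => ((√(d y) : ℝ) : ℂ)) (Set.Ioi 0) := by
    have : ContinuousOn d (Set.Ioi 0) := by
      have := Complex.continuous_re.comp_continuousOn (hcd.pow 2)
      exact this.congr fun y hy => by simp [hdeq y hy]
    exact Complex.continuous_ofReal.comp_continuousOn this.sqrt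
  have hs : Set.EqOn ((fun y : ℝ => D (y * Complex.I)) ^ 2) ((fun y : ℝ => ((√(d y) : ℝ) : ℂ)) ^ 2)
      (Set.Ioi 0) := fun y hy => by
    have : (√(d y)) ^ 2 = d y := Real.sq_sqrt (hdpos y hy).le
    simp only [Pi.pow_apply]
    rw [hdeq y hy, ← Complex.ofReal_pow, this]
  rcases isPreconnected_Ioi.eq_or_eq_neg_of_sq_eq hcd hcr hs (fun {y} hy => by
    exact_mod_cast (Real.sqrt_pos.mpr (hdpos y hy)).ne') with h | h
  · exact ⟨D, hdiff, hsq, fun y hy => ⟨_, Real.sqrt_pos.mpr (hdpos y hy), h hy⟩⟩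
  · refine ⟨fun τ => -D τ, fun τ hτ => (hdiff τ hτ).neg, fun τ => by rw [neg_sq, hsq], fun y hy =>
      ⟨_, Real.sqrt_pos.mpr (hdpos y hy), ?_⟩⟩
    have := h hy
    simp only [Pi.neg_apply] at this
    simp only [this, neg_neg]

/-- The holomorphic square root of `6 π i s'` that is positive on the imaginary axis. -/
def rootD : ℂ → ℂ := exists_sqrt_deriv.choose

lemma differentiableAt_rootD {τ : ℂ} (hτ : 0 < τ.im) : DifferentiableAt ℂ rootD τ :=
  exists_sqrt_deriv.choose_spec.1 τ hτ
lemma rootD_sq (τ : ℂ) : rootD τ ^ 2 = 6 * Real.pi * Complex.I * deriv hauptS τ :=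
  exists_sqrt_deriv.choose_spec.2.1 τ
lemma rootD_mul_I {y : ℝ} (hy : 0 < y) : ∃ d : ℝ, 0 < d ∧ rootD (y * Complex.I) = d :=
  exists_sqrt_deriv.choose_spec.2.2 y hy

lemma rootD_ne_zero {τ : ℂ} (hτ : 0 < τ.im) : rootD τ ≠ 0 := by
  intro h
  have := rootD_sq τ
  rw [h, zero_pow two_ne_zero] at this
  simp [Real.pi_ne_zero, deriv_hauptS_ne_zero hτ] at this

/-- The constant 6πi is chosen for this: 36·π⁴/576 = (π/2)⁴. D is thus the product of (π/2)ϑ₃² and a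
fourth root of s(s−1)²(s−9)², the shape of Ψ₂. -/
lemma rootD_pow_four {τ : ℂ} (hτ : 0 < τ.im) : rootD τ ^ 4 =
    (Real.pi / 2 * theta3 0 τ ^ 2) ^ 4 * (hauptS τ * (hauptS τ - 1) ^ 2 * (hauptS τ - 9) ^ 2) := by
  rw [show rootD τ ^ 4 = (rootD τ ^ 2) ^ 2 by ring, rootD_sq, mul_pow, deriv_hauptS_sq hτ, mul_pow,
    Complex.I_sq]
  ring

end

noncomputable section

/-! ### The hypergeometric function `₂F₁(1/2, 1/2; 1)` -/

lemma hasDerivAt_tsum_mul_pow {a : ℕ → ℂ} (ha : ∀ n, ‖a n‖ ≤ 1) {x : ℂ} (hx : ‖x‖ < 1) :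
    HasDerivAt (fun x => ∑' n, a n * x ^ n) (∑' n : ℕ, ((n : ℂ) + 1) * a (n + 1) * x ^ n) x := by
  obtain ⟨r, hxr, hr⟩ := exists_between hx
  have hr0 : 0 ≤ r := (norm_nonneg x).trans hxr.le
  have hs : Summable fun n : ℕ => (n : ℝ) * r ^ (n - 1) := by
    rw [← summable_nat_add_iff 1]
    have h1 := summable_pow_mul_geometric_of_norm_lt_one 1 (r := r)
      (by rwa [Real.norm_of_nonneg hr0])
    have h0 := summable_geometric_of_lt_one hr0 hr
    refine (h1.add h0).congr fun n => ?_
    rw [Nat.add_sub_cancel]; push_cast; ring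
  have h := hasDerivAt_tsum_of_isPreconnected (g := fun n (x : ℂ) => a n * x ^ n)
    (g' := fun n x => a n * (n * x ^ (n - 1))) (t := Metric.ball 0 r) (y₀ := 0) (y := x) hs
    Metric.isOpen_ball (convex_ball 0 r).isPreconnected (fun n y _ => (hasDerivAt_pow n y).const_mul _)
    (fun n y hy => by
      rw [mem_ball_zero_iff] at hy
      rw [norm_mul, norm_mul, norm_pow, Complex.norm_natCast]
      calc ‖a n‖ * (n * ‖y‖ ^ (n - 1)) ≤ 1 * (n * r ^ (n - 1)) := by gcongr; exact ha n
        _ = _ := one_mul _)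
    (by simpa using (norm_nonneg x).trans_lt hxr)
    (summable_of_ne_finset_zero (s := {0}) fun n hn => by
      rw [zero_pow (by simpa using hn), mul_zero])
    (by simpa using hxr)
  refine h.congr_deriv ?_
  have hsum : Summable fun n : ℕ => a n * (n * x ^ (n - 1)) := by
    refine Summable.of_norm_bounded hs fun n => ?_
    rw [norm_mul, norm_mul, norm_pow, Complex.norm_natCast]
    calc ‖a n‖ * (n * ‖x‖ ^ (n - 1)) ≤ 1 * (n * r ^ (n - 1)) := by gcongr; exact ha n
      _ = _ := one_mul _
  rw [hsum.tsum_eq_zero_add]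
  simp only [Nat.cast_zero, zero_mul, mul_zero, zero_add, Nat.add_sub_cancel]
  exact tsum_congr fun n => by push_cast; rw [← mul_assoc, mul_comm (a _)]

/-- The hypergeometric function that represents the elliptic integral. -/
def hypF (x : ℂ) : ℂ := ordinaryHypergeometric (1 / 2 : ℂ) (1 / 2) 1 x

/-- The coefficients of `hypF`. -/
def hypCoeff (n : ℕ) : ℂ := ((n.factorial : ℂ)⁻¹ * (ascPochhammer ℂ n).eval (1 / 2)) ^ 2

lemma hypCoeff_zero : hypCoeff 0 = 1 := by simp [hypCoeff]

lemma hypCoeff_succ (n : ℕ) :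
    ((n : ℂ) + 1) ^ 2 * hypCoeff (n + 1) = ((n : ℂ) + 1 / 2) ^ 2 * hypCoeff n := by
  have h1 : ((n : ℂ) + 1) ≠ 0 := by exact_mod_cast n.succ_ne_zero
  have h2 : (n.factorial : ℂ) ≠ 0 := by exact_mod_cast n.factorial_ne_zero
  rw [hypCoeff, hypCoeff, ascPochhammer_succ_eval, Nat.factorial_succ]
  push_cast
  field_simp
  ring

lemma norm_hypCoeff_le (n : ℕ) : ‖hypCoeff n‖ ≤ 1 := by
  induction n with
  | zero => simp [hypCoeff_zero]
  | succ n ih =>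
    have h := congrArg norm (hypCoeff_succ n)
    rw [norm_mul, norm_mul, norm_pow, norm_pow] at h
    have h1 : ‖(n : ℂ) + 1‖ = n + 1 := by
      rw [← Nat.cast_succ, Complex.norm_natCast]; push_cast; rfl
    have h2 : ‖(n : ℂ) + 1 / 2‖ = n + 1 / 2 := by
      rw [show (n : ℂ) + 1 / 2 = ((n + 1 / 2 : ℝ) : ℂ) by push_cast; rfl,
        Complex.norm_of_nonneg (by positivity)]
    rw [h1, h2] at h
    have hn : (0 : ℝ) ≤ n := n.cast_nonneg
    by_contra hc
    push Not at hc
    have : ((n : ℝ) + 1) ^ 2 < (n + 1) ^ 2 * ‖hypCoeff (n + 1)‖ := by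
      have : (0 : ℝ) < (n + 1) ^ 2 := by positivity
      nlinarith
    have : ((n : ℝ) + 1 / 2) ^ 2 * ‖hypCoeff n‖ ≤ (n + 1 / 2) ^ 2 := by
      have : (0 : ℝ) < (n + 1 / 2) ^ 2 := by positivity
      nlinarith
    nlinarith

lemma hypF_eq_tsum (x : ℂ) : hypF x = ∑' n, hypCoeff n * x ^ n := by
  rw [hypF, ordinaryHypergeometric_eq_tsum]
  refine tsum_congr fun n => ?_
  rw [ascPochhammer_eval_one, smul_eq_mul, hypCoeff]
  ring

lemma hypF_zero : hypF 0 = 1 := ordinaryHypergeometric_zero _ _ _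

/-- The derivative of `hypF`. -/
def hypF' (x : ℂ) : ℂ := ∑' n : ℕ, ((n : ℂ) + 1) * hypCoeff (n + 1) * x ^ n

lemma hasDerivAt_hypF {x : ℂ} (hx : ‖x‖ < 1) : HasDerivAt hypF (hypF' x) x := by
  rw [show hypF = fun x => ∑' n, hypCoeff n * x ^ n from funext hypF_eq_tsum]
  exact hasDerivAt_tsum_mul_pow norm_hypCoeff_le hx

/-- The coefficients of `x (1 - x) F'`. -/
def hypCoeff' (n : ℕ) : ℂ := hypCoeff (n - 1) / (4 * n)

lemma norm_hypCoeff'_le (n : ℕ) : ‖hypCoeff' n‖ ≤ 1 := by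
  rcases n with _ | n
  -- For n = 0 the denominator 4n is zero and the quotient is 0 by convention, as it must be:
  -- x(1−x)F′ has no constant term.
  · simp [hypCoeff']
  · rw [hypCoeff', norm_div, norm_mul, Complex.norm_natCast]
    refine div_le_one_of_le₀ ((norm_hypCoeff_le _).trans ?_) (by positivity)
    push_cast
    have : (0 : ℝ) ≤ n := n.cast_nonneg
    norm_num; linarith

/-- With n²cₙ = (n−1/2)²cₙ₋₁, the coefficient n cₙ − (n−1)cₙ₋₁ collapses to cₙ₋₁/(4n). -/
lemma mul_hypF'_eq {x : ℂ} (hx : ‖x‖ < 1) : x * (1 - x) * hypF' x = ∑' n, hypCoeff' n * x ^ n := by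
  have hs : Summable fun n : ℕ => ((n : ℂ) + 1) * hypCoeff (n + 1) * x ^ n := by
    have h1 := summable_pow_mul_geometric_of_norm_lt_one 1 (r := ‖x‖) (by rwa [norm_norm])
    have h0 := summable_geometric_of_lt_one (norm_nonneg x) hx
    refine Summable.of_norm_bounded (h1.add h0) fun n => ?_
    have e : ‖(n : ℂ) + 1‖ = n + 1 := by
      rw [← Nat.cast_succ, Complex.norm_natCast]; push_cast; rfl
    rw [norm_mul, norm_mul, norm_pow, e]
    calc ((n : ℝ) + 1) * ‖hypCoeff (n + 1)‖ * ‖x‖ ^ n ≤ (n + 1) * 1 * ‖x‖ ^ n := by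
          gcongr; exact norm_hypCoeff_le _
      _ = _ := by ring
  have hs' : Summable fun n : ℕ => hypCoeff' n * x ^ n := by
    refine Summable.of_norm_bounded (summable_geometric_of_lt_one (norm_nonneg x) hx) fun n => ?_
    rw [norm_mul, norm_pow]
    exact mul_le_of_le_one_left (by positivity) (norm_hypCoeff'_le n)
  have hs1 : Summable fun n : ℕ => ((n : ℂ) + 1) * hypCoeff (n + 1) * x ^ n * x ^ 2 := hs.mul_right _
  have e1 : x * hypF' x = hypCoeff 1 * x +
      ∑' n : ℕ, ((n : ℂ) + 2) * hypCoeff (n + 2) * x ^ (n + 2) := by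
    rw [hypF', hs.tsum_eq_zero_add, mul_add, ← tsum_mul_left]
    congr 1
    · simp; ring
    · exact tsum_congr fun n => by push_cast; ring
  have e2 : x ^ 2 * hypF' x = ∑' n : ℕ, ((n : ℂ) + 1) * hypCoeff (n + 1) * x ^ (n + 2) := by
    rw [hypF', ← tsum_mul_left]
    exact tsum_congr fun n => by ring
  have hs2 : Summable fun n : ℕ => ((n : ℂ) + 1) * hypCoeff (n + 1) * x ^ (n + 2) :=
    hs1.congr fun n => by ring
  have hs3 : Summable fun n : ℕ => ((n : ℂ) + 2) * hypCoeff (n + 2) * x ^ (n + 2) := by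
    have := ((summable_nat_add_iff 1).mpr hs).mul_right x
    exact this.congr fun n => by push_cast; ring
  rw [show x * (1 - x) * hypF' x = x * hypF' x - x ^ 2 * hypF' x by ring, e1, e2, add_sub_assoc,
    ← hs3.tsum_sub hs2, hs'.tsum_eq_zero_add, ((summable_nat_add_iff 1).mpr hs').tsum_eq_zero_add]
  have h1 : hypCoeff 1 = 1 / 4 := by
    have := hypCoeff_succ 0
    rw [hypCoeff_zero] at this
    norm_num at this ⊢
    exact this
  rw [show hypCoeff' 0 * x ^ 0 = 0 by simp [hypCoeff'], zero_add]
  refine congrArg₂ (· + ·) (by simp [hypCoeff', h1, hypCoeff_zero]) (tsum_congr fun n => ?_)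
  simp only [hypCoeff', Nat.add_sub_cancel]
  have h := hypCoeff_succ (n + 1)
  have h2 : ((n : ℂ) + 2) ≠ 0 := by exact_mod_cast (n + 1).succ_ne_zero
  push_cast at h ⊢
  rw [show (n : ℂ) + 1 + 1 = n + 2 by ring] at *
  field_simp
  linear_combination 4 * x ^ (n + 2) * h

/-- The hypergeometric equation in self-adjoint form. Working with the pair F, x(1−x)F′ avoids
second derivatives in all later steps. -/
lemma hasDerivAt_mul_hypF' {x : ℂ} (hx : ‖x‖ < 1) :
    HasDerivAt (fun x => x * (1 - x) * hypF' x) (hypF x / 4) x := by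
  have h := hasDerivAt_tsum_mul_pow norm_hypCoeff'_le hx
  refine (h.congr_deriv ?_).congr_of_eventuallyEq ?_
  · rw [hypF_eq_tsum, ← tsum_div_const]
    refine tsum_congr fun n => ?_
    have h1 : ((n : ℂ) + 1) ≠ 0 := by exact_mod_cast n.succ_ne_zero
    rw [hypCoeff', Nat.add_sub_cancel]
    push_cast
    field_simp
  · filter_upwards [Metric.isOpen_ball.mem_nhds (mem_ball_zero_iff.mpr hx)] with t ht
    exact mul_hypF'_eq (mem_ball_zero_iff.mp ht)

lemma analyticAt_hypF {x : ℂ} (hx : ‖x‖ < 1) : AnalyticAt ℂ hypF x :=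
  DifferentiableOn.analyticAt (s := Metric.ball 0 1) (fun _ ht => (hasDerivAt_hypF
    (mem_ball_zero_iff.mp ht)).differentiableAt.differentiableWithinAt)
    (Metric.isOpen_ball.mem_nhds (mem_ball_zero_iff.mpr hx))

/-! The cubic transformation. -/

/-- The square of the modulus as a function of the multiplier. -/
def modX (z : ℂ) : ℂ := (z + 1) ^ 3 * (3 - z) / (16 * z)

/-- The square of the transformed modulus as a function of the multiplier. -/
def modXX (z : ℂ) : ℂ := (3 - z) ^ 3 * (z + 1) / (16 * z ^ 3)

lemma one_sub_modX {z : ℂ} (hz : z ≠ 0) : 1 - modX z = (z - 1) ^ 3 * (z + 3) / (16 * z) := by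
  rw [modX]; field_simp; ring

lemma hasDerivAt_modX {z : ℂ} (hz : z ≠ 0) :
    HasDerivAt modX (-3 * (z ^ 2 - 1) ^ 2 / (16 * z ^ 2)) z := by
  have h := (((((hasDerivAt_id z).add_const 1).pow 3).mul ((hasDerivAt_id z).const_sub 3)).div
    ((hasDerivAt_id z).const_mul 16) (by simpa using hz))
  refine h.congr_deriv ?_
  simp only [id, Pi.pow_apply, Pi.mul_apply]
  push_cast
  field_simp
  ring

lemma hasDerivAt_modXX {z : ℂ} (hz : z ≠ 0) :
    HasDerivAt modXX (-(z ^ 2 - 9) ^ 2 / (16 * z ^ 4)) z := by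
  have h := (((((hasDerivAt_id z).const_sub 3).pow 3).mul ((hasDerivAt_id z).add_const 1)).div
    (((hasDerivAt_id z).pow 3).const_mul 16) (by simpa using hz))
  refine h.congr_deriv ?_
  simp only [id, Pi.pow_apply, Pi.mul_apply]
  push_cast
  field_simp
  ring

/-- Both sides solve the same second order equation in z, and both are regular at z = 3, where the
two moduli vanish. Their weighted Wronskian is constant and is zero at z = 3, so the ratio is
constant; its value there is 1/3. -/
lemma cubic_near_three : ∀ᶠ z in 𝓝 (3 : ℂ), hypF (modXX z) = z / 3 * hypF (modX z) := by
  have m0 : modX 3 = 0 := by simp [modX]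
  have n0 : modXX 3 = 0 := by simp [modXX]
  have h30 : (3 : ℂ) ≠ 0 := three_ne_zero
  have a1 : AnalyticAt ℂ (fun z => hypF (modX z)) 3 :=
    AnalyticAt.fun_comp (analyticAt_hypF (by simp [m0])) (by
      unfold modX; fun_prop (disch := simp))
  have a2 : AnalyticAt ℂ (fun z => hypF (modXX z)) 3 :=
    AnalyticAt.fun_comp (analyticAt_hypF (by simp [n0])) (by
      unfold modXX; fun_prop (disch := simp))
  have cm : ContinuousAt modX 3 := (hasDerivAt_modX h30).continuousAt
  have cn : ContinuousAt modXX 3 := (hasDerivAt_modXX h30).continuousAt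
  have ev : ∀ᶠ z in 𝓝 (3 : ℂ), ‖modX z‖ < 1 ∧ ‖modXX z‖ < 1 ∧ z ≠ 0 ∧ z ^ 2 ≠ 1 ∧ z ≠ -3 ∧
      z * hypF (modX z) ≠ 0 := by
    refine ((cm.norm.eventually_lt continuousAt_const (by simp [m0])).and
      ((cn.norm.eventually_lt continuousAt_const (by simp [n0])).and
      ((continuousAt_id.eventually_ne h30).and
      (((continuousAt_id.pow 2).eventually_ne (by norm_num)).and
      ((continuousAt_id.eventually_ne (by norm_num)).and
      ((continuousAt_id.mul a1.continuousAt).eventually_ne ?_))))))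
    simp [m0, hypF_zero]
  obtain ⟨ε, hε, hball⟩ := Metric.eventually_nhds_iff_ball.mp ev
  -- the products `x (1 - x) F'` at the two moduli
  let g : ℂ → ℂ := fun z => modX z * (1 - modX z) * hypF' (modX z)
  let k : ℂ → ℂ := fun z => modXX z * (1 - modXX z) * hypF' (modXX z)
  let A : ℂ → ℂ := fun z => hypF (modX z)
  let B : ℂ → ℂ := fun z => hypF (modXX z)
  let p : ℂ → ℂ := fun z => (z ^ 2 - 1) * (z ^ 2 - 9) / 48
  -- the Wronskian
  let W : ℂ → ℂ := fun z => k z * (z * A z) - B z * (3 * p z / z ^ 2 * A z + 3 / z * g z)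
  have hA : ∀ z ∈ Metric.ball (3 : ℂ) ε, HasDerivAt A (-3 * (z ^ 2 - 1) ^ 2 / (16 * z ^ 2) *
      hypF' (modX z)) z ∧ HasDerivAt g (-3 * (z ^ 2 - 1) ^ 2 / (16 * z ^ 2) * A z / 4) z ∧
      HasDerivAt B (-(z ^ 2 - 9) ^ 2 / (16 * z ^ 4) * hypF' (modXX z)) z ∧
      HasDerivAt k (-(z ^ 2 - 9) ^ 2 / (16 * z ^ 4) * B z / 4) z := by
    intro z hz
    obtain ⟨h1, h2, h3, h4, -⟩ := hball z hz
    refine ⟨((hasDerivAt_hypF h1).comp z (hasDerivAt_modX h3)).congr_deriv (by ring),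
      ((hasDerivAt_mul_hypF' h1).comp z (hasDerivAt_modX h3)).congr_deriv (by simp only [A]; ring),
      ((hasDerivAt_hypF h2).comp z (hasDerivAt_modXX h3)).congr_deriv (by ring),
      ((hasDerivAt_mul_hypF' h2).comp z (hasDerivAt_modXX h3)).congr_deriv (by simp only [B]; ring)⟩
  have hg : ∀ z, z ≠ 0 → g z = p z * (-3 * (z ^ 2 - 1) ^ 2 / (16 * z ^ 2) * hypF' (modX z)) := by
    intro z hz
    simp only [g, p]; rw [one_sub_modX hz, modX]; field_simp; ring
  have hk : ∀ z, z ≠ 0 → k z =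
      3 * p z / z ^ 2 * (-(z ^ 2 - 9) ^ 2 / (16 * z ^ 4) * hypF' (modXX z)) := by
    intro z hz
    have : 1 - modXX z = (3 + z) ^ 3 * (z - 1) / (16 * z ^ 3) := by rw [modXX]; field_simp; ring
    simp only [k, p]; rw [this, modXX]; field_simp; ring
  have hW : ∀ z ∈ Metric.ball (3 : ℂ) ε, HasDerivAt W 0 z := by
    intro z hz
    obtain ⟨-, -, h3, -⟩ := hball z hz
    obtain ⟨d1, d2, d3, d4⟩ := hA z hz
    have dp : HasDerivAt (fun z => 3 * p z / z ^ 2) ((z - 9 / z ^ 3) / 8) z := by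
      have := (((((hasDerivAt_id z).pow 2).sub_const 1).mul
        (((hasDerivAt_id z).pow 2).sub_const 9)).div_const 48).const_mul 3
      refine (this.div ((hasDerivAt_id z).pow 2) (by simpa using h3)).congr_deriv ?_
      simp only [id, Pi.pow_apply, Pi.mul_apply]
      push_cast
      field_simp
      ring
    have dq : HasDerivAt (fun z : ℂ => 3 / z) (-3 / z ^ 2) z := by
      have := (hasDerivAt_inv h3).const_mul 3
      refine (this.congr_deriv (by ring)).congr_of_eventuallyEq
        (Eventually.of_forall fun t => by simp [div_eq_mul_inv])
    have := (d4.mul ((hasDerivAt_id z).mul d1)).sub (d3.mul ((dp.mul d1).add (dq.mul d2)))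
    refine this.congr_deriv ?_
    simp only [id, Pi.mul_apply, Pi.add_apply]
    rw [hg z h3, hk z h3]
    simp only [p]
    field_simp
    ring
  -- The weight 3p/z² contains the factor z² − 9, so W vanishes at z = 3 and therefore everywhere in
  -- the disc.
  have hWc : ∀ z ∈ Metric.ball (3 : ℂ) ε, W z = 0 := by
    intro z hz
    have h3 : (3 : ℂ) ∈ Metric.ball (3 : ℂ) ε := Metric.mem_ball_self hε
    have := Metric.isOpen_ball.is_const_of_deriv_eq_zero (convex_ball (3 : ℂ) ε).isPreconnected
      (fun t ht => (hW t ht).differentiableAt.differentiableWithinAt) (fun t ht => (hW t ht).deriv)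
      hz h3
    rw [this]
    simp only [W, k, g, p, m0, n0]
    norm_num
  -- the quotient is constant
  let q : ℂ → ℂ := fun z => B z / (z * A z)
  have hq : ∀ z ∈ Metric.ball (3 : ℂ) ε, z ≠ 3 → deriv q z = 0 := by
    intro z hz hz3
    obtain ⟨-, -, h3, h4, h5, h6⟩ := hball z hz
    obtain ⟨d1, d2, d3, d4⟩ := hA z hz
    have hA0 : A z ≠ 0 := right_ne_zero_of_mul h6
    have dq : HasDerivAt q _ z := d3.div ((hasDerivAt_id z).mul d1) h6
    rw [dq.deriv]
    have hw := hWc z hz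
    simp only [W] at hw
    rw [hg z h3, hk z h3] at hw
    have hp : p z ≠ 0 := by
      refine div_ne_zero (mul_ne_zero (sub_ne_zero.mpr h4) ?_) (by norm_num)
      rw [show z ^ 2 - 9 = (z - 3) * (z + 3) by ring]
      exact mul_ne_zero (sub_ne_zero.mpr hz3) (fun h => h5 (eq_neg_of_add_eq_zero_left h))
    rw [div_eq_zero_iff]
    left
    simp only [id]
    refine (mul_eq_zero.mp (?_ : 3 * p z / z ^ 2 * _ = 0)).resolve_left
      (div_ne_zero (mul_ne_zero three_ne_zero hp) (pow_ne_zero 2 h3))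
    rw [← hw]
    field_simp
  -- Because p(3) = 0, the vanishing of W gives q′ = 0 only for z ≠ 3; analyticity of q′ fills in
  -- the centre.
  have aq : AnalyticAt ℂ q 3 := a2.div (analyticAt_id.mul a1) (by simp [A, m0, hypF_zero])
  have hdq : ∀ᶠ z in 𝓝 (3 : ℂ), deriv q z = 0 := by
    refine aq.deriv.frequently_zero_iff_eventually_zero.mp (Eventually.frequently ?_)
    filter_upwards [nhdsWithin_le_nhds (Metric.ball_mem_nhds (3 : ℂ) hε), self_mem_nhdsWithin]
      with z hz hz3 using hq z hz hz3
  obtain ⟨δ, hδ, hball'⟩ := Metric.eventually_nhds_iff_ball.mp (hdq.and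
    (aq.eventually_analyticAt.and ev))
  filter_upwards [Metric.ball_mem_nhds (3 : ℂ) hδ] with z hz
  have := Metric.isOpen_ball.is_const_of_deriv_eq_zero (convex_ball (3 : ℂ) δ).isPreconnected
      (fun t ht => (hball' t ht).2.1.differentiableAt.differentiableWithinAt)
      (fun t ht => (hball' t ht).1) hz (Metric.mem_ball_self hδ)
  simp only [q, A, B, m0, n0, hypF_zero] at this
  rw [div_eq_iff (hball' z hz).2.2.2.2.2.2.2] at this
  rw [this]; ring

lemma modX_ofReal {z : ℝ} (h1 : 1 < z) (h3 : z ≤ 3) : ‖modX z‖ < 1 ∧ ‖modXX z‖ < 1 := by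
  have hz : 0 < z := by linarith
  have e1 : modX z = ((z + 1) ^ 3 * (3 - z) / (16 * z) : ℝ) := by rw [modX]; push_cast; rfl
  have e2 : modXX z = ((3 - z) ^ 3 * (z + 1) / (16 * z ^ 3) : ℝ) := by rw [modXX]; push_cast; rfl
  have h3' : 0 ≤ 3 - z := by linarith
  have h1' : 0 < z - 1 := by linarith
  rw [e1, e2, Complex.norm_of_nonneg (by positivity), Complex.norm_of_nonneg (by positivity),
    div_lt_one (by positivity), div_lt_one (by positivity)]
  constructor
  · have : 0 < (z - 1) ^ 3 * (z + 3) := by positivity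
    nlinarith
  · have : 0 < (3 + z) ^ 3 * (z - 1) := by positivity
    nlinarith

/-- The cubic transformation of the complete elliptic integral. -/
theorem hypF_cubic {z : ℝ} (h1 : 1 < z) (h3 : z ≤ 3) :
    hypF (modXX z) = z / 3 * hypF (modX z) := by
  -- The identity theorem along the real interval (1,3], on which both moduli stay inside the unit
  -- disc.
  have h := AnalyticOnNhd.eqOn_of_preconnected_of_eventuallyEq (𝕜 := ℂ)
    (f := fun z : ℂ => hypF (modXX z)) (g := fun z : ℂ => z / 3 * hypF (modX z))
    (U := Complex.ofReal '' Set.Ioc 1 3) (z₀ := 3) (fun w hw => ?_) (fun w hw => ?_)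
    (isPreconnected_Ioc.image _ Complex.continuous_ofReal.continuousOn)
    ⟨3, by norm_num, by norm_num⟩ cubic_near_three
  · exact h ⟨z, ⟨h1, h3⟩, rfl⟩
  · obtain ⟨x, ⟨hx1, hx3⟩, rfl⟩ := hw
    have hx0 : (x : ℂ) ≠ 0 := by exact_mod_cast (by linarith : x ≠ 0)
    exact AnalyticAt.fun_comp (analyticAt_hypF (modX_ofReal hx1 hx3).2) (by
      unfold modXX; fun_prop (disch := simpa using hx0))
  · obtain ⟨x, ⟨hx1, hx3⟩, rfl⟩ := hw
    have hx0 : (x : ℂ) ≠ 0 := by exact_mod_cast (by linarith : x ≠ 0)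
    have := AnalyticAt.fun_comp (f := modX) (analyticAt_hypF (modX_ofReal hx1 hx3).1) (by
      unfold modX; fun_prop (disch := simpa using hx0))
    fun_prop

end

noncomputable section

/-! ### The solutions of the Heun equation on the imaginary axis -/

lemma thetaX_pow_four_eq_modX {τ : ℂ} (hτ : 0 < τ.im) : thetaX τ ^ 4 = modX (multZ τ) :=
  thetaX_pow_four hτ

lemma tendsto_mul_I_atImInfty {f : ℂ → ℂ} {l : ℂ} (h : Tendsto (fun u : ℍ => f u) atImInfty (𝓝 l))
    {y : ℝ} (hy : 0 < y) : Tendsto (fun n : ℕ => f (((3 ^ n * y : ℝ) : ℂ) * Complex.I)) atTop (𝓝 l) := by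
  have hp : ∀ n : ℕ, 0 < 3 ^ n * y := fun n => by positivity
  let u : ℕ → ℍ := fun n => ⟨((3 ^ n * y : ℝ) : ℂ) * Complex.I, im_mul_I_pos (hp n)⟩
  have hu : Tendsto u atTop atImInfty := by
    rw [atImInfty, tendsto_comap_iff]
    have : UpperHalfPlane.im ∘ u = fun n => 3 ^ n * y := by
      funext n
      change (((3 ^ n * y : ℝ) : ℂ) * Complex.I).im = _
      rw [Complex.mul_I_im, Complex.ofReal_re]
    rw [this]
    exact (tendsto_pow_atTop_atTop_of_one_lt (by norm_num)).atTop_mul_const hy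
  exact h.comp hu

/-- Jacobi's formula for the complete elliptic integral on the imaginary axis. -/
theorem hypF_thetaX {y : ℝ} (hy : 0 < y) :
    hypF (thetaX (y * Complex.I) ^ 4) = theta3 0 (y * Complex.I) ^ 2 := by
  let R : ℝ → ℂ := fun y => hypF (thetaX (y * Complex.I) ^ 4) / theta3 0 (y * Complex.I) ^ 2
  -- The moduli at τ and 3τ are the two moduli of the cubic transformation, and its factor z/3 is
  -- exactly ϑ₃²(3τ)/ϑ₃²(τ).
  have step : ∀ y : ℝ, 0 < y → R (3 * y) = R y := by
    intro y hy
    have hτ := im_mul_I_pos hy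
    have h3 := im_three_mul hτ
    obtain ⟨z, h1, h3', hz⟩ := multZ_mul_I hy
    have n1 := theta3_ne_zero hτ
    have n2 := theta3_ne_zero h3
    simp only [R]
    rw [← three_mul_mul_I, thetaX_three_mul_pow_four hτ, thetaX_pow_four hτ]
    have hc := hypF_cubic h1 h3'.le
    rw [← hz, modXX, modX] at hc
    rw [hc]
    generalize hypF _ = H
    rw [multZ]
    generalize theta3 0 (3 * _) = b at *
    field_simp
  have hpow : ∀ n : ℕ, R (3 ^ n * y) = R y := by
    intro n
    induction n with
    | zero => simp
    | succ n ih => rw [← ih, pow_succ', mul_assoc, step _ (by positivity)]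
  have lX : Tendsto (fun u : ℍ => thetaX u ^ 4) atImInfty (𝓝 0) := by
    have h : Tendsto (fun u : ℍ => (multZ u + 1) ^ 3 * (3 - multZ u) / (16 * multZ u)) atImInfty
        (𝓝 ((3 + 1) ^ 3 * (3 - 3) / (16 * 3))) :=
      (((tendsto_multZ.add_const 1).pow 3).mul (tendsto_multZ.const_sub 3)).div
        (tendsto_multZ.const_mul 16) (by norm_num)
    rw [sub_self, mul_zero, zero_div] at h
    exact h.congr fun u => (thetaX_pow_four u.im_pos).symm
  have l3 : Tendsto (fun u : ℍ => theta3 0 u) atImInfty (𝓝 1) := by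
    have := tendsto_of_expansion analyticAt_sqSeries.continuousAt
      (fun u hu => (theta_expansions hu).1)
    rwa [sqSeries_zero] at this
  have lR : Tendsto (fun u : ℍ => hypF (thetaX u ^ 4) / theta3 0 u ^ 2) atImInfty (𝓝 1) := by
    have hF : Tendsto hypF (𝓝 0) (𝓝 1) := by
      have := (analyticAt_hypF (x := 0) (by simp)).continuousAt.tendsto
      rwa [hypF_zero] at this
    have := (hF.comp lX).div (l3.pow 2) (by norm_num)
    rwa [one_pow, div_one] at this
  -- R takes the same value at all points 3ⁿy, which run to i∞, where R tends to F(0)/1 = 1.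
  have := tendsto_mul_I_atImInfty (f := fun u => hypF (thetaX u ^ 4) / theta3 0 u ^ 2) lR hy
  have h1 : R y = 1 :=
    tendsto_nhds_unique (tendsto_const_nhds.congr fun n => (hpow n).symm) this
  simp only [R] at h1
  rwa [div_eq_one_iff_eq (pow_ne_zero 2 (theta3_ne_zero (im_mul_I_pos hy)))] at h1

lemma hypF_thetaY {y : ℝ} (hy : 0 < y) :
    hypF (thetaY (y * Complex.I) ^ 4) = y * theta3 0 (y * Complex.I) ^ 2 := by
  have hy' : 0 < 1 / y := by positivity
  have h := hypF_thetaX hy'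
  have e := thetaX_neg_inv (im_mul_I_pos hy)
  have e3 := theta3_neg_inv (im_mul_I_pos hy)
  rw [neg_inv_mul_I] at e e3
  rw [e, e3, mul_pow, sqrtFactor_sq] at h
  rw [h]
  linear_combination (-(y : ℂ)) * theta3 0 (y * Complex.I) ^ 2 * Complex.I_sq

/-- The common factor of the two solutions. -/
def heunRho (s : ℂ) : ℂ := (s * (s - 1) ^ 2 * (s - 9) ^ 2) ^ (1 / 4 : ℂ)

/-- The square root of `s`. -/
def sqrtS (s : ℂ) : ℂ := s ^ (1 / 2 : ℂ)

lemma cpow_half_sq (s : ℂ) : (s ^ (1 / 2 : ℂ)) ^ 2 = s := by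
  rw [← Complex.cpow_nat_mul]; norm_num

lemma sqrtS_sq (s : ℂ) : sqrtS s ^ 2 = s := cpow_half_sq s

/-- The given modulus satisfies 1 − k² = `modX` √s, which is ϑ₂⁴/ϑ₃⁴ at τ. So K′ corresponds to ϑ₃²
and K to −iτϑ₃². -/
lemma heunModulus_sq {s : ℂ} (h0 : s ≠ 0) : heunModulus s ^ 2 = 1 - modX (sqrtS s) := by
  have hz : sqrtS s ≠ 0 := fun h => h0 (by rw [← sqrtS_sq s, h]; simp)
  rw [heunModulus, mul_pow, cpow_half_sq, one_sub_modX hz, ← sqrtS]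
  nth_rw 1 [← sqrtS_sq s]
  field_simp
  ring

lemma heunBasis_zero {s : ℂ} (h0 : s ≠ 0) : heunBasis s 0 =
    Complex.I * (Real.pi / 2 * (heunRho s * hypF (1 - modX (sqrtS s)))) := by
  rw [← heunModulus_sq h0, hypF, heunRho]
  simp only [heunBasis, ellipticK, Matrix.cons_val_zero]
  ring

lemma heunBasis_one {s : ℂ} (h0 : s ≠ 0) : heunBasis s 1 =
    Real.pi / 2 * (heunRho s * hypF (modX (sqrtS s))) := by
  rw [← sub_sub_cancel 1 (modX (sqrtS s)), ← heunModulus_sq h0, hypF, heunRho]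
  rw [show heunBasis s 1 = (s * (s - 1) ^ 2 * (s - 9) ^ 2) ^ (1 / 4 : ℂ) *
    ellipticK' (heunModulus s) from rfl, ellipticK']
  ring

/-- The points near which `heunBasis` is given by convergent series. -/
def IsBasePoint (s : ℂ) : Prop := s ∈ Complex.slitPlane ∧ s ≠ 1 ∧ s ≠ 9 ∧
  s * (s - 1) ^ 2 * (s - 9) ^ 2 ∈ Complex.slitPlane ∧ ‖modX (sqrtS s)‖ < 1 ∧
  ‖1 - modX (sqrtS s)‖ < 1

lemma ofReal_sqrtS {w : ℝ} (hw : 0 ≤ w) : sqrtS w = (√w : ℝ) := by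
  rw [sqrtS, Real.sqrt_eq_rpow, Complex.ofReal_cpow hw]; norm_num

lemma isBasePoint_ofReal {w : ℝ} (h1 : 1 < w) (h9 : w < 9) : IsBasePoint w := by
  have hw : 0 < w := by linarith
  have hs1 : 1 < √w := by rw [Real.lt_sqrt (by norm_num)]; simpa using h1
  have hs9 : √w < 3 := by rw [Real.sqrt_lt' (by norm_num)]; norm_num; exact h9
  have hz0 : ((√w : ℝ) : ℂ) ≠ 0 := by exact_mod_cast (by linarith : √w ≠ 0)
  refine ⟨Complex.ofReal_mem_slitPlane.mpr hw, by exact_mod_cast h1.ne', by exact_mod_cast h9.ne,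
    ?_, ?_, ?_⟩
  · rw [show (w : ℂ) * (w - 1) ^ 2 * (w - 9) ^ 2 = ((w * (w - 1) ^ 2 * (w - 9) ^ 2 : ℝ) : ℂ) by
      push_cast; ring, Complex.ofReal_mem_slitPlane]
    have : w - 1 ≠ 0 := by linarith
    have : w - 9 ≠ 0 := by linarith
    positivity
  · rw [ofReal_sqrtS hw.le]; exact (modX_ofReal hs1 hs9.le).1
  · rw [ofReal_sqrtS hw.le, one_sub_modX hz0]
    set z := √w
    have e : ((z : ℂ) - 1) ^ 3 * (z + 3) / (16 * z) = ((z - 1) ^ 3 * (z + 3) / (16 * z) : ℝ) := by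
      push_cast; rfl
    have hp : 0 < z - 1 := by linarith
    rw [e, Complex.norm_of_nonneg (by positivity), div_lt_one (by positivity)]
    have : 0 < (z + 1) ^ 3 * (3 - z) := mul_pos (by positivity) (by linarith)
    nlinarith

lemma hasDerivAt_sqrtS {s : ℂ} (hs : s ∈ Complex.slitPlane) :
    HasDerivAt sqrtS (1 / (2 * sqrtS s)) s := by
  have h0 := Complex.slitPlane_ne_zero hs
  have hz : sqrtS s ≠ 0 := fun h => h0 (by rw [← sqrtS_sq s, h]; simp)
  have hc : ContinuousAt sqrtS s := by
    unfold sqrtS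
    exact (continuousAt_cpow_const hs)
  have := hasDerivAt_of_sq_eq hc hz (hasDerivAt_id s) (Eventually.of_forall sqrtS_sq)
  exact this

lemma IsBasePoint.eventually {s : ℂ} (h : IsBasePoint s) : ∀ᶠ t in 𝓝 s, IsBasePoint t := by
  obtain ⟨h1, h2, h3, h4, h5, h6⟩ := h
  have h0 := Complex.slitPlane_ne_zero h1
  have hz : sqrtS s ≠ 0 := fun h => h0 (by rw [← sqrtS_sq s, h]; simp)
  have c : ContinuousAt (fun t => modX (sqrtS t)) s :=
    ContinuousAt.comp (hasDerivAt_modX hz).continuousAt (hasDerivAt_sqrtS h1).continuousAt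
  have c4 : ContinuousAt (fun s : ℂ => s * (s - 1) ^ 2 * (s - 9) ^ 2) s := by fun_prop
  exact (Complex.isOpen_slitPlane.eventually_mem h1).and ((continuousAt_id.eventually_ne h2).and
    ((continuousAt_id.eventually_ne h3).and ((c4.eventually_mem (Complex.isOpen_slitPlane.mem_nhds h4)).and
    ((c.norm.eventually_lt continuousAt_const h5).and
    ((continuousAt_const.sub c).norm.eventually_lt continuousAt_const h6)))))

/-- The logarithmic derivative of `heunRho`. -/
def heunL (s : ℂ) : ℂ := 1 / 4 * (1 / s + 2 / (s - 1) + 2 / (s - 9))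

lemma hasDerivAt_heunRho {s : ℂ} (h : IsBasePoint s) :
    HasDerivAt heunRho (heunL s * heunRho s) s := by
  have h0 := Complex.slitPlane_ne_zero h.1
  have h1 := sub_ne_zero.mpr h.2.1
  have h9 := sub_ne_zero.mpr h.2.2.1
  have hp : HasDerivAt (fun s : ℂ => s * (s - 1) ^ 2 * (s - 9) ^ 2)
      ((s * (s - 1) ^ 2 * (s - 9) ^ 2) * (4 * heunL s)) s := by
    have := ((hasDerivAt_id s).mul (((hasDerivAt_id s).sub_const 1).pow 2)).mul
      (((hasDerivAt_id s).sub_const 9).pow 2)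
    refine this.congr_deriv ?_
    simp only [id, Pi.pow_apply, Pi.mul_apply, heunL]
    push_cast
    field_simp
  have := hp.cpow_const (c := 1 / 4) h.2.2.2.1
  refine this.congr_deriv ?_
  have hne := Complex.slitPlane_ne_zero h.2.2.2.1
  rw [Complex.cpow_sub _ _ hne, Complex.cpow_one, heunRho]
  generalize s * (s - 1) ^ 2 * (s - 9) ^ 2 = P at *
  field_simp

/-- A product `heunRho * u` solves the Heun equation if `u` solves the corresponding first order
system. -/
lemma isHeunSolutionAt_of_system {u g : ℂ → ℂ} {w : ℂ}
    (hu : ∀ᶠ s in 𝓝 w, IsBasePoint s ∧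
      HasDerivAt u (24 / (sqrtS s * (s - 1) * (s - 9)) * g s) s ∧
      HasDerivAt g (-3 * (s - 1) ^ 2 / (128 * s * sqrtS s) * u s) s) :
    IsHeunSolutionAt (fun s => heunRho s * u s) w := by
  let a : ℂ → ℂ := fun s => 24 / (sqrtS s * (s - 1) * (s - 9))
  have h1 : ∀ᶠ s in 𝓝 w, HasDerivAt (fun s => heunRho s * u s)
      (heunRho s * (heunL s * u s + a s * g s)) s := by
    filter_upwards [hu] with s hs
    exact ((hasDerivAt_heunRho hs.1).mul hs.2.1).congr_deriv (by simp only [a]; ring)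
  have h2 : ∀ᶠ s in 𝓝 w, HasDerivAt (fun s => heunRho s * (heunL s * u s + a s * g s))
      (heunCoeff s * (heunRho s * u s)) s := by
    filter_upwards [hu] with s hs
    have h0 := Complex.slitPlane_ne_zero hs.1.1
    have n1 := sub_ne_zero.mpr hs.1.2.1
    have n9 := sub_ne_zero.mpr hs.1.2.2.1
    have hz : sqrtS s ≠ 0 := fun h => h0 (by rw [← sqrtS_sq s, h]; simp)
    have hL : HasDerivAt heunL (1 / 4 * (-1 / s ^ 2 - 2 / (s - 1) ^ 2 - 2 / (s - 9) ^ 2)) s := by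
      have e1 := (hasDerivAt_id s).inv h0
      have e2 := (((hasDerivAt_id s).sub_const 1).inv n1).const_mul 2
      have e3 := (((hasDerivAt_id s).sub_const 9).inv n9).const_mul 2
      refine ((((e1.add e2).add e3).const_mul (1 / 4)).congr_deriv ?_).congr_of_eventuallyEq
        (Eventually.of_forall fun t => ?_)
      · simp only [id]; ring
      · simp only [heunL, Pi.add_apply, Pi.inv_apply, id]; ring
    -- a is proportional to the inverse square of `heunRho`, so a′/a = −2L. This removes the first
    -- derivative term.
    have ha : HasDerivAt a (-2 * heunL s * a s) s := by
      have := ((((hasDerivAt_sqrtS hs.1.1).mul ((hasDerivAt_id s).sub_const 1)).mul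
        ((hasDerivAt_id s).sub_const 9)).inv (mul_ne_zero (mul_ne_zero hz n1) n9)).const_mul 24
      refine (this.congr_deriv ?_).congr_of_eventuallyEq (Eventually.of_forall fun t => ?_)
      · simp only [id, Pi.mul_apply, a, heunL]
        have hs' := sqrtS_sq s
        generalize sqrtS s = z at *
        subst hs'
        field_simp
        ring
      · simp only [a, Pi.mul_apply, Pi.inv_apply, id]; ring
    have := (hasDerivAt_heunRho hs.1).mul ((hL.mul hs.2.1).add (ha.mul hs.2.2))
    refine this.congr_deriv ?_
    simp only [Pi.mul_apply, Pi.add_apply]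
    have hab : a s * (-3 * (s - 1) ^ 2 / (128 * s * sqrtS s)) = -9 * (s - 1) / (16 * s ^ 2 * (s - 9)) := by
      simp only [a]
      field_simp
      rw [sqrtS_sq]; ring
    -- The remaining potential is L² + L′ + ab, where b is the coefficient in g′ = bu.
    have hc : heunCoeff s = heunL s ^ 2 + 1 / 4 * (-1 / s ^ 2 - 2 / (s - 1) ^ 2 - 2 / (s - 9) ^ 2) +
        -9 * (s - 1) / (16 * s ^ 2 * (s - 9)) := by
      rw [heunCoeff, heunL]; field_simp; ring
    rw [hc, ← hab]
    ring
  constructor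
  · rw [Complex.analyticAt_iff_eventually_differentiableAt]
    exact h1.mono fun s hs => hs.differentiableAt
  · filter_upwards [h1.eventually_nhds, h2] with s hs hs2
    have : deriv (fun s => heunRho s * u s) =ᶠ[𝓝 s]
        fun s => heunRho s * (heunL s * u s + a s * g s) := hs.mono fun t ht => ht.deriv
    rw [this.deriv_eq, hs2.deriv]

lemma IsHeunSolutionAt.const_mul {f : ℂ → ℂ} {w : ℂ} (h : IsHeunSolutionAt f w) (c : ℂ) :
    IsHeunSolutionAt (fun s => c * f s) w := by
  refine ⟨analyticAt_const.mul h.1, ?_⟩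
  filter_upwards [h.1.eventually_analyticAt.eventually_nhds, h.2] with s hs h2
  have : deriv (fun s => c * f s) =ᶠ[𝓝 s] fun s => c * deriv f s :=
    hs.mono fun t ht => deriv_const_mul _ ht.differentiableAt
  rw [this.deriv_eq, deriv_const_mul _ hs.self_of_nhds.deriv.differentiableAt, h2]
  ring

lemma IsHeunSolutionAt.congr {f g : ℂ → ℂ} {w : ℂ} (h : IsHeunSolutionAt f w) (e : f =ᶠ[𝓝 w] g) :
    IsHeunSolutionAt g w := by
  refine ⟨h.1.congr e, ?_⟩
  filter_upwards [e.eventuallyEq_nhds, h.2] with s hs h2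
  rw [← hs.deriv.deriv_eq, h2, hs.eq_of_nhds]

/-- One computation for both solutions: m is `modX` with c = 1, or 1 − `modX` with c = −1. The
product m(1−m) is the same in both cases, and only the sign of m′ differs. -/
lemma hypF_system {s m' : ℂ} {m : ℂ → ℂ} (hb : IsBasePoint s) {c : ℂ} (hc : c ^ 2 = 1)
    (hm : HasDerivAt m m' (sqrtS s)) (h1 : ‖m (sqrtS s)‖ < 1)
    (he : m (sqrtS s) * (1 - m (sqrtS s)) = modX (sqrtS s) * (1 - modX (sqrtS s)))
    (hm' : m' = c * (-3 * ((sqrtS s) ^ 2 - 1) ^ 2 / (16 * (sqrtS s) ^ 2))) :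
    HasDerivAt (fun s => hypF (m (sqrtS s))) (24 / (sqrtS s * (s - 1) * (s - 9)) *
      (c * (m (sqrtS s) * (1 - m (sqrtS s)) * hypF' (m (sqrtS s))))) s ∧
    HasDerivAt (fun s => c * (m (sqrtS s) * (1 - m (sqrtS s)) * hypF' (m (sqrtS s))))
      (-3 * (s - 1) ^ 2 / (128 * s * sqrtS s) * hypF (m (sqrtS s))) s := by
  have h0 := Complex.slitPlane_ne_zero hb.1
  have n1 := sub_ne_zero.mpr hb.2.1
  have n9 := sub_ne_zero.mpr hb.2.2.1
  have hz : sqrtS s ≠ 0 := fun h => h0 (by rw [← sqrtS_sq s, h]; simp)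
  have hm2 := hm.comp s (hasDerivAt_sqrtS hb.1)
  have d1 := (hasDerivAt_hypF h1).comp s hm2
  have d2 := ((hasDerivAt_mul_hypF' h1).comp s hm2).const_mul c
  refine ⟨d1.congr_deriv ?_, d2.congr_deriv ?_⟩
  · rw [he, one_sub_modX hz, modX, hm']
    have hs := sqrtS_sq s
    generalize sqrtS s = z at *
    generalize hypF' (m z) = H
    subst hs
    have n1' : z ^ 2 - 1 ≠ 0 := n1
    have n9' : z ^ 2 - 9 ≠ 0 := n9
    field_simp
    ring
  · rw [hm']
    have hs := sqrtS_sq s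
    generalize sqrtS s = z at *
    generalize hypF (m z) = H
    subst hs
    field_simp
    linear_combination (-128 * H) * hc

lemma isHeunSolutionAt_heunBasis {w : ℂ} (hw : IsBasePoint w) (i : Fin 2) :
    IsHeunSolutionAt (fun s => heunBasis s i) w := by
  have hne : ∀ᶠ s in 𝓝 w, s ≠ 0 := hw.eventually.mono fun s hs => Complex.slitPlane_ne_zero hs.1
  fin_cases i
  · have h : IsHeunSolutionAt (fun s => heunRho s * hypF (1 - modX (sqrtS s))) w := by
      refine isHeunSolutionAt_of_system (g := fun s => -1 * ((1 - modX (sqrtS s)) *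
        (1 - (1 - modX (sqrtS s))) * hypF' (1 - modX (sqrtS s)))) (hw.eventually.mono fun s hs => ?_)
      have hz : sqrtS s ≠ 0 := fun h => Complex.slitPlane_ne_zero hs.1 (by rw [← sqrtS_sq s, h]; simp)
      exact ⟨hs, hypF_system (m := fun z => 1 - modX z) hs (by norm_num)
        ((hasDerivAt_modX hz).const_sub 1) hs.2.2.2.2.2 (by ring) (by ring)⟩
    refine ((h.const_mul (Real.pi / 2)).const_mul Complex.I).congr ?_
    filter_upwards [hne] with s hs using (heunBasis_zero hs).symm
  · have h : IsHeunSolutionAt (fun s => heunRho s * hypF (modX (sqrtS s))) w := by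
      refine isHeunSolutionAt_of_system (g := fun s => 1 * (modX (sqrtS s) *
        (1 - modX (sqrtS s)) * hypF' (modX (sqrtS s)))) (hw.eventually.mono fun s hs => ?_)
      have hz : sqrtS s ≠ 0 := fun h => Complex.slitPlane_ne_zero hs.1 (by rw [← sqrtS_sq s, h]; simp)
      exact ⟨hs, hypF_system (m := modX) hs (by norm_num)
        (hasDerivAt_modX hz) hs.2.2.2.2.1 rfl (by ring)⟩
    refine (h.const_mul (Real.pi / 2)).congr ?_
    filter_upwards [hne] with s hs using (heunBasis_one hs).symm

/-- The values of the basis on the imaginary axis. -/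
lemma heunBasis_hauptS_mul_I {y : ℝ} (hy : 0 < y) :
    heunBasis (hauptS (y * Complex.I)) =
      ![y * Complex.I * rootD (y * Complex.I), rootD (y * Complex.I)] := by
  have hτ := im_mul_I_pos hy
  obtain ⟨z, h1, h3, hz⟩ := multZ_mul_I hy
  obtain ⟨a, ha, e⟩ := theta3_mul_I hy
  obtain ⟨d, hd, ed⟩ := rootD_mul_I hy
  have hs : hauptS (y * Complex.I) = (z ^ 2 : ℝ) := by rw [← multZ_sq, hz]; push_cast; rfl
  have hs0 := hauptS_ne_zero hτ
  have hz' : sqrtS (hauptS (y * Complex.I)) = multZ (y * Complex.I) := by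
    rw [hs, ofReal_sqrtS (by positivity), Real.sqrt_sq (by linarith), hz]
  -- Both sides are positive and their fourth powers agree by `rootD_pow_four`. This is where the
  -- principal fourth root and the choice of sign of D are matched.
  have hρ : Real.pi / 2 * (heunRho (hauptS (y * Complex.I)) * theta3 0 (y * Complex.I) ^ 2) =
      rootD (y * Complex.I) := by
    have hP : 0 ≤ z ^ 2 * (z ^ 2 - 1) ^ 2 * (z ^ 2 - 9) ^ 2 := by positivity
    have er : heunRho (hauptS (y * Complex.I)) =
        ((z ^ 2 * (z ^ 2 - 1) ^ 2 * (z ^ 2 - 9) ^ 2) ^ (1 / 4 : ℝ) : ℝ) := by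
      rw [heunRho, hs, Complex.ofReal_cpow hP]; push_cast; rfl
    have h4 := rootD_pow_four hτ
    rw [ed, e, hs] at h4
    have h4' : d ^ 4 = (Real.pi / 2 * a ^ 2) ^ 4 * (z ^ 2 * (z ^ 2 - 1) ^ 2 * (z ^ 2 - 9) ^ 2) := by
      exact_mod_cast h4
    rw [er, ed, e]
    have : Real.pi / 2 * ((z ^ 2 * (z ^ 2 - 1) ^ 2 * (z ^ 2 - 9) ^ 2) ^ (1 / 4 : ℝ) * a ^ 2) = d := by
      rw [← pow_left_inj₀ (by positivity) hd.le four_ne_zero, h4', mul_pow, mul_pow, mul_pow,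
        ← Real.rpow_natCast ((z ^ 2 * (z ^ 2 - 1) ^ 2 * (z ^ 2 - 9) ^ 2) ^ (1 / 4 : ℝ)),
        ← Real.rpow_mul hP]
      norm_num
      ring
    exact_mod_cast this
  funext i
  fin_cases i
  · change heunBasis _ 0 = _
    rw [heunBasis_zero hs0, hz', ← thetaX_pow_four_eq_modX hτ]
    have : 1 - thetaX (y * Complex.I) ^ 4 = thetaY (y * Complex.I) ^ 4 := by
      rw [thetaX_pow_four_eq_modX hτ, one_sub_modX (multZ_ne_zero hτ), thetaY_pow_four hτ]
    rw [this, hypF_thetaY hy]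
    simp only [Fin.zero_eta, Matrix.cons_val_zero]
    rw [← hρ]; ring
  · change heunBasis _ 1 = _
    rw [heunBasis_one hs0, hz', ← thetaX_pow_four_eq_modX hτ, hypF_thetaX hy, hρ]
    rfl

lemma isBasePoint_hauptS_mul_I {y : ℝ} (hy : 0 < y) : IsBasePoint (hauptS (y * Complex.I)) := by
  obtain ⟨z, h1, h3, hz⟩ := multZ_mul_I hy
  have hs : hauptS (y * Complex.I) = (z ^ 2 : ℝ) := by rw [← multZ_sq, hz]; push_cast; rfl
  rw [hs]
  exact isBasePoint_ofReal (by nlinarith) (by nlinarith)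

/-- The basis as a function of `τ` near the imaginary axis. -/
theorem heunBasis_hauptS {y : ℝ} (hy : 0 < y) :
    ∀ᶠ τ in 𝓝 ((y : ℂ) * Complex.I), heunBasis (hauptS τ) = ![τ * rootD τ, rootD τ] := by
  have hτ := im_mul_I_pos hy
  have as : AnalyticAt ℂ hauptS (y * Complex.I) :=
    analyticOnNhd_im_pos (fun τ hτ => differentiableAt_hauptS hτ) _ hτ
  have ad : AnalyticAt ℂ rootD (y * Complex.I) :=
    analyticOnNhd_im_pos (fun τ hτ => differentiableAt_rootD hτ) _ hτ
  -- Points of the axis accumulate at iy, so equality on the axis extends to a neighbourhood by the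
  -- identity theorem.
  have hfreq : ∃ᶠ τ in 𝓝[≠] ((y : ℂ) * Complex.I), ∃ x : ℝ, 0 < x ∧ τ = x * Complex.I := by
    have hinj : Function.Injective (fun x : ℝ => (x : ℂ) * Complex.I) := fun a b h => by
      simpa using h
    have hc : Continuous (fun x : ℝ => (x : ℂ) * Complex.I) := by fun_prop
    have ht : Tendsto (fun x : ℝ => (x : ℂ) * Complex.I) (𝓝[≠] y) (𝓝[≠] ((y : ℂ) * Complex.I)) :=
      tendsto_nhdsWithin_of_tendsto_nhds_of_eventually_within _
        (hc.continuousAt.tendsto.mono_left nhdsWithin_le_nhds) (by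
          filter_upwards [self_mem_nhdsWithin] with x hx using fun h => hx (hinj h))
    refine ht.frequently (Eventually.frequently ?_)
    filter_upwards [nhdsWithin_le_nhds (Ioi_mem_nhds hy)] with x hx using ⟨x, hx, rfl⟩
  have key : ∀ i, ∀ᶠ τ in 𝓝 ((y : ℂ) * Complex.I),
      heunBasis (hauptS τ) i = ![τ * rootD τ, rootD τ] i := by
    intro i
    have ab : AnalyticAt ℂ (fun τ => heunBasis (hauptS τ) i) (y * Complex.I) :=
      AnalyticAt.fun_comp (g := fun s => heunBasis s i)
        (isHeunSolutionAt_heunBasis (isBasePoint_hauptS_mul_I hy) i).1 as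
    have ar : AnalyticAt ℂ (fun τ => ![τ * rootD τ, rootD τ] i) (y * Complex.I) := by
      fin_cases i
      · exact analyticAt_id.mul ad
      · exact ad
    refine (ab.frequently_eq_iff_eventually_eq ar).mp (hfreq.mono ?_)
    rintro τ ⟨x, hx, rfl⟩
    exact congrFun (heunBasis_hauptS_mul_I hx) i
  filter_upwards [key 0, key 1] with τ h0 h1
  funext i
  fin_cases i
  · exact h0
  · exact h1

end

noncomputable section

/-! ### The covering defined by `hauptS` -/

lemma analyticAt_hauptS {τ : ℂ} (hτ : 0 < τ.im) : AnalyticAt ℂ hauptS τ :=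
  analyticOnNhd_im_pos (fun _ h => differentiableAt_hauptS h) τ hτ

lemma analyticAt_rootD {τ : ℂ} (hτ : 0 < τ.im) : AnalyticAt ℂ rootD τ :=
  analyticOnNhd_im_pos (fun _ h => differentiableAt_rootD h) τ hτ

theorem hauptS_smul {g : SL(2, ℤ)} (hg : g ∈ intHeunGroup) (τ : ℍ) :
    hauptS ↑(g • τ) = hauptS τ :=
  invariant_of_periodic (f := fun t : ℍ => hauptS t)
    (fun u => by
      rw [cuspMat_zero_smul, cuspMat_zero_smul]
      have : (((2 : ℝ) +ᵥ u : ℍ) : ℂ) = u + 2 := by simp [add_comm]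
      rw [this, hauptS_add_two])
    (fun u => by
      rw [coe_cuspMat_two_smul, coe_cuspMat_two_smul]
      have h := hauptS_cusp_one_periodic (im_div_three u.im_pos)
      have : (((3 : ℝ) +ᵥ u : ℍ) : ℂ) = 3 * (u / 3 + 1) := by simp; ring
      rw [this, h, mul_div_cancel₀ _ (three_ne_zero' ℂ)])
    (fun u => by
      rw [coe_cuspMat_three_smul, coe_cuspMat_three_smul]
      have : (((1 : ℝ) +ᵥ u : ℍ) : ℂ) = u + 1 := by simp [add_comm]
      rw [this, hauptS_cusp_third_periodic u.im_pos])
    g hg τ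

lemma continuous_hauptS : Continuous fun τ : ℍ => hauptS τ :=
  continuous_iff_continuousAt.mpr fun τ =>
    (differentiableAt_hauptS τ.im_pos).continuousAt.comp (f := UpperHalfPlane.coe)
      UpperHalfPlane.continuous_coe.continuousAt

lemma map_hauptS_nhds {τ : ℂ} (hτ : 0 < τ.im) : map hauptS (𝓝 τ) = 𝓝 (hauptS τ) :=
  (analyticAt_hauptS hτ).hasStrictDerivAt.map_nhds_eq (deriv_hauptS_ne_zero hτ)

lemma eventually_nhds_hauptS {τ : ℂ} (hτ : 0 < τ.im) {p : ℂ → Prop} :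
    (∀ᶠ s in 𝓝 (hauptS τ), p s) ↔ ∀ᶠ t in 𝓝 τ, p (hauptS t) := by
  rw [← map_hauptS_nhds hτ, eventually_map]

lemma exists_local_inverse {τ : ℂ} (hτ : 0 < τ.im) : ∃ ι : ℂ → ℂ, AnalyticAt ℂ ι (hauptS τ) ∧
    ∀ᶠ t in 𝓝 τ, ι (hauptS t) = t :=
  ⟨_, (analyticAt_hauptS hτ).analyticAt_localInverse (deriv_hauptS_ne_zero hτ),
    HasStrictDerivAt.eventually_left_inverse ..⟩

lemma continuousAt_ofComplex {z : ℂ} (hz : 0 < z.im) : ContinuousAt ofComplex z :=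
  (contMDiffAt_ofComplex (n := 0) hz).continuousAt

/-- The values of `hauptS` at the four cusps. -/
def cuspValue : Fin 4 → OnePoint ℂ := ![((9 : ℂ) : OnePoint ℂ), ((1 : ℂ) : OnePoint ℂ),
  OnePoint.infty, ((0 : ℂ) : OnePoint ℂ)]

lemma hauptS_cusp_regular_zero (u : ℍ) : hauptS ↑(cuspMat 0 • u) = 9 * expS (nome u) := by
  rw [cuspMat_zero_smul]; exact hauptS_expansion u.im_pos

lemma hauptS_cusp_regular_one (u : ℍ) : hauptS ↑(cuspMat 1 • u) = (expS (nome (u / 3)))⁻¹ := by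
  rw [coe_cuspMat_one_smul, expS, ← hauptS_cusp_zero_expansion (im_div_three u.im_pos),
    mul_div_cancel₀ _ (three_ne_zero' ℂ)]

lemma hauptS_cusp_regular_two (u : ℍ) : hauptS ↑(cuspMat 2 • u) = (expR (nome (u / 3) ^ 2))⁻¹ := by
  rw [coe_cuspMat_two_smul, expR, ← hauptS_cusp_one_expansion (im_div_three u.im_pos),
    mul_div_cancel₀ _ (three_ne_zero' ℂ)]

lemma hauptS_cusp_regular_three (u : ℍ) : hauptS ↑(cuspMat 3 • u) = 9 * expR (nome u ^ 2) := by
  rw [coe_cuspMat_three_smul, hauptS_cusp_third_expansion u.im_pos, expR, mul_assoc]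

/-- Read off at zero local parameter: `expS` is 1 and `expR` is 0 there, and s equals 9·`expS`,
1/`expS`, 1/`expR`, 9·`expR` at the four cusps. `OnePoint` treats the pole on the same footing. -/
theorem tendsto_hauptS_cusp (c : Fin 4) :
    Tendsto (fun u : ℍ => (hauptS ↑(cuspMat c • u) : OnePoint ℂ)) atImInfty (𝓝 (cuspValue c)) := by
  have n0 := tendsto_nome_atImInfty.mono_right nhdsWithin_le_nhds
  have n3 := tendsto_nome_div_three_atImInfty.mono_right nhdsWithin_le_nhds
  have hS : Tendsto expS (𝓝 0) (𝓝 1) := by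
    simpa [expS_zero] using analyticAt_expS_zero.continuousAt.tendsto
  have hR : Tendsto expR (𝓝 0) (𝓝 0) := by
    simpa [expR_zero] using analyticAt_expR_zero.continuousAt.tendsto
  have sq : Tendsto (fun x : ℂ => x ^ 2) (𝓝 0) (𝓝 0) := by
    have : ContinuousAt (fun x : ℂ => x ^ 2) 0 := by fun_prop
    simpa using this.tendsto
  fin_cases c
  · refine (OnePoint.continuous_coe.tendsto (9 : ℂ)).comp ?_
    have := (hS.comp n0).const_mul 9
    rw [mul_one] at this
    exact this.congr fun u => (hauptS_cusp_regular_zero u).symm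
  · refine (OnePoint.continuous_coe.tendsto (1 : ℂ)).comp ?_
    have := (hS.comp n3).inv₀ one_ne_zero
    rw [inv_one] at this
    exact this.congr fun u => (hauptS_cusp_regular_one u).symm
  · refine OnePoint.tendsto_coe_infty.comp ?_
    rw [coclosedCompact_eq_cocompact, ← Metric.cobounded_eq_cocompact]
    have : Tendsto (fun u : ℍ => expR (nome (u / 3) ^ 2)) atImInfty (𝓝[≠] 0) :=
      tendsto_nhdsWithin_iff.mpr ⟨(hR.comp sq).comp n3, Eventually.of_forall fun u =>
        expR_ne_zero (im_div_three u.im_pos)⟩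
    exact (tendsto_inv₀_nhdsNE_zero.comp this).congr fun u => (hauptS_cusp_regular_two u).symm
  · refine (OnePoint.continuous_coe.tendsto (0 : ℂ)).comp ?_
    have := ((hR.comp sq).comp n0).const_mul 9
    rw [mul_zero] at this
    exact this.congr fun u => (hauptS_cusp_regular_three u).symm

/-- Properness at a cusp: high points have values of s near the cusp value, hence outside the
compact set K. -/
lemma exists_im_bound {K : Set ℂ} (hK : IsCompact K) {c : Fin 4}
    (hn : cuspValue c ∉ (((↑) : ℂ → OnePoint ℂ) '' K)) :
    ∃ M : ℝ, ∀ u : ℍ, hauptS ↑(cuspMat c • u) ∈ K → u.im ≤ M := by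
  have hc : IsClosed (((↑) : ℂ → OnePoint ℂ) '' K) :=
    (hK.image OnePoint.continuous_coe).isClosed
  have := (tendsto_hauptS_cusp c).eventually (hc.isOpen_compl.mem_nhds hn)
  rw [atImInfty, eventually_comap] at this
  obtain ⟨M, hM⟩ := eventually_atTop.mp this
  refine ⟨M, fun u hu => le_of_not_gt fun h => hM _ h.le u rfl ⟨_, hu, rfl⟩⟩

lemma cuspValue_notMem {K : Set ℂ} (hKd : K ⊆ heunDomain) (c : Fin 4) :
    cuspValue c ∉ (((↑) : ℂ → OnePoint ℂ) '' K) := by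
  rintro ⟨s, hs, h⟩
  have := hKd hs
  simp only [heunDomain, Set.mem_compl_iff, Set.mem_insert_iff, Set.mem_singleton_iff,
    not_or] at this
  fin_cases c
  · exact this.2.2 (OnePoint.coe_injective h)
  · exact this.2.1 (OnePoint.coe_injective h)
  · exact OnePoint.coe_ne_infty s h
  · exact this.1 (OnePoint.coe_injective h)

/-- The part of the upper half plane below the height `M c` at the cusps. -/
def truncatedRegion (M : Fin 4 → ℝ) : Set ℍ := ⋃ c, (fun t : ℍ => cuspMat c • t) ''
  (ofComplex '' (Set.Icc (-7) 7 ×ℂ Set.Icc (1 / 2) (M c)))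

lemma continuous_intSL_smul (g : SL(2, ℤ)) : Continuous fun τ : ℍ => g • τ :=
  continuous_const_smul (g : SL(2, ℝ))

lemma isCompact_truncatedRegion (M : Fin 4 → ℝ) : IsCompact (truncatedRegion M) := by
  refine isCompact_iUnion fun c => IsCompact.image ?_ (continuous_intSL_smul (cuspMat c))
  refine (isCompact_Icc.reProdIm isCompact_Icc).image_of_continuousOn fun z hz => ?_
  have : (1 / 2 : ℝ) ≤ z.im := hz.2.1
  exact (continuousAt_ofComplex (by linarith)).continuousWithinAt

lemma mem_truncatedRegion {M : Fin 4 → ℝ} {c : Fin 4} {u : ℍ} (h1 : |u.re| ≤ 7)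
    (h2 : 1 / 2 ≤ u.im) (h3 : u.im ≤ M c) : cuspMat c • u ∈ truncatedRegion M :=
  Set.mem_iUnion.mpr ⟨c, u, ⟨u, ⟨abs_le.mp h1, h2, h3⟩, ofComplex_apply u⟩, rfl⟩

/-- A section of `hauptS` over a disc. -/
def HasSection (τ : ℍ) (ε : ℝ) : Prop :=
  ∃ σ : ℂ → ℍ, ContinuousOn σ (Metric.ball (hauptS τ) ε) ∧
    (∀ w ∈ Metric.ball (hauptS τ) ε, hauptS (σ w) = w) ∧ σ (hauptS τ) = τ

lemma HasSection.mono {τ : ℍ} {ε δ : ℝ} (h : HasSection τ ε) (hδ : δ ≤ ε) : HasSection τ δ := by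
  obtain ⟨σ, h1, h2, h3⟩ := h
  exact ⟨σ, h1.mono (Metric.ball_subset_ball hδ), fun w hw => h2 w (Metric.ball_subset_ball hδ hw), h3⟩

lemma HasSection.smul {τ : ℍ} {ε : ℝ} (h : HasSection τ ε) {g : SL(2, ℤ)} (hg : g ∈ intHeunGroup) :
    HasSection (g • τ) ε := by
  obtain ⟨σ, h1, h2, h3⟩ := h
  refine ⟨fun w => g • σ w, ?_, ?_, ?_⟩
  · rw [hauptS_smul hg]
    exact (continuous_intSL_smul g).comp_continuousOn h1
  · rw [hauptS_smul hg]
    exact fun w hw => by rw [hauptS_smul hg, h2 w hw]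
  · simp only [hauptS_smul hg, h3]

/-- Halving the radius lets a single local inverse at τ₀ serve every nearby τ, so the radius does
not depend on τ. -/
lemma exists_section_near (τ₀ : ℍ) : ∃ ε > 0, ∀ᶠ τ in 𝓝 τ₀, HasSection τ ε := by
  obtain ⟨ι, hι, hl⟩ := exists_local_inverse τ₀.im_pos
  have h0 : ι (hauptS τ₀) = τ₀ := hl.self_of_nhds
  have e1 : ∀ᶠ s in 𝓝 (hauptS τ₀), hauptS (ι s) = s :=
    (eventually_nhds_hauptS τ₀.im_pos).mpr (hl.mono fun t ht => by rw [ht])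
  have e2 : ∀ᶠ s in 𝓝 (hauptS τ₀), 0 < (ι s).im :=
    hι.continuousAt.eventually_mem (isOpen_upperHalfPlaneSet.mem_nhds (by
      rw [h0]; exact τ₀.im_pos))
  obtain ⟨r, hr, hb⟩ := Metric.eventually_nhds_iff_ball.mp
    (hι.eventually_analyticAt.and (e1.and e2))
  refine ⟨r / 2, half_pos hr, ?_⟩
  have n1 : ∀ᶠ τ : ℍ in 𝓝 τ₀, hauptS τ ∈ Metric.ball (hauptS τ₀) (r / 2) :=
    continuous_hauptS.continuousAt.eventually_mem (Metric.ball_mem_nhds _ (half_pos hr))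
  have n2 : ∀ᶠ τ : ℍ in 𝓝 τ₀, ι (hauptS τ) = τ :=
    UpperHalfPlane.continuous_coe.continuousAt.eventually hl
  filter_upwards [n1, n2] with τ h1 h2
  have hsub : Metric.ball (hauptS τ) (r / 2) ⊆ Metric.ball (hauptS τ₀) r :=
    Metric.ball_subset_ball' (by
      have := Metric.mem_ball.mp h1
      linarith)
  refine ⟨fun w => ofComplex (ι w), fun w hw => ?_, fun w hw => ?_, ?_⟩
  · obtain ⟨b1, b2, b3⟩ := hb w (hsub hw)
    exact (ContinuousAt.comp (continuousAt_ofComplex b3) b1.continuousAt).continuousWithinAt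
  · obtain ⟨b1, b2, b3⟩ := hb w (hsub hw)
    simp only [ofComplex_apply_of_im_pos b3]
    exact b2
  · simp only [h2, ofComplex_apply]

/-- A compact set that meets every orbit lying over a compact set. -/
lemma exists_compact_region {K : Set ℂ} (hK : IsCompact K) (hKd : K ⊆ heunDomain) :
    ∃ C : Set ℍ, IsCompact C ∧ ∀ τ : ℍ, hauptS τ ∈ K → ∃ g ∈ intHeunGroup, ∃ t ∈ C, τ = g • t := by
  choose M hM using fun c => exists_im_bound hK (cuspValue_notMem hKd c)
  refine ⟨truncatedRegion M, isCompact_truncatedRegion M, fun τ hτ => ?_⟩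
  obtain ⟨g, hg, c, u, h1, h2, rfl⟩ := exists_cusp_region τ
  rw [hauptS_smul hg] at hτ
  exact ⟨g, hg, cuspMat c • u, mem_truncatedRegion h1 h2 (hM c u hτ), rfl⟩

/-- The radius is uniform on a compact set meeting every orbit over K, and sections are carried
along orbits by G_s-invariance. This replaces evenly covered neighbourhoods in the lifting argument.
-/
theorem exists_uniform_section {K : Set ℂ} (hK : IsCompact K) (hKd : K ⊆ heunDomain) :
    ∃ ε > 0, ∀ τ : ℍ, hauptS τ ∈ K → HasSection τ ε := by
  obtain ⟨C, hC, hcov⟩ := exists_compact_region hK hKd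
  have : ∃ ε > 0, ∀ t ∈ C, HasSection t ε := by
    refine hC.induction_on (p := fun C => ∃ ε > 0, ∀ t ∈ C, HasSection t ε) ⟨1, one_pos, by simp⟩
      (fun s t hst ⟨ε, h, h'⟩ => ⟨ε, h, fun x hx => h' x (hst hx)⟩)
      (fun s t ⟨ε, h, h'⟩ ⟨δ, k, k'⟩ => ⟨min ε δ, lt_min h k, fun x hx => ?_⟩) (fun t _ => ?_)
    · rcases hx with hx | hx
      · exact (h' x hx).mono (min_le_left _ _)
      · exact (k' x hx).mono (min_le_right _ _)
    · obtain ⟨ε, hε, h⟩ := exists_section_near t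
      exact ⟨_, nhdsWithin_le_nhds h, ε, hε, fun x hx => hx⟩
  obtain ⟨ε, hε, h⟩ := this
  refine ⟨ε, hε, fun τ hτ => ?_⟩
  obtain ⟨g, hg, t, ht, rfl⟩ := hcov τ hτ
  exact (h t ht).smul hg

/-- Paths in `heunDomain` lift to the upper half plane. -/
theorem exists_lift {a b : ℂ} (γ : Path a b) (hγ : ∀ t, γ t ∈ heunDomain) {τ : ℍ}
    (hτ : hauptS τ = a) : ∃ Γ : C(unitInterval, ℍ), Γ 0 = τ ∧ ∀ t, hauptS (Γ t) = γ t := by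
  have hK : IsCompact (Set.range γ) := isCompact_range γ.continuous
  obtain ⟨ε, hε, hsec⟩ := exists_uniform_section hK (by rintro _ ⟨t, rfl⟩; exact hγ t)
  have hu : UniformContinuous γ := CompactSpace.uniformContinuous_of_continuous γ.continuous
  obtain ⟨δ, hδ, hd⟩ := Metric.uniformContinuous_iff.mp hu ε hε
  obtain ⟨n, hn⟩ := exists_nat_one_div_lt hδ
  have hn0 : (0 : ℝ) < n + 1 := by positivity
  let p : ℝ → ℂ := γ.extend
  have hp : Continuous p := γ.continuous_extend
  have hclose : ∀ t t' : ℝ, t ∈ Set.Icc (0 : ℝ) 1 → t' ∈ Set.Icc (0 : ℝ) 1 → |t - t'| ≤ 1 / (n + 1) →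
      p t ∈ Metric.ball (p t') ε := by
    intro t t' ht ht' h
    simp only [p]
    rw [Path.extend_apply _ ht, Path.extend_apply _ ht']
    refine hd (?_ : dist (⟨t, ht⟩ : unitInterval) ⟨t', ht'⟩ < δ)
    rw [Subtype.dist_eq, Real.dist_eq]
    exact h.trans_lt hn
  -- The path is cut into n + 1 pieces, each inside a disc that carries a section through the
  -- current endpoint; the lift is extended piece by piece.
  have key : ∀ k : ℕ, k ≤ n + 1 → ∃ Γ : ℝ → ℍ, ContinuousOn Γ (Set.Icc 0 (k / (n + 1))) ∧ Γ 0 = τ ∧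
      ∀ t ∈ Set.Icc (0 : ℝ) (k / (n + 1)), hauptS (Γ t) = p t := by
    intro k
    induction k with
    | zero =>
      intro _
      refine ⟨fun _ => τ, continuousOn_const, rfl, fun t ht => ?_⟩
      have : t = 0 := by simpa using ht
      rw [this, hτ]; simp [p]
    | succ k ih =>
      intro hk
      obtain ⟨Γ, h1, h2, h3⟩ := ih (by lia)
      set t0 : ℝ := k / (n + 1) with ht0
      have e1 : ((k + 1 : ℕ) : ℝ) / (n + 1) = t0 + 1 / (n + 1) := by rw [ht0]; push_cast; ring
      have h0 : 0 ≤ t0 := by positivity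
      have hle : t0 + 1 / (n + 1) ≤ 1 := by
        rw [← e1, div_le_one hn0]; exact_mod_cast hk
      have hpos : 0 < 1 / ((n : ℝ) + 1) := by positivity
      rw [e1]
      have hS0 := h3 t0 ⟨h0, le_rfl⟩
      have m0 : t0 ∈ Set.Icc (0 : ℝ) 1 := ⟨h0, by linarith⟩
      obtain ⟨σ, s1, s2, s3⟩ := hsec (Γ t0) (by
        rw [hS0]; simp only [p]; rw [Path.extend_apply _ m0]; exact Set.mem_range_self _)
      rw [hS0] at s1 s2 s3
      have hmem : ∀ t ∈ Set.Icc t0 (t0 + 1 / (n + 1)), p t ∈ Metric.ball (p t0) ε := by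
        intro t ht
        refine hclose t t0 ⟨h0.trans ht.1, ht.2.trans hle⟩ m0 ?_
        rw [abs_of_nonneg (by linarith [ht.1])]
        linarith [ht.2]
      refine ⟨fun t => if t ≤ t0 then Γ t else σ (p t), ?_, ?_, ?_⟩
      · rw [← Set.Icc_union_Icc_eq_Icc h0 (by linarith : t0 ≤ t0 + 1 / (n + 1))]
        refine ContinuousOn.union_of_isClosed ?_ ?_ isClosed_Icc isClosed_Icc
        · exact h1.congr fun t ht => if_pos ht.2
        · refine (s1.comp hp.continuousOn hmem).congr fun t ht => ?_
          rcases ht.1.eq_or_lt with h | h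
          · rw [if_pos h.symm.le, ← h, Function.comp_apply, s3]
          · rw [if_neg h.not_ge, Function.comp_apply]
      · simp only [if_pos h0, h2]
      · intro t ht
        by_cases h : t ≤ t0
        · simp only [if_pos h, h3 t ⟨ht.1, h⟩]
        · simp only [if_neg h, s2 _ (hmem t ⟨(not_le.mp h).le, ht.2⟩)]
  obtain ⟨Γ, h1, h2, h3⟩ := key (n + 1) le_rfl
  have e : ((n + 1 : ℕ) : ℝ) / (n + 1) = 1 := by push_cast; exact div_self hn0.ne'
  rw [e] at h1 h3
  refine ⟨⟨fun t => Γ t, continuousOn_iff_continuous_domRestrict.mp h1⟩, h2, fun t => ?_⟩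
  change hauptS (Γ t) = _
  rw [h3 t t.2]
  simp only [p]
  rw [Path.extend_apply _ t.2]

/-- Two lifts of a path that agree at one point are equal. -/
theorem lift_unique {Γ Δ : C(unitInterval, ℍ)} (h : ∀ t, hauptS (Γ t) = hauptS (Δ t))
    {t₀ : unitInterval} (h0 : Γ t₀ = Δ t₀) : Γ = Δ := by
  have hcl : IsClosed {t | Γ t = Δ t} := isClosed_eq Γ.continuous Δ.continuous
  have hop : IsOpen {t | Γ t = Δ t} := by
    rw [isOpen_iff_mem_nhds]
    intro t ht
    obtain ⟨ι, -, hl⟩ := exists_local_inverse (Γ t).im_pos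
    have e1 : ∀ᶠ t' in 𝓝 t, ι (hauptS (Γ t')) = Γ t' :=
      ((UpperHalfPlane.continuous_coe.comp Γ.continuous).continuousAt (x := t)).eventually hl
    have e2 : ∀ᶠ t' in 𝓝 t, ι (hauptS (Δ t')) = Δ t' := by
      have ht' : Γ t = Δ t := ht
      rw [ht'] at hl
      exact ((UpperHalfPlane.continuous_coe.comp Δ.continuous).continuousAt (x := t)).eventually hl
    filter_upwards [e1, e2] with t' h1 h2
    rw [h t', h2] at h1
    exact UpperHalfPlane.ext h1.symm
  have := IsClopen.eq_univ ⟨hcl, hop⟩ ⟨t₀, h0⟩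
  ext1 t
  exact this.symm.subset (Set.mem_univ t)

end

noncomputable section

/-! ### Fibres of `hauptS` -/

lemma exists_injective_expS : ∃ δ > 0, ∀ q ∈ Metric.ball (0 : ℂ) δ, ∀ r ∈ Metric.ball (0 : ℂ) δ,
    expS q = expS r → q = r := by
  have hd : deriv expS 0 ≠ 0 := by rw [deriv_expS_zero]; norm_num
  have hl := analyticAt_expS_zero.hasStrictDerivAt.eventually_left_inverse hd
  obtain ⟨δ, hδ, h⟩ := Metric.eventually_nhds_iff_ball.mp hl
  exact ⟨δ, hδ, fun q hq r hr e => by rw [← h q hq, e, h r hr]⟩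

lemma intT9_eq : ModularGroup.T ^ (-2 : ℤ) = intT9 := by
  rw [zpow_neg]
  change (ModularGroup.T ^ (2 : ℕ))⁻¹ = _
  decide

lemma eq_smul_of_nome_eq {u v : ℍ} (h : nome u = nome v) : ∃ g ∈ intHeunGroup, v = g • u := by
  obtain ⟨n, hn⟩ := Complex.exp_eq_exp_iff_exists_int.mp h
  have hpi : (Real.pi : ℂ) * Complex.I ≠ 0 := by simp [Real.pi_ne_zero]
  have e : (v : ℂ) = ((-2 * n : ℤ) : ℂ) + u := by
    push_cast
    refine mul_left_cancel₀ hpi ?_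
    linear_combination -hn
  refine ⟨intT9 ^ n, zpow_mem intT9_mem n, UpperHalfPlane.ext ?_⟩
  have hT : intT9 ^ n = ModularGroup.T ^ (-2 * n) := by
    rw [zpow_mul, intT9_eq]
  rw [hT, modular_T_zpow_smul, e]
  simp

/-- Near s = 9 a point must lie high at a cusp equivalent to ∞. There s = 9·`expS` is injective in
the nome because `expS` has derivative −8 at 0. Equal nomes then differ by an even translation, a
power of T₉. -/
lemma exists_smul_eq_near_nine : ∃ ε > 0, ∀ τ₁ τ₂ : ℍ, hauptS τ₁ = hauptS τ₂ →
    hauptS τ₁ ∈ Metric.ball (9 : ℂ) ε → ∃ g ∈ intHeunGroup, τ₂ = g • τ₁ := by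
  obtain ⟨δ, hδ, hinj⟩ := exists_injective_expS
  have hsmall := (tendsto_nome_atImInfty.mono_right nhdsWithin_le_nhds).eventually
    (Metric.ball_mem_nhds (0 : ℂ) hδ)
  rw [atImInfty, eventually_comap] at hsmall
  obtain ⟨M₀, hM₀⟩ := eventually_atTop.mp hsmall
  have hK : IsCompact (Metric.closedBall (9 : ℂ) 1) := isCompact_closedBall _ _
  have hn : ∀ c : Fin 4, c ≠ 0 →
      cuspValue c ∉ (((↑) : ℂ → OnePoint ℂ) '' Metric.closedBall (9 : ℂ) 1) := by
    rintro c hc ⟨s, hs, h⟩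
    rw [Metric.mem_closedBall, dist_eq_norm] at hs
    fin_cases c
    · exact hc rfl
    · rw [OnePoint.coe_injective h] at hs; norm_num at hs
    · exact OnePoint.coe_ne_infty s h
    · rw [OnePoint.coe_injective h] at hs; norm_num at hs
  -- At the three cusps with values other than 9 the height is bounded over a disc about 9; at ∞ the
  -- cut is made where the nome enters the disc of injectivity. The truncated region is compact and
  -- s omits 9, so values close enough to 9 come only from above the cut at ∞.
  have hM : ∀ c : Fin 4, ∃ M : ℝ, (c = 0 → M = M₀) ∧ (c ≠ 0 → ∀ u : ℍ,
      hauptS ↑(cuspMat c • u) ∈ Metric.closedBall (9 : ℂ) 1 → u.im ≤ M) := by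
    intro c
    by_cases hc : c = 0
    · exact ⟨M₀, fun _ => rfl, fun h => absurd hc h⟩
    · obtain ⟨M, hM⟩ := exists_im_bound hK (hn c hc)
      exact ⟨M, fun h => absurd h hc, fun _ => hM⟩
  choose M hM1 hM2 using hM
  have hC : IsClosed ((fun τ : ℍ => hauptS τ) '' truncatedRegion M) :=
    ((isCompact_truncatedRegion M).image continuous_hauptS).isClosed
  have h9 : (9 : ℂ) ∉ ((fun τ : ℍ => hauptS τ) '' truncatedRegion M) := by
    rintro ⟨τ, -, h⟩
    exact hauptS_ne_nine τ.im_pos h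
  obtain ⟨ε, hε, hball⟩ := Metric.mem_nhds_iff.mp (hC.isOpen_compl.mem_nhds h9)
  have key : ∀ τ : ℍ, hauptS τ ∈ Metric.ball (9 : ℂ) (min ε 1) →
      ∃ g ∈ intHeunGroup, ∃ u : ℍ, M₀ < u.im ∧ τ = g • u := by
    intro τ hτ
    obtain ⟨g, hg, c, u, h1, h2, rfl⟩ := exists_cusp_region τ
    rw [hauptS_smul hg] at hτ
    have hlt : M c < u.im := lt_of_not_ge fun h =>
      hball (Metric.ball_subset_ball (min_le_left _ _) hτ) ⟨_, mem_truncatedRegion h1 h2 h, rfl⟩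
    have hc : c = 0 := by
      by_contra hc
      exact hlt.not_ge (hM2 c hc u (Metric.ball_subset_closedBall
        (Metric.ball_subset_ball (min_le_right _ _) hτ)))
    subst hc
    exact ⟨g, hg, u, by rwa [hM1 0 rfl] at hlt, by rw [cuspMat_zero_smul]⟩
  refine ⟨min ε 1, lt_min hε one_pos, fun τ₁ τ₂ h h1 => ?_⟩
  obtain ⟨g₁, hg₁, u₁, hu₁, rfl⟩ := key τ₁ h1
  obtain ⟨g₂, hg₂, u₂, hu₂, rfl⟩ := key τ₂ (h ▸ h1)
  rw [hauptS_smul hg₁, hauptS_smul hg₂] at h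
  have h' : 9 * expS (nome u₁) = 9 * expS (nome u₂) := by
    rw [← hauptS_cusp_regular_zero, ← hauptS_cusp_regular_zero, cuspMat_zero_smul,
      cuspMat_zero_smul, h]
  have hnome := hinj _ (hM₀ _ hu₁.le u₁ rfl) _ (hM₀ _ hu₂.le u₂ rfl)
    (mul_left_cancel₀ (by norm_num) h')
  obtain ⟨k, hk, e⟩ := eq_smul_of_nome_eq hnome
  refine ⟨g₂ * k * g₁⁻¹, mul_mem (mul_mem hg₂ hk) (inv_mem hg₁), ?_⟩
  rw [e, mul_smul, mul_smul, inv_smul_smul]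

lemma isPathConnected_heunDomain : IsPathConnected heunDomain :=
  Set.Countable.isPathConnected_compl_of_one_lt_rank (by
    rw [Complex.rank_real_complex]; norm_num) (Set.toFinite _).countable

/-- The fibres of `hauptS` are the orbits of the group. -/
theorem exists_smul_eq {τ₁ τ₂ : ℍ} (h : hauptS τ₁ = hauptS τ₂) :
    ∃ g ∈ intHeunGroup, τ₂ = g • τ₁ := by
  obtain ⟨ε, hε, hnear⟩ := exists_smul_eq_near_nine
  set e : ℝ := min ε 1 / 2 with he
  have he0 : 0 < e := by positivity
  have he1 : e < ε := by
    have := min_le_left ε 1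
    rw [he]; linarith
  have hmem : (9 : ℂ) + e ∈ heunDomain := by
    have h0 : (9 : ℝ) + e ≠ 0 := by linarith
    have h1 : (9 : ℝ) + e ≠ 1 := by linarith
    have h9 : (9 : ℝ) + e ≠ 9 := by linarith
    simp only [heunDomain, Set.mem_compl_iff, Set.mem_insert_iff, Set.mem_singleton_iff, not_or]
    exact ⟨by exact_mod_cast h0, by exact_mod_cast h1, by exact_mod_cast h9⟩
  obtain ⟨γ, hγ⟩ := isPathConnected_heunDomain.joinedIn _ (hauptS_mem_heunDomain τ₁.im_pos) _ hmem
  obtain ⟨Γ, hΓ0, hΓ⟩ := exists_lift γ hγ rfl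
  obtain ⟨Δ, hΔ0, hΔ⟩ := exists_lift γ hγ h.symm
  -- Both lifts end over 9 + e, where the fibre is known to be one orbit. Uniqueness of lifts
  -- carries the equivalence back to the starting points.
  obtain ⟨g, hg, hend⟩ := hnear (Γ 1) (Δ 1) (by rw [hΓ, hΔ]) (by
    rw [hΓ, γ.target, Metric.mem_ball, dist_eq_norm, add_sub_cancel_left,
      Complex.norm_of_nonneg he0.le]
    exact he1)
  let Γ' : C(unitInterval, ℍ) := ⟨fun t => g • Γ t, (continuous_intSL_smul g).comp Γ.continuous⟩
  have : Δ = Γ' := lift_unique (t₀ := 1) (fun t => by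
    change _ = hauptS ↑(g • Γ t)
    rw [hauptS_smul hg, hΓ, hΔ]) hend
  exact ⟨g, hg, by rw [← hΔ0, ← hΓ0, this]; rfl⟩

/-! ### Branches of the solutions -/

/-- The pair of solutions as a function on the upper half plane. -/
def pairPhi (τ : ℂ) : Fin 2 → ℂ := ![τ * rootD τ, rootD τ]

lemma analyticAt_pairPhi {τ : ℂ} (hτ : 0 < τ.im) : AnalyticAt ℂ pairPhi τ := by
  rw [analyticAt_pi_iff]
  intro i
  fin_cases i
  · exact analyticAt_id.mul (analyticAt_rootD hτ)
  · exact analyticAt_rootD hτ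

/-- The branch of the pair of solutions that belongs to a point of the upper half plane. -/
def branch (τ : ℍ) (s : ℂ) : Fin 2 → ℂ := pairPhi ((exists_local_inverse τ.im_pos).choose s)

lemma branch_hauptS (τ : ℍ) : ∀ᶠ t in 𝓝 (τ : ℂ), branch τ (hauptS t) = pairPhi t := by
  filter_upwards [(exists_local_inverse τ.im_pos).choose_spec.2] with t ht
  rw [branch, ht]

lemma analyticAt_branch (τ : ℍ) : AnalyticAt ℂ (branch τ) (hauptS τ) := by
  have h := (exists_local_inverse τ.im_pos).choose_spec
  have e : (exists_local_inverse τ.im_pos).choose (hauptS τ) = τ := h.2.self_of_nhds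
  exact AnalyticAt.fun_comp (g := pairPhi) (f := (exists_local_inverse τ.im_pos).choose)
    (by rw [e]; exact analyticAt_pairPhi τ.im_pos) h.1

/-- Germs at s(τ) are compared after pulling back to τ, where every branch is the same global pair.
This makes continuation along a lifted path automatic. -/
lemma eventuallyEq_branch {τ : ℍ} {f : ℂ → Fin 2 → ℂ} :
    f =ᶠ[𝓝 (hauptS τ)] branch τ ↔ ∀ᶠ t in 𝓝 (τ : ℂ), f (hauptS t) = pairPhi t := by
  rw [Filter.EventuallyEq, eventually_nhds_hauptS τ.im_pos]
  constructor <;> intro h <;> filter_upwards [h, branch_hauptS τ] with t h1 h2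
  · rw [h1, h2]
  · rw [h1, h2]

lemma isAnalyticContinuation_branch {a b : ℂ} {γ : Path a b} {Γ : C(unitInterval, ℍ)}
    (h : ∀ t, hauptS (Γ t) = γ t) : IsAnalyticContinuation γ fun t => branch (Γ t) := by
  refine ⟨fun t => h t ▸ analyticAt_branch (Γ t), fun t => ?_⟩
  have hc : ContinuousAt (fun t' => (Γ t' : ℂ)) t :=
    (UpperHalfPlane.continuous_coe.comp Γ.continuous).continuousAt
  filter_upwards [hc.eventually (branch_hauptS (Γ t)).eventually_nhds] with t' ht'
  rw [← h t']
  exact (eventuallyEq_branch.mpr ht').symm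

/-- Uniqueness of analytic continuation along a path. -/
theorem continuation_unique {a b : ℂ} {γ : Path a b} {F G : unitInterval → ℂ → Fin 2 → ℂ}
    (hF : IsAnalyticContinuation γ F) (hG : IsAnalyticContinuation γ G) (h0 : F 0 =ᶠ[𝓝 a] G 0) :
    ∀ t, F t =ᶠ[𝓝 (γ t)] G t := by
  have hop : IsOpen {t | F t =ᶠ[𝓝 (γ t)] G t} := by
    rw [isOpen_iff_mem_nhds]
    intro t ht
    have h1 : ∀ᶠ t' in 𝓝 t, F t =ᶠ[𝓝 (γ t')] G t :=
      γ.continuous.continuousAt.eventually (Filter.EventuallyEq.eventuallyEq_nhds ht)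
    filter_upwards [hF.2 t, hG.2 t, h1] with t' e1 e2 e3
    exact (e1.trans e3).trans e2.symm
  have hcl : IsClosed {t | F t =ᶠ[𝓝 (γ t)] G t} := by
    rw [← isOpen_compl_iff, isOpen_iff_mem_nhds]
    intro t ht
    obtain ⟨r, hr, hb⟩ := Metric.eventually_nhds_iff_ball.mp
      ((hF.1 t).eventually_analyticAt.and (hG.1 t).eventually_analyticAt)
    filter_upwards [hF.2 t, hG.2 t, γ.continuous.continuousAt.eventually_mem
      (Metric.ball_mem_nhds (γ t) hr)] with t' e1 e2 hm hEq
    have e3 : F t =ᶠ[𝓝 (γ t')] G t := (e1.symm.trans hEq).trans e2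
    have := AnalyticOnNhd.eqOn_of_preconnected_of_eventuallyEq (fun z hz => (hb z hz).1)
      (fun z hz => (hb z hz).2) (convex_ball (γ t) r).isPreconnected hm e3
    exact ht (this.eventuallyEq_of_mem (Metric.ball_mem_nhds _ hr))
  have := IsClopen.eq_univ ⟨hcl, hop⟩ ⟨0, by
    change F 0 =ᶠ[𝓝 (γ 0)] G 0
    rwa [γ.source]⟩
  exact fun t => this.symm.subset (Set.mem_univ t)

lemma branch_mul_I {y : ℝ} (hy : 0 < y) :
    branch ⟨y * Complex.I, im_mul_I_pos hy⟩ =ᶠ[𝓝 (hauptS (y * Complex.I))] heunBasis :=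
  (eventuallyEq_branch (τ := ⟨y * Complex.I, im_mul_I_pos hy⟩).mpr (heunBasis_hauptS hy)).symm

/-! The differential equation for all branches. -/

/-- The chain rule read backwards: d/ds is (1/s′) d/dτ, legitimate because s′ never vanishes. -/
lemma deriv_of_comp_hauptS {A φ : ℂ → ℂ} {τ : ℂ} (hτ : 0 < τ.im) (hA : AnalyticAt ℂ A (hauptS τ))
    (h : ∀ᶠ t in 𝓝 τ, A (hauptS t) = φ t) :
    ∀ᶠ t in 𝓝 τ, deriv A (hauptS t) = deriv φ t / deriv hauptS t := by
  have hA' : ∀ᶠ t in 𝓝 τ, AnalyticAt ℂ A (hauptS t) :=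
    (eventually_nhds_hauptS hτ).mp hA.eventually_analyticAt
  filter_upwards [hA', h.eventually_nhds, isOpen_upperHalfPlaneSet.mem_nhds hτ] with t h1 h2 h3
  have e : deriv φ t = deriv A (hauptS t) * deriv hauptS t :=
    ((h1.differentiableAt.hasDerivAt.comp t
      (differentiableAt_hauptS h3).hasDerivAt).congr_of_eventuallyEq
        (h2.mono fun x hx => hx.symm)).deriv
  rw [e, mul_div_cancel_right₀ _ (deriv_hauptS_ne_zero h3)]

/-- The Heun operator in the coordinate `τ`. -/
def heunOp (φ : ℂ → ℂ) (t : ℂ) : ℂ :=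
  deriv (fun t => deriv φ t / deriv hauptS t) t / deriv hauptS t - heunCoeff (hauptS t) * φ t

lemma heunOp_eq {A φ : ℂ → ℂ} {τ : ℂ} (hτ : 0 < τ.im) (hA : AnalyticAt ℂ A (hauptS τ))
    (h : ∀ᶠ t in 𝓝 τ, A (hauptS t) = φ t) : ∀ᶠ t in 𝓝 τ,
      heunOp φ t = deriv (deriv A) (hauptS t) - heunCoeff (hauptS t) * A (hauptS t) := by
  have h1 := deriv_of_comp_hauptS hτ hA h
  filter_upwards [h, deriv_of_comp_hauptS hτ hA.deriv h1] with t e1 e2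
  rw [heunOp, e1, e2]

/-- The pulled-back operator is defined on all of the half plane, since s′ ≠ 0 and s avoids 0, 1, 9.
Near τ = i the pair is `heunBasis` at s(τ), a solution by direct computation; the identity theorem
does the rest. -/
lemma heunOp_pairPhi {τ : ℂ} (hτ : 0 < τ.im) (i : Fin 2) : heunOp (fun t => pairPhi t i) τ = 0 := by
  have ha : ∀ t : ℂ, 0 < t.im → AnalyticAt ℂ (heunOp fun t => pairPhi t i) t := by
    intro t ht
    have h1 := analyticAt_hauptS ht
    have h0 := deriv_hauptS_ne_zero ht
    have h2 : AnalyticAt ℂ (fun t => pairPhi t i) t := analyticAt_pi_iff.mp (analyticAt_pairPhi ht) i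
    have h3 : AnalyticAt ℂ heunCoeff (hauptS t) := by
      have n0 := hauptS_ne_zero ht
      have n1 := sub_ne_zero.mpr (hauptS_ne_one ht)
      have n9 := sub_ne_zero.mpr (hauptS_ne_nine ht)
      unfold heunCoeff
      fun_prop (disch := first | assumption | positivity)
    exact (((h2.deriv.div h1.deriv h0).deriv).div h1.deriv h0).sub ((h3.fun_comp h1).mul h2)
  have hone : (0 : ℝ) < 1 := one_pos
  have hI := im_mul_I_pos hone
  have hs := isHeunSolutionAt_heunBasis (isBasePoint_hauptS_mul_I hone) i
  have hev : heunOp (fun t => pairPhi t i) =ᶠ[𝓝 (((1 : ℝ) : ℂ) * Complex.I)] fun _ => 0 := by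
    filter_upwards [heunOp_eq (A := fun s => heunBasis s i) hI hs.1
      ((heunBasis_hauptS hone).mono fun t ht => congrFun ht i),
      (eventually_nhds_hauptS hI).mp hs.2] with t e1 e2
    have e1' : heunOp (fun t => pairPhi t i) t = _ := e1
    rw [e1', e2, sub_self]
  exact AnalyticOnNhd.eqOn_of_preconnected_of_eventuallyEq (U := {z : ℂ | 0 < z.im})
    (fun t ht => ha t ht) (fun t _ => analyticAt_const) isPreconnected_im_pos hI hev hτ

theorem isHeunSolutionAt_branch (τ : ℍ) (i : Fin 2) :
    IsHeunSolutionAt (fun s => branch τ s i) (hauptS τ) := by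
  have ha : AnalyticAt ℂ (fun s => branch τ s i) (hauptS τ) :=
    analyticAt_pi_iff.mp (analyticAt_branch τ) i
  refine ⟨ha, (eventually_nhds_hauptS τ.im_pos).mpr ?_⟩
  filter_upwards [heunOp_eq τ.im_pos ha ((branch_hauptS τ).mono fun t ht => congrFun ht i),
    isOpen_upperHalfPlaneSet.mem_nhds τ.im_pos] with t e1 e2
  rw [heunOp_pairPhi e2] at e1
  exact (sub_eq_zero.mp e1.symm)

/-! The base points. -/

/-- On the imaginary axis s is real and tends to 1 and 9 at the two ends, so the intermediate value
theorem applies. -/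
lemma exists_hauptS_eq {w : ℝ} (h1 : 1 < w) (h9 : w < 9) :
    ∃ y : ℝ, 0 < y ∧ hauptS (y * Complex.I) = w := by
  let f : ℝ → ℝ := fun y => (hauptS (y * Complex.I)).re
  have hre : ∀ y : ℝ, 0 < y → hauptS (y * Complex.I) = f y := by
    intro y hy
    obtain ⟨z, -, -, hz⟩ := multZ_mul_I hy
    have hs : hauptS (y * Complex.I) = (z ^ 2 : ℝ) := by rw [← multZ_sq, hz]; push_cast; rfl
    simp only [f]
    rw [hs, Complex.ofReal_re]
  have hc : ContinuousOn f (Set.Ioi 0) := fun y hy =>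
    (Complex.continuous_re.continuousAt.comp ((differentiableAt_hauptS (im_mul_I_pos
      hy)).continuousAt.comp (f := fun y : ℝ => (y : ℂ) * Complex.I)
        (by fun_prop))).continuousWithinAt
  have t9 : Tendsto (fun u : ℍ => hauptS u) atImInfty (𝓝 9) := by
    have := tendsto_multZ.pow 2
    norm_num [multZ_sq] at this
    exact this
  have t1 : Tendsto (fun u : ℍ => hauptS (-1 / u)) atImInfty (𝓝 1) := by
    have := tendsto_hauptS_cusp 1
    have h : Tendsto (fun u : ℍ => hauptS ↑(cuspMat 1 • u)) atImInfty (𝓝 1) :=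
      (OnePoint.isOpenEmbedding_coe.tendsto_nhds_iff).mpr this
    exact h.congr fun u => by rw [coe_cuspMat_one_smul]
  have e9 := (Complex.continuous_re.tendsto _).comp
    (tendsto_mul_I_atImInfty (f := hauptS) t9 one_pos)
  have e1 := (Complex.continuous_re.tendsto _).comp
    (tendsto_mul_I_atImInfty (f := fun t => hauptS (-1 / t)) t1 one_pos)
  obtain ⟨n, hn⟩ := (e9.eventually_const_lt (by simpa using h9 : w < (9 : ℂ).re)).exists
  obtain ⟨m, hm⟩ := (e1.eventually_lt_const (by simpa using h1 : (1 : ℂ).re < w)).exists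
  simp only [Function.comp_apply, neg_inv_mul_I] at hm hn
  obtain ⟨y, hy, e⟩ := isPreconnected_Ioi.intermediate_value (s := Set.Ioi (0 : ℝ))
    (a := 1 / (3 ^ m * 1)) (b := 3 ^ n * 1) (by simp) (by simp) hc ⟨hm.le, hn.le⟩
  exact ⟨y, hy, by rw [hre y hy, e]⟩

section inversion
variable {τ₀ : ℍ} {a : ℂ}

lemma continuesBasis_branch (hb : branch τ₀ =ᶠ[𝓝 a] heunBasis) {b : ℂ}
    {γ : Path a b} {Γ : C(unitInterval, ℍ)} (h0 : Γ 0 = τ₀) (h : ∀ t, hauptS (Γ t) = γ t) :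
    ContinuesBasis γ fun t => branch (Γ t) :=
  ⟨isAnalyticContinuation_branch h, by
    change branch (Γ 0) =ᶠ[𝓝 a] heunBasis
    rw [h0]; exact hb⟩

lemma eq_branch_of_continuesBasis (hb : branch τ₀ =ᶠ[𝓝 a] heunBasis) {b : ℂ}
    {γ : Path a b} {Γ : C(unitInterval, ℍ)} (h0 : Γ 0 = τ₀) (h : ∀ t, hauptS (Γ t) = γ t)
    {F : unitInterval → ℂ → Fin 2 → ℂ} (hF : ContinuesBasis γ F) :
    F 1 =ᶠ[𝓝 b] branch (Γ 1) := by
  have := continuation_unique hF.1 (isAnalyticContinuation_branch h)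
    (hF.2.trans (by rw [h0]; exact hb.symm)) 1
  rwa [γ.target] at this

lemma exists_inverse_value (τ : ℍ) : ∀ᶠ s in 𝓝 (hauptS τ), branch τ s 1 ≠ 0 ∧
    ∃ t : ℍ, (t : ℂ) = branch τ s 0 / branch τ s 1 ∧ hauptS t = s := by
  rw [eventually_nhds_hauptS τ.im_pos]
  filter_upwards [branch_hauptS τ, isOpen_upperHalfPlaneSet.mem_nhds τ.im_pos] with t e ht
  have hD := rootD_ne_zero ht
  rw [e]
  refine ⟨hD, ⟨t, ht⟩, ?_, rfl⟩
  change t = t * rootD t / rootD t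
  field_simp

/-- A path in the upper half plane. -/
def segmentPath (τ₀ τ : ℍ) : C(unitInterval, ℍ) where
  toFun t := ⟨(1 - (t : ℝ) : ℝ) * τ₀ + (t : ℝ) * τ, by
    have h0 := t.2.1
    have h1 := t.2.2
    have p := τ₀.im_pos
    have q := τ.im_pos
    simp only [Complex.add_im, Complex.im_ofReal_mul, coe_im]
    rcases h0.eq_or_lt with h | h
    · rw [← h]; simpa using p
    · have : 0 ≤ (1 - (t : ℝ)) * τ₀.im := mul_nonneg (by linarith) p.le
      positivity⟩
  continuous_toFun := by
    rw [UpperHalfPlane.isEmbedding_coe.continuous_iff]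
    change Continuous fun t : unitInterval => (((1 - (t : ℝ) : ℝ) : ℂ) * τ₀ + ((t : ℝ) : ℂ) * τ)
    fun_prop

lemma segmentPath_zero (τ₀ τ : ℍ) : segmentPath τ₀ τ 0 = τ₀ := by
  ext; simp [segmentPath]
lemma segmentPath_one (τ₀ τ : ℍ) : segmentPath τ₀ τ 1 = τ := by
  ext; simp [segmentPath]

/-- The image of a path in the upper half plane. -/
def imagePath {a b : ℂ} (Γ : C(unitInterval, ℍ)) (h0 : hauptS (Γ 0) = a) (h1 : hauptS (Γ 1) = b) :
    Path a b where
  toFun t := hauptS (Γ t)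
  continuous_toFun := continuous_hauptS.comp Γ.continuous
  source' := h0
  target' := h1

lemma imagePath_apply {a b : ℂ} (Γ : C(unitInterval, ℍ)) (h0 : hauptS (Γ 0) = a)
    (h1 : hauptS (Γ 1) = b) (t : unitInterval) : imagePath Γ h0 h1 t = hauptS (Γ t) := rfl

lemma imagePath_mem {a b : ℂ} (Γ : C(unitInterval, ℍ)) (h0 : hauptS (Γ 0) = a)
    (h1 : hauptS (Γ 1) = b) (t : unitInterval) : imagePath Γ h0 h1 t ∈ heunDomain := by
  rw [imagePath_apply]; exact hauptS_mem_heunDomain (Γ t).im_pos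

end inversion

lemma exists_base_point {w₀ : ℝ} (h1 : 1 < w₀) (h9 : w₀ < 9) :
    ∃ τ₀ : ℍ, hauptS τ₀ = w₀ ∧ branch τ₀ =ᶠ[𝓝 (w₀ : ℂ)] heunBasis := by
  obtain ⟨y, hy, hw⟩ := exists_hauptS_eq h1 h9
  exact ⟨⟨y * Complex.I, im_mul_I_pos hy⟩, hw, hw ▸ branch_mul_I hy⟩

/-- The function `hauptS` inverts the quotient of the solutions. -/
theorem inversion {w₀ : ℝ} (h1 : 1 < w₀) (h9 : w₀ < 9) :
    (∀ i, IsHeunSolutionAt (fun s => heunBasis s i) w₀) ∧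
      (∀ (b : ℂ) (γ : Path (w₀ : ℂ) b), (∀ t, γ t ∈ heunDomain) →
        (∃ F, ContinuesBasis γ F) ∧
        ∀ F, ContinuesBasis γ F →
          (∀ i, IsHeunSolutionAt (fun s => F 1 s i) b) ∧
          ∀ᶠ s in 𝓝 b, F 1 s 1 ≠ 0 ∧ ∃ τ : ℍ, (τ : ℂ) = F 1 s 0 / F 1 s 1 ∧ hauptS τ = s) ∧
      (∀ τ : ℍ, ∃ γ : Path (w₀ : ℂ) (hauptS τ), (∀ t, γ t ∈ heunDomain) ∧
        ∃ F, ContinuesBasis γ F ∧ F 1 (hauptS τ) 0 / F 1 (hauptS τ) 1 = τ) := by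
  obtain ⟨τ₀, hw, hb⟩ := exists_base_point h1 h9
  refine ⟨isHeunSolutionAt_heunBasis (isBasePoint_ofReal h1 h9), fun b γ hγ => ?_, fun τ => ?_⟩
  · obtain ⟨Γ, h0, h⟩ := exists_lift γ hγ (τ := τ₀) hw
    have hend : hauptS (Γ 1) = b := by rw [h, γ.target]
    refine ⟨⟨fun t => branch (Γ t), continuesBasis_branch hb h0 h⟩, fun F hF => ?_⟩
    have e := eq_branch_of_continuesBasis hb h0 h hF
    constructor
    · intro i
      have := isHeunSolutionAt_branch (Γ 1) i
      rw [hend] at this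
      exact this.congr (e.mono fun s hs => by simp only [hs])
    · have := exists_inverse_value (Γ 1)
      rw [hend] at this
      filter_upwards [e, this] with s h1 h2
      rwa [h1]
  · have e0 : hauptS (segmentPath τ₀ τ 0) = w₀ := by rw [segmentPath_zero, hw]
    have e1 : hauptS (segmentPath τ₀ τ 1) = hauptS τ := by rw [segmentPath_one]
    refine ⟨imagePath (segmentPath τ₀ τ) e0 e1, imagePath_mem _ e0 e1,
      fun t => branch (segmentPath τ₀ τ t), continuesBasis_branch hb (segmentPath_zero τ₀ τ)
        fun t => (imagePath_apply _ e0 e1 t).symm, ?_⟩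
    have hD := rootD_ne_zero τ.im_pos
    have hp : branch τ (hauptS τ) = pairPhi τ := (branch_hauptS τ).self_of_nhds
    simp only [segmentPath_one, hp]
    change (τ : ℂ) * rootD τ / rootD τ = τ
    field_simp

end

noncomputable section

/-! ### Automorphy of the solutions and monodromy -/

/-- The embedding of the integral matrices. -/
def toReal : SL(2, ℤ) →* SL(2, ℝ) := Matrix.SpecialLinearGroup.map (Int.castRingHom ℝ)

lemma toReal_apply (g : SL(2, ℤ)) (i j : Fin 2) : toReal g i j = (g i j : ℝ) := rfl

lemma toReal_smul (g : SL(2, ℤ)) (τ : ℍ) : toReal g • τ = g • τ := rfl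

lemma toReal_intT0 : toReal intT0 = T0 := by
  ext i j; rw [toReal_apply]; fin_cases i <;> fin_cases j <;> simp [intT0, T0]
lemma toReal_intTinf : toReal intTinf = Tinf := by
  ext i j; rw [toReal_apply]; fin_cases i <;> fin_cases j <;> simp [intTinf, Tinf]
lemma toReal_intT9 : toReal intT9 = T9 := by
  ext i j; rw [toReal_apply]; fin_cases i <;> fin_cases j <;> simp [intT9, T9]

lemma heunGroup_eq_map : heunGroup = intHeunGroup.map toReal := by
  rw [intHeunGroup, MonoidHom.map_closure, heunGroup, Set.image_insert_eq, Set.image_pair,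
    toReal_intT0, toReal_intTinf, toReal_intT9]

lemma mem_heunGroup_iff {M : SL(2, ℝ)} : M ∈ heunGroup ↔ ∃ g ∈ intHeunGroup, toReal g = M := by
  rw [heunGroup_eq_map, Subgroup.mem_map]

lemma coe_intSL_smul (g : SL(2, ℤ)) (τ : ℍ) :
    ((g • τ : ℍ) : ℂ) = ((g 0 0 : ℂ) * τ + g 0 1) / ((g 1 0 : ℂ) * τ + g 1 1) := by
  rw [coe_specialLinearGroup_apply]; simp

lemma intSL_denom_ne_zero (g : SL(2, ℤ)) {z : ℂ} (hz : 0 < z.im) :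
    (g 1 0 : ℂ) * z + g 1 1 ≠ 0 := by
  intro h
  have him := congrArg Complex.im h
  have hre := congrArg Complex.re h
  simp at him hre
  have h0 : g 1 0 = 0 := him.resolve_right hz.ne'
  have h1 : g 1 1 = 0 := by
    have : (g 1 1 : ℝ) = 0 := by simpa [h0] using hre
    exact_mod_cast this
  have hd := g.det_coe
  rw [Matrix.det_fin_two, h0, h1] at hd
  simp at hd

lemma intSL_det (g : SL(2, ℤ)) : (g 0 0 : ℂ) * g 1 1 - (g 0 1 : ℂ) * g 1 0 = 1 := by
  have hd := g.det_coe
  rw [Matrix.det_fin_two] at hd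
  exact_mod_cast hd

/-- The linear fractional transformation with an integral matrix. -/
def mob (g : SL(2, ℤ)) (z : ℂ) : ℂ := ((g 0 0 : ℂ) * z + g 0 1) / ((g 1 0 : ℂ) * z + g 1 1)

lemma mob_coe (g : SL(2, ℤ)) (τ : ℍ) : mob g τ = ((g • τ : ℍ) : ℂ) := (coe_intSL_smul g τ).symm

lemma im_mob_pos (g : SL(2, ℤ)) {z : ℂ} (hz : 0 < z.im) : 0 < (mob g z).im := by
  have := mob_coe g ⟨z, hz⟩
  change mob g z = _ at this
  rw [this]; exact (g • (⟨z, hz⟩ : ℍ)).im_pos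

lemma hasDerivAt_mob (g : SL(2, ℤ)) {z : ℂ} (hz : 0 < z.im) :
    HasDerivAt (mob g) (1 / ((g 1 0 : ℂ) * z + g 1 1) ^ 2) z := by
  have h0 := intSL_denom_ne_zero g hz
  have h1 : HasDerivAt (fun z : ℂ => (g 0 0 : ℂ) * z + g 0 1) (g 0 0) z := by
    simpa using ((hasDerivAt_id z).const_mul (g 0 0 : ℂ)).add_const (g 0 1 : ℂ)
  have h2 : HasDerivAt (fun z : ℂ => (g 1 0 : ℂ) * z + g 1 1) (g 1 0) z := by
    simpa using ((hasDerivAt_id z).const_mul (g 1 0 : ℂ)).add_const (g 1 1 : ℂ)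
  refine (h1.div h2 h0).congr_deriv ?_
  congr 1
  linear_combination intSL_det g

lemma hauptS_mob {g : SL(2, ℤ)} (hg : g ∈ intHeunGroup) {z : ℂ} (hz : 0 < z.im) :
    hauptS (mob g z) = hauptS z := by
  have := hauptS_smul hg ⟨z, hz⟩
  rwa [← mob_coe] at this

lemma deriv_hauptS_comp_mob (g : SL(2, ℤ)) {z : ℂ} (hz : 0 < z.im) :
    deriv (fun t => hauptS (mob g t)) z =
      deriv hauptS (mob g z) / ((g 1 0 : ℂ) * z + g 1 1) ^ 2 := by
  have h : HasDerivAt (fun t => hauptS (mob g t)) _ z :=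
    (differentiableAt_hauptS (im_mob_pos g hz)).hasDerivAt.comp z (hasDerivAt_mob g hz)
  rw [h.deriv, mul_one_div]

/-- Differentiating s(gz) = s(z) shows that s′ has weight 2, so its square root has weight 1 up to a
sign. -/
lemma rootD_mob_sq {g : SL(2, ℤ)} (hg : g ∈ intHeunGroup) {z : ℂ} (hz : 0 < z.im) :
    rootD (mob g z) ^ 2 = (((g 1 0 : ℂ) * z + g 1 1) * rootD z) ^ 2 := by
  have h0 := intSL_denom_ne_zero g hz
  have e : deriv (fun t => hauptS (mob g t)) z = deriv hauptS z := by
    refine Filter.EventuallyEq.deriv_eq ?_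
    filter_upwards [isOpen_upperHalfPlaneSet.mem_nhds hz] with t ht
    exact hauptS_mob hg ht
  rw [deriv_hauptS_comp_mob g hz, div_eq_iff (pow_ne_zero 2 h0)] at e
  rw [mul_pow, rootD_sq, rootD_sq, e]
  ring

/-- The multiplier system of `rootD`. -/
lemma exists_multiplier {g : SL(2, ℤ)} (hg : g ∈ intHeunGroup) :
    (∀ z : ℂ, 0 < z.im → rootD (mob g z) = ((g 1 0 : ℂ) * z + g 1 1) * rootD z) ∨
      ∀ z : ℂ, 0 < z.im → rootD (mob g z) = -(((g 1 0 : ℂ) * z + g 1 1) * rootD z) := by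
  have := isPreconnected_im_pos.eq_or_eq_neg_of_sq_eq (f := fun z => rootD (mob g z))
    (g := fun z => ((g 1 0 : ℂ) * z + g 1 1) * rootD z)
    (fun z hz => ((differentiableAt_rootD (im_mob_pos g hz)).continuousAt.comp
      (hasDerivAt_mob g hz).continuousAt).continuousWithinAt)
    (fun z hz => ((by fun_prop : ContinuousAt (fun z : ℂ => (g 1 0 : ℂ) * z + g 1 1) z).mul
      (differentiableAt_rootD hz).continuousAt).continuousWithinAt)
    (fun z hz => rootD_mob_sq hg hz)
    (fun {z} hz => mul_ne_zero (intSL_denom_ne_zero g hz) (rootD_ne_zero hz))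
  exact this.imp (fun h z hz => h hz) fun h z hz => h hz

lemma pairPhi_mob {g : SL(2, ℤ)} {z ε : ℂ} (hz : 0 < z.im)
    (h : rootD (mob g z) = ε * (((g 1 0 : ℂ) * z + g 1 1) * rootD z)) (i : Fin 2) :
    pairPhi (mob g z) i = ε * ((g i 0 : ℂ) * pairPhi z 0 + (g i 1 : ℂ) * pairPhi z 1) := by
  have h0 := intSL_denom_ne_zero g hz
  fin_cases i
  · simp only [pairPhi, Fin.zero_eta, Matrix.cons_val_zero, Matrix.cons_val_one, h]
    rw [mob]
    generalize (g 1 0 : ℂ) * z + g 1 1 = d at h0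
    field_simp
  · simp only [pairPhi, Fin.mk_one, Matrix.cons_val_zero, Matrix.cons_val_one, h]
    ring

/-- `M` describes the behaviour of the pair of solutions under `g`. -/
def IsTransformedBy (g : SL(2, ℤ)) (M : SL(2, ℝ)) : Prop := ∀ z : ℂ, 0 < z.im →
  pairPhi (mob g z) = ((M : Matrix (Fin 2) (Fin 2) ℝ).map Complex.ofReal).mulVec (pairPhi z)

lemma isTransformedBy_toReal {g : SL(2, ℤ)}
    (h : ∀ z : ℂ, 0 < z.im → rootD (mob g z) = ((g 1 0 : ℂ) * z + g 1 1) * rootD z) :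
    IsTransformedBy g (toReal g) := by
  intro z hz
  ext i
  rw [pairPhi_mob (ε := 1) hz (by rw [h z hz, one_mul])]
  simp [Matrix.mulVec, dotProduct, Fin.sum_univ_two, toReal_apply]

lemma isTransformedBy_neg_toReal {g : SL(2, ℤ)}
    (h : ∀ z : ℂ, 0 < z.im → rootD (mob g z) = -(((g 1 0 : ℂ) * z + g 1 1) * rootD z)) :
    IsTransformedBy g (-toReal g) := by
  intro z hz
  ext i
  rw [pairPhi_mob (ε := -1) hz (by rw [h z hz]; ring)]
  simp [Matrix.mulVec, dotProduct, Fin.sum_univ_two, toReal_apply]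

lemma isTransformedBy_or {g : SL(2, ℤ)} (hg : g ∈ intHeunGroup) :
    IsTransformedBy g (toReal g) ∨ IsTransformedBy g (-toReal g) :=
  (exists_multiplier hg).imp isTransformedBy_toReal isTransformedBy_neg_toReal

/-- Continuation replaces the branch at τ₀ by the branch at gτ₀. Pulled back near τ₀ and using s(gτ)
= s(τ), the latter is the pair evaluated at gτ. -/
lemma hasMonodromy_of_lift {τ₀ : ℍ} {a : ℂ} (ha : hauptS τ₀ = a)
    (hb : branch τ₀ =ᶠ[𝓝 a] heunBasis) {γ : Path a a} {Γ : C(unitInterval, ℍ)} (h0 : Γ 0 = τ₀)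
    {g : SL(2, ℤ)} (hg : g ∈ intHeunGroup) (h1 : Γ 1 = g • τ₀) (h : ∀ t, hauptS (Γ t) = γ t)
    {M : SL(2, ℝ)} (hM : IsTransformedBy g M) : HasMonodromy γ M := by
  refine ⟨fun t => branch (Γ t), continuesBasis_branch hb h0 h, ?_⟩
  have hc : ContinuousAt (mob g) τ₀ := (hasDerivAt_mob g τ₀.im_pos).continuousAt
  have hbr : ∀ᶠ t in 𝓝 (mob g τ₀), branch (g • τ₀) (hauptS t) = pairPhi t := by
    rw [mob_coe]; exact branch_hauptS (g • τ₀)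
  have hb' : ∀ᶠ t in 𝓝 (τ₀ : ℂ), branch τ₀ (hauptS t) = heunBasis (hauptS t) := by
    rw [← eventually_nhds_hauptS τ₀.im_pos (p := fun s => branch τ₀ s = heunBasis s), ha]; exact hb
  simp only [h1]
  rw [Filter.EventuallyEq, ← ha, eventually_nhds_hauptS τ₀.im_pos]
  filter_upwards [hc.eventually hbr, hb', branch_hauptS τ₀,
    isOpen_upperHalfPlaneSet.mem_nhds τ₀.im_pos] with t e1 e2 e3 ht
  rw [hauptS_mob hg ht] at e1
  rw [e1, hM t ht, ← e2, e3]

/-- The lift of a loop ends in the fibre of its starting point, which is an orbit of G_s. -/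
theorem monodromy_mem {w₀ : ℝ} (h1 : 1 < w₀) (h9 : w₀ < 9) (γ : Path (w₀ : ℂ) w₀)
    (hγ : ∀ t, γ t ∈ heunDomain) : ∃ g ∈ heunGroup, HasMonodromy γ g ∨ HasMonodromy γ (-g) := by
  obtain ⟨τ₀, hw, hb⟩ := exists_base_point h1 h9
  obtain ⟨Γ, h0, h⟩ := exists_lift γ hγ (τ := τ₀) hw
  obtain ⟨g, hg, hend⟩ := exists_smul_eq (τ₁ := τ₀) (τ₂ := Γ 1) (by rw [h, γ.target, hw])
  exact ⟨toReal g, mem_heunGroup_iff.mpr ⟨g, hg, rfl⟩,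
    (isTransformedBy_or hg).imp (hasMonodromy_of_lift hw hb h0 hg hend h)
      (hasMonodromy_of_lift hw hb h0 hg hend h)⟩

/-- The half plane is convex, so a segment from τ₀ to gτ₀ exists; its image under s is the required
loop. -/
theorem exists_monodromy {w₀ : ℝ} (h1 : 1 < w₀) (h9 : w₀ < 9) {M : SL(2, ℝ)}
    (hM : M ∈ heunGroup) : ∃ γ : Path (w₀ : ℂ) w₀, (∀ t, γ t ∈ heunDomain) ∧
      (HasMonodromy γ M ∨ HasMonodromy γ (-M)) := by
  obtain ⟨τ₀, hw, hb⟩ := exists_base_point h1 h9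
  obtain ⟨g, hg, rfl⟩ := mem_heunGroup_iff.mp hM
  have e0 : hauptS (segmentPath τ₀ (g • τ₀) 0) = w₀ := by rw [segmentPath_zero, hw]
  have e1 : hauptS (segmentPath τ₀ (g • τ₀) 1) = w₀ := by rw [segmentPath_one, hauptS_smul hg, hw]
  have h := fun t => (imagePath_apply _ e0 e1 t).symm
  exact ⟨imagePath _ e0 e1, imagePath_mem _ e0 e1, (isTransformedBy_or hg).imp
    (hasMonodromy_of_lift hw hb (segmentPath_zero _ _) hg (segmentPath_one _ _) h)
    (hasMonodromy_of_lift hw hb (segmentPath_zero _ _) hg (segmentPath_one _ _) h)⟩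

/-! ### The automorphism group -/

/-- Fixing iy gives a = d and b = −cy². Two different values of y force b = c = 0, and the
determinant leaves ±1. -/
lemma eq_one_or_neg_one_of_fixing {k : SL(2, ℝ)} (hk : ∀ᶠ τ in 𝓝 I, k • τ = τ) :
    k = 1 ∨ k = -1 := by
  have hmk : ContinuousAt (fun y : ℝ => ofComplex ((y : ℂ) * Complex.I)) 1 :=
    ContinuousAt.comp (f := fun y : ℝ => (y : ℂ) * Complex.I) (g := fun z => ofComplex z)
      (continuousAt_ofComplex (by simp)) (by fun_prop)
  have hI : ofComplex (((1 : ℝ) : ℂ) * Complex.I) = I := by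
    rw [Complex.ofReal_one, one_mul]; exact ofComplex_apply I
  have hmk' : Tendsto (fun y : ℝ => ofComplex ((y : ℂ) * Complex.I)) (𝓝 1) (𝓝 I) := by
    rw [← hI]
    exact hmk
  have hev : ∀ᶠ y : ℝ in 𝓝 1, k • ofComplex ((y : ℂ) * Complex.I) = ofComplex (y * Complex.I) :=
    hmk'.eventually hk
  have heq : ∀ y : ℝ, 0 < y → k • ofComplex ((y : ℂ) * Complex.I) = ofComplex (y * Complex.I) →
      k 0 0 = k 1 1 ∧ k 0 1 = -k 1 0 * y ^ 2 := by
    intro y hy h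
    have h' := congrArg UpperHalfPlane.coe h
    have hc : (ofComplex ((y : ℂ) * Complex.I) : ℂ) = y * Complex.I :=
      ofComplex_apply_of_im_pos (im_mul_I_pos hy) ▸ rfl
    have hd : (k 1 0 : ℂ) * (y * Complex.I) + k 1 1 ≠ 0 := by
      have := denom_ne_zero (k : GL (Fin 2) ℝ) (ofComplex ((y : ℂ) * Complex.I))
      rw [denom, hc] at this
      exact this
    rw [coe_specialLinearGroup_apply, hc] at h'
    change ((k 0 0 : ℂ) * (y * Complex.I) + k 0 1) / ((k 1 0 : ℂ) * (y * Complex.I) + k 1 1) = _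
      at h'
    rw [div_eq_iff hd] at h'
    have hre := congrArg Complex.re h'
    have him := congrArg Complex.im h'
    simp at hre him
    refine ⟨mul_right_cancel₀ hy.ne' (by linarith), by linarith⟩
  have e1 := heq 1 one_pos hev.self_of_nhds
  obtain ⟨y, hy, hy1⟩ := ((hev.filter_mono nhdsWithin_le_nhds).and
    (self_mem_nhdsWithin : Set.Ioi (1 : ℝ) ∈ 𝓝[>] 1)).exists
  have hy1 : 1 < y := hy1
  have e2 := heq y (by linarith) hy
  have hc : k 1 0 = 0 := by
    have h : k 1 0 * (y ^ 2 - 1) = 0 := by linarith [e1.2, e2.2]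
    exact (mul_eq_zero.mp h).resolve_right (by nlinarith)
  have hb : k 0 1 = 0 := by rw [e1.2, hc]; simp
  have hdet := k.det_coe
  rw [Matrix.det_fin_two, hb, hc, ← e1.1] at hdet
  have ha : (k 0 0 - 1) * (k 0 0 + 1) = 0 := by linarith
  rcases mul_eq_zero.mp ha with h | h
  · left
    ext i j
    fin_cases i <;> fin_cases j <;> simp <;> linarith [e1.1]
  · right
    ext i j
    fin_cases i <;> fin_cases j <;> simp <;> linarith [e1.1]

lemma hauptS_smul_of_mem {M : SL(2, ℝ)} (hM : M ∈ heunGroup) (τ : ℍ) :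
    hauptS ↑(M • τ) = hauptS τ := by
  obtain ⟨g, hg, rfl⟩ := mem_heunGroup_iff.mp hM
  exact hauptS_smul hg τ

/-- Because g preserves the fibre of i, an element of G_s agrees with it at i. The quotient of the
two fixes i and preserves the locally injective s, so it is the identity near i. -/
theorem automorphism_iff (g : SL(2, ℝ)) :
    (∀ τ : ℍ, hauptS ↑(g • τ) = hauptS τ) ↔ g ∈ heunGroup ∨ -g ∈ heunGroup := by
  constructor
  · intro h
    obtain ⟨h', hh, e⟩ := exists_smul_eq (h I).symm
    have hm : toReal h' ∈ heunGroup := mem_heunGroup_iff.mpr ⟨h', hh, rfl⟩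
    set k : SL(2, ℝ) := (toReal h')⁻¹ * g with hk
    have hkI : k • I = I := by
      rw [hk, mul_smul, e, ← toReal_smul, inv_smul_smul]
    have hkS : ∀ τ : ℍ, hauptS ↑(k • τ) = hauptS τ := fun τ => by
      rw [hk, mul_smul, hauptS_smul_of_mem (inv_mem hm), h]
    obtain ⟨ι, -, hι⟩ := exists_local_inverse I.im_pos
    have hι' : ∀ᶠ τ : ℍ in 𝓝 I, ι (hauptS τ) = τ :=
      UpperHalfPlane.continuous_coe.continuousAt.eventually hι
    have hcont : Tendsto (fun τ : ℍ => k • τ) (𝓝 I) (𝓝 I) := by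
      have := (continuous_const_smul k).tendsto I
      rwa [hkI] at this
    have hfix : ∀ᶠ τ in 𝓝 I, k • τ = τ := by
      filter_upwards [hι', hcont.eventually hι'] with τ e1 e2
      apply UpperHalfPlane.ext
      rw [← e2, hkS, e1]
    have hg : g = toReal h' * k := by rw [hk]; group
    rcases eq_one_or_neg_one_of_fixing hfix with hk1 | hk1
    · left; rwa [hg, hk1, mul_one]
    · right; rwa [hg, hk1, mul_neg, mul_one, neg_neg]
  · rintro (h | h) τ
    · exact hauptS_smul_of_mem h τ
    · have := hauptS_smul_of_mem h τ
      have e : -g • τ = g • τ := by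
        ext
        rw [coe_specialLinearGroup_apply, coe_specialLinearGroup_apply, ← neg_div_neg_eq]
        simp
        ring_nf
      rwa [e] at this

end

noncomputable section

/-! ### The multipliers at the cusps -/

lemma convex_lt_im (Y : ℝ) : Convex ℝ {z : ℂ | Y < z.im} := convex_halfSpace_im_gt Y

lemma norm_cexp_mul_I_mul (κ : ℝ) (u : ℂ) :
    ‖Complex.exp (κ * Complex.I * u)‖ = Real.exp (-(κ * u.im)) := by
  rw [Complex.norm_exp]
  simp

/-- A square root of a function with a simple zero or a simple pole at a cusp is not periodic. -/
lemma not_periodic_of_sq {D W : ℂ → ℂ} {κ : ℝ} {m : ℤ} (hκ : 0 < κ) (hm : Odd m)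
    (hD : ∀ u : ℂ, 0 < u.im → ContinuousAt D u) (hW : AnalyticAt ℂ W 0) (hW0 : W 0 ≠ 0)
    (hsq : ∀ᶠ Q in 𝓝[≠] (0 : ℂ), ∀ u : ℂ, 0 < u.im → Complex.exp (κ * Complex.I * u) = Q →
      D u ^ 2 = Q ^ m * W Q) : ¬ ∀ u : ℂ, 0 < u.im → D (u + (2 * Real.pi / κ : ℝ)) = D u := by
  intro hper
  have hV : ContinuousAt (fun Q => W Q / W 0) 0 := hW.continuousAt.div_const _
  have hslit : ∀ᶠ Q in 𝓝 (0 : ℂ), W Q / W 0 ∈ Complex.slitPlane :=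
    hV.eventually_mem (Complex.isOpen_slitPlane.mem_nhds (by
      simp [div_self hW0]))
  rw [eventually_nhdsWithin_iff] at hsq
  obtain ⟨ρ, hρ, hball⟩ := Metric.eventually_nhds_iff_ball.mp
    (hslit.and (hsq.and hW.eventually_continuousAt))
  obtain ⟨Y, hY0, hY⟩ : ∃ Y : ℝ, 0 < Y ∧ ∀ u : ℂ, Y < u.im →
      Complex.exp (κ * Complex.I * u) ∈ Metric.ball (0 : ℂ) ρ := by
    have ht : Tendsto (fun y : ℝ => Real.exp (-(κ * y))) atTop (𝓝 0) :=
      Real.tendsto_exp_neg_atTop_nhds_zero.comp (tendsto_id.const_mul_atTop hκ)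
    obtain ⟨Y, hY⟩ := eventually_atTop.mp (ht.eventually_lt_const hρ)
    refine ⟨max Y 1, by positivity, fun u hu => ?_⟩
    rw [mem_ball_zero_iff, norm_cexp_mul_I_mul]
    exact hY _ ((le_max_left _ _).trans hu.le)
  set q : ℂ → ℂ := fun u => Complex.exp (κ * Complex.I * u) with hq
  have hq0 : ∀ u, q u ≠ 0 := fun u => Complex.exp_ne_zero _
  have hqc : Continuous q := by fun_prop
  -- E is D divided by the half power Q^{m/2}, and G is a root of W(Q) depending on Q alone. They
  -- agree up to one global sign on a high half plane.
  let E : ℂ → ℂ := fun u => D u * Complex.exp (-(m * (κ * Complex.I * u) / 2))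
  let G : ℂ → ℂ := fun u => W 0 ^ (1 / 2 : ℂ) * (W (q u) / W 0) ^ (1 / 2 : ℂ)
  have half_sq : ∀ x : ℂ, (x ^ (1 / 2 : ℂ)) ^ 2 = x := fun x => by
    simp
  have hG2 : ∀ u, G u ^ 2 = W (q u) := fun u => by
    simp only [G]
    rw [mul_pow, half_sq, half_sq, mul_div_cancel₀ _ hW0]
  have hE2 : ∀ u : ℂ, Y < u.im → E u ^ 2 = W (q u) := fun u hu => by
    simp only [E]
    have e : Complex.exp (-(m * (κ * Complex.I * u) / 2)) ^ 2 = (q u ^ m)⁻¹ := by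
      rw [← Complex.exp_nat_mul, hq, ← Complex.exp_int_mul, ← Complex.exp_neg]
      congr 1; push_cast; ring
    have hDq : D u ^ 2 = q u ^ m * W (q u) :=
      (hball _ (hY u hu)).2.1 (hq0 u) u (hY0.trans hu) rfl
    rw [mul_pow, e, hDq]
    have := zpow_ne_zero m (hq0 u)
    field_simp
  have hGne : ∀ u : ℂ, Y < u.im → G u ≠ 0 := fun u hu h => by
    have h1 := hG2 u
    rw [h] at h1
    have := Complex.slitPlane_ne_zero (hball _ (hY u hu)).1
    rw [← h1] at this
    simp at this
  have hEG := (convex_lt_im Y).isPreconnected.eq_or_eq_neg_of_sq_eq (f := E) (g := G)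
    (fun u hu => ((hD u (hY0.trans hu)).mul (by fun_prop)).continuousWithinAt)
    (fun u hu => by
      have h := hball _ (hY u hu)
      have h1 : ContinuousAt (fun u => W (q u) / W 0) u :=
        (ContinuousAt.comp (f := q) (g := W) h.2.2 hqc.continuousAt).div_const _
      exact (continuousAt_const.mul (h1.cpow continuousAt_const h.1)).continuousWithinAt)
    (fun u hu => (hE2 u hu).trans (hG2 u).symm) (fun {u} hu => hGne u hu)
  have hκ0 : (κ : ℂ) ≠ 0 := by exact_mod_cast hκ.ne'
  set w : ℂ := ((2 * Real.pi / κ : ℝ) : ℂ) with hw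
  have hw' : (κ : ℂ) * w = 2 * Real.pi := by rw [hw]; push_cast; field_simp
  have hGw : ∀ u, G (u + w) = G u := fun u => by
    have : q (u + w) = q u := by
      simp only [hq]
      rw [show (κ : ℂ) * Complex.I * (u + w) = κ * Complex.I * u + 2 * Real.pi * Complex.I by
        linear_combination Complex.I * hw', Complex.exp_periodic]
    simp only [G, this]
  -- If D were periodic, the half power with m odd would contribute e^{−πim} = −1. Then E is
  -- antiperiodic while G is periodic and nonzero, a contradiction.
  have hEw : ∀ u : ℂ, 0 < u.im → E (u + w) = -E u := fun u hu => by
    simp only [E]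
    obtain ⟨k, rfl⟩ := hm
    rw [hper u hu, show -((((2 * k + 1 : ℤ) : ℂ)) * (κ * Complex.I * (u + w)) / 2) =
      -((((2 * k + 1 : ℤ) : ℂ)) * (κ * Complex.I * u) / 2) - Real.pi * Complex.I +
        ((-k : ℤ) : ℂ) * (2 * Real.pi * Complex.I) by
          push_cast; linear_combination -(2 * k + 1) / 2 * Complex.I * hw',
      Complex.exp_add, Complex.exp_int_mul_two_pi_mul_I, mul_one, Complex.exp_sub,
      Complex.exp_pi_mul_I]
    ring
  have hu : Y < (((Y + 1 : ℝ) : ℂ) * Complex.I).im := by simp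
  have hu' : Y < (((Y + 1 : ℝ) : ℂ) * Complex.I + w).im := by
    rw [hw, Complex.add_im, Complex.ofReal_im, add_zero]; exact hu
  generalize ((Y + 1 : ℝ) : ℂ) * Complex.I = u at hu hu'
  have h1 := hEw u (hY0.trans hu)
  have h0 : E u = 0 := by
    rcases hEG with h | h
    · have e1 : E u = G u := h hu
      have e2 : E (u + w) = G (u + w) := h hu'
      rw [hGw, ← e1, h1] at e2
      exact self_eq_neg.mp e2.symm
    · have e1 : E u = -G u := h hu
      have e2 : E (u + w) = -G (u + w) := h hu'
      rw [hGw, ← e1, h1] at e2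
      exact self_eq_neg.mp e2.symm
  have h2 : G u ^ 2 = 0 := by rw [hG2, ← hE2 u hu, h0]; simp
  exact hGne u hu (pow_eq_zero_iff two_ne_zero |>.mp h2)

lemma cuspGen_mul_cuspMat (c : Fin 4) (i : Fin 2) : (cuspGen c * cuspMat c) i 0 = cuspMat c i 0 ∧
    (cuspGen c * cuspMat c) i 1 = cuspMat c i 1 - cuspWidth c * cuspMat c i 0 := by
  revert c i; decide

lemma denom_mul (g h : SL(2, ℤ)) {z : ℂ} (hz : 0 < z.im) :
    ((g * h) 1 0 : ℂ) * z + (g * h) 1 1 =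
      ((g 1 0 : ℂ) * mob h z + g 1 1) * ((h 1 0 : ℂ) * z + h 1 1) := by
  have h0 := intSL_denom_ne_zero h hz
  rw [mob, add_mul, mul_assoc, div_mul_cancel₀ _ h0]
  simp [Matrix.mul_apply, Fin.sum_univ_two]
  ring

lemma mob_mul (g h : SL(2, ℤ)) {z : ℂ} (hz : 0 < z.im) : mob (g * h) z = mob g (mob h z) := by
  have := congrArg UpperHalfPlane.coe (mul_smul g h (⟨z, hz⟩ : ℍ))
  rw [← mob_coe, ← mob_coe, ← mob_coe] at this
  exact this

lemma mob_cuspGen_mul_cuspMat (c : Fin 4) (z : ℂ) :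
    mob (cuspGen c * cuspMat c) z = mob (cuspMat c) (z - cuspWidth c) := by
  rw [mob, mob, (cuspGen_mul_cuspMat c 0).1, (cuspGen_mul_cuspMat c 0).2,
    (cuspGen_mul_cuspMat c 1).1, (cuspGen_mul_cuspMat c 1).2]
  push_cast
  congr 1 <;> ring

/-- The function D(u) = `rootD`(σu)/(cu+d) satisfies D² = 6πi · d/du s(σu), which has odd order m in
the local parameter; the chain rule raises the order m − 1 of F′ by one. A positive multiplier would
make D periodic, which is impossible. -/
lemma isTransformedBy_cuspGen_of_expansion {c : Fin 4} {F W : ℂ → ℂ} {κ : ℝ} {m : ℤ} (hκ : 0 < κ)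
    (hm : Odd m) (hw : cuspWidth c * κ = 2 * Real.pi)
    (hF : ∀ u : ℂ, 0 < u.im → hauptS (mob (cuspMat c) u) = F (Complex.exp (κ * Complex.I * u)))
    (hW : AnalyticAt ℂ W 0) (hW0 : W 0 ≠ 0)
    (hFW : ∀ᶠ Q in 𝓝[≠] (0 : ℂ), HasDerivAt F (Q ^ (m - 1) * W Q) Q) :
    IsTransformedBy (cuspGen c) (-toReal (cuspGen c)) := by
  refine isTransformedBy_neg_toReal ((exists_multiplier (cuspGen_mem c)).resolve_left fun h => ?_)
  set σ := cuspMat c with hσ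
  set D : ℂ → ℂ := fun u => rootD (mob σ u) / ((σ 1 0 : ℂ) * u + σ 1 1) with hD
  have hw' : ((2 * Real.pi / κ : ℝ) : ℂ) = cuspWidth c := by
    rw [← hw, mul_div_cancel_right₀ _ hκ.ne']; simp
  refine not_periodic_of_sq (D := D) (W := fun Q => 6 * Real.pi * Complex.I * (κ * Complex.I) * W Q)
    hκ hm ?_ (analyticAt_const.mul hW) ?_ ?_ ?_
  · intro u hu
    exact ((differentiableAt_rootD (im_mob_pos σ hu)).continuousAt.comp
      (hasDerivAt_mob σ hu).continuousAt).div (by fun_prop) (intSL_denom_ne_zero σ hu)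
  · have : (κ : ℂ) ≠ 0 := by exact_mod_cast hκ.ne'
    simp [Real.pi_ne_zero, this, hW0]
  · filter_upwards [hFW, self_mem_nhdsWithin] with Q hQ hQ0 u hu e
    have hQ0 : Q ≠ 0 := hQ0
    have hq : HasDerivAt (fun u : ℂ => Complex.exp (κ * Complex.I * u)) (Q * (κ * Complex.I)) u := by
      have := ((hasDerivAt_id u).const_mul ((κ : ℂ) * Complex.I)).cexp
      simpa [e] using this
    have h1 : deriv (fun t => hauptS (mob σ t)) u = Q ^ (m - 1) * W Q * (Q * (κ * Complex.I)) := by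
      refine HasDerivAt.deriv (HasDerivAt.congr_of_eventuallyEq
        (HasDerivAt.comp u (by rw [e]; exact hQ) hq) ?_)
      filter_upwards [isOpen_upperHalfPlaneSet.mem_nhds hu] with t ht
      exact hF t ht
    rw [deriv_hauptS_comp_mob σ hu] at h1
    simp only [hD]
    rw [div_pow, rootD_sq, mul_div_assoc, h1, zpow_sub_one₀ hQ0]
    field_simp
  · intro u hu
    rw [hw']
    have hu' : 0 < (u + cuspWidth c).im := by simpa using hu
    have e1 := mob_cuspGen_mul_cuspMat c (u + cuspWidth c)
    rw [add_sub_cancel_right, mob_mul _ _ hu'] at e1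
    have e2 := denom_mul (cuspGen c) (cuspMat c) hu'
    rw [(cuspGen_mul_cuspMat c 1).1, (cuspGen_mul_cuspMat c 1).2] at e2
    have e3 : (σ 1 0 : ℂ) * u + σ 1 1 = ((cuspGen c 1 0 : ℂ) * mob σ (u + cuspWidth c) +
        cuspGen c 1 1) * ((σ 1 0 : ℂ) * (u + cuspWidth c) + σ 1 1) := by
      rw [← e2]; push_cast; ring
    simp only [hD]
    rw [e3, ← e1, h _ (im_mob_pos _ hu')]
    have d1 := intSL_denom_ne_zero (cuspGen c) (im_mob_pos σ hu')
    rw [mul_div_mul_left _ _ d1]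

end

/-! ### The sign of the multiplier at each of the four cusps -/

noncomputable section

lemma nome_eq (u : ℂ) : nome u = Complex.exp ((Real.pi : ℝ) * Complex.I * u) := rfl

lemma nome_sq_eq (u : ℂ) : nome u ^ 2 = Complex.exp ((2 * Real.pi : ℝ) * Complex.I * u) := by
  rw [nome, ← Complex.exp_nat_mul]; congr 1; push_cast; ring

lemma nome_div_three_eq (u : ℂ) :
    nome (u / 3) = Complex.exp ((Real.pi / 3 : ℝ) * Complex.I * u) := by
  rw [nome]; congr 1; push_cast; ring

lemma nome_div_three_sq_eq (u : ℂ) :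
    nome (u / 3) ^ 2 = Complex.exp ((2 * Real.pi / 3 : ℝ) * Complex.I * u) := by
  rw [nome, ← Complex.exp_nat_mul]; congr 1; push_cast; ring

lemma hauptS_mob_zero {u : ℂ} (hu : 0 < u.im) : hauptS (mob (cuspMat 0) u) =
    9 * expS (Complex.exp ((Real.pi : ℝ) * Complex.I * u)) := by
  have := hauptS_cusp_regular_zero ⟨u, hu⟩
  rw [← mob_coe] at this
  rw [← nome_eq]; exact this

lemma hauptS_mob_one {u : ℂ} (hu : 0 < u.im) : hauptS (mob (cuspMat 1) u) =
    (expS (Complex.exp ((Real.pi / 3 : ℝ) * Complex.I * u)))⁻¹ := by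
  have := hauptS_cusp_regular_one ⟨u, hu⟩
  rw [← mob_coe] at this
  rw [← nome_div_three_eq]; exact this

lemma hauptS_mob_two {u : ℂ} (hu : 0 < u.im) : hauptS (mob (cuspMat 2) u) =
    (expR (Complex.exp ((2 * Real.pi / 3 : ℝ) * Complex.I * u)))⁻¹ := by
  have := hauptS_cusp_regular_two ⟨u, hu⟩
  rw [← mob_coe] at this
  rw [← nome_div_three_sq_eq]; exact this

lemma hauptS_mob_three {u : ℂ} (hu : 0 < u.im) : hauptS (mob (cuspMat 3) u) =
    9 * expR (Complex.exp ((2 * Real.pi : ℝ) * Complex.I * u)) := by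
  have := hauptS_cusp_regular_three ⟨u, hu⟩
  rw [← mob_coe] at this
  rw [← nome_sq_eq]; exact this

lemma deriv_expR_zero : deriv expR 0 = 1 := by
  have h := (hasDerivAt_id (0 : ℂ)).mul (analyticAt_phi2.pow 4).differentiableAt.hasDerivAt
  have h' : HasDerivAt expR _ 0 := h
  rw [h'.deriv]
  simp [phi2_zero]

/-- In the parameter of exact width, s takes its value simply at each cusp: a simple zero of s −
s(c) gives m = 1, the simple pole at the cusp 1 gives m = −1. Both are odd. -/
lemma isTransformedBy_cuspGen (c : Fin 4) : IsTransformedBy (cuspGen c) (-toReal (cuspGen c)) := by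
  have hpi := Real.pi_pos
  have hS : ∀ᶠ Q in 𝓝[≠] (0 : ℂ), HasDerivAt expS (deriv expS Q) Q :=
    (analyticAt_expS_zero.eventually_analyticAt.filter_mono nhdsWithin_le_nhds).mono
      fun Q h => h.differentiableAt.hasDerivAt
  have hR : ∀ᶠ Q in 𝓝[≠] (0 : ℂ), HasDerivAt expR (deriv expR Q) Q :=
    (analyticAt_expR_zero.eventually_analyticAt.filter_mono nhdsWithin_le_nhds).mono
      fun Q h => h.differentiableAt.hasDerivAt
  have hSne : ∀ᶠ Q in 𝓝[≠] (0 : ℂ), expS Q ≠ 0 :=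
    (analyticAt_expS_zero.continuousAt.eventually_ne (by rw [expS_zero]; exact one_ne_zero)).filter_mono
      nhdsWithin_le_nhds
  have hpne : ∀ᶠ Q in 𝓝[≠] (0 : ℂ), phi2 Q ≠ 0 :=
    (analyticAt_phi2.continuousAt.eventually_ne (by rw [phi2_zero]; exact one_ne_zero)).filter_mono
      nhdsWithin_le_nhds
  fin_cases c
  · refine isTransformedBy_cuspGen_of_expansion (c := 0) (F := fun Q => 9 * expS Q)
      (W := fun Q => 9 * deriv expS Q) (m := 1) hpi odd_one (by simp [cuspWidth])
      (fun u hu => hauptS_mob_zero hu) (analyticAt_const.mul analyticAt_expS_zero.deriv)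
      (by simp [deriv_expS_zero]) ?_
    filter_upwards [hS] with Q h
    simpa using h.const_mul 9
  · refine isTransformedBy_cuspGen_of_expansion (c := 1) (F := fun Q => (expS Q)⁻¹)
      (W := fun Q => -deriv expS Q / expS Q ^ 2) (m := 1) (by positivity) odd_one
      (by simp [cuspWidth]; ring) (fun u hu => hauptS_mob_one hu)
      (analyticAt_expS_zero.deriv.neg.div (analyticAt_expS_zero.pow 2) (by simp [expS_zero]))
      (by simp [deriv_expS_zero, expS_zero]) ?_
    filter_upwards [hS, hSne] with Q h h0
    simpa using h.fun_inv h0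
  · refine isTransformedBy_cuspGen_of_expansion (c := 2) (F := fun Q => (expR Q)⁻¹)
      (W := fun Q => -deriv expR Q / phi2 Q ^ 8) (m := -1) (by positivity) (by decide)
      (by simp [cuspWidth]; ring) (fun u hu => hauptS_mob_two hu)
      (analyticAt_expR_zero.deriv.neg.div (analyticAt_phi2.pow 8) (by simp [phi2_zero]))
      (by simp [deriv_expR_zero, phi2_zero]) ?_
    filter_upwards [hR, hpne, self_mem_nhdsWithin] with Q h h0 hQ
    have hQ : Q ≠ 0 := hQ
    refine (h.fun_inv (mul_ne_zero hQ (pow_ne_zero 4 h0))).congr_deriv ?_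
    rw [show expR Q = Q * phi2 Q ^ 4 from rfl, show (-1 - 1 : ℤ) = -((2 : ℕ) : ℤ) by norm_num,
      zpow_neg, zpow_natCast]
    field_simp
  · refine isTransformedBy_cuspGen_of_expansion (c := 3) (F := fun Q => 9 * expR Q)
      (W := fun Q => 9 * deriv expR Q) (m := 1) (by positivity) odd_one (by simp [cuspWidth])
      (fun u hu => hauptS_mob_three hu) (analyticAt_const.mul analyticAt_expR_zero.deriv)
      (by simp [deriv_expR_zero]) ?_
    filter_upwards [hR] with Q h
    simpa using h.const_mul 9

/-! ### Loops around the singularities -/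

/-- A path in the upper half plane that an analytic coordinate maps to a small clockwise circle. -/
lemma exists_circle_lift {A : ℂ → ℂ} (hA : AnalyticAt ℂ A 0) (h0 : A 0 = 0) (h1 : deriv A 0 ≠ 0)
    {κ r : ℝ} (hκ : 0 < κ) (hr : 0 < r) : ∃ ζ : ℂ, ζ ≠ 0 ∧ ‖ζ‖ < r ∧ ∃ u : unitInterval → ℂ,
      Continuous u ∧ (∀ t, 0 < (u t).im) ∧
      (∀ t, A (Complex.exp (κ * Complex.I * u t)) =
        ζ * Complex.exp (-(2 * Real.pi * Complex.I) * (t : ℝ))) ∧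
      u 1 = u 0 - (2 * Real.pi / κ : ℝ) := by
  obtain ⟨B, hB, hB0, hB1, hAB⟩ : ∃ B : ℂ → ℂ, AnalyticAt ℂ B 0 ∧ B 0 = 0 ∧ deriv B 0 ≠ 0 ∧
      ∀ᶠ ζ in 𝓝 0, A (B ζ) = ζ := by
    have hB := hA.analyticAt_localInverse h1
    have hl := hA.hasStrictDerivAt.eventually_left_inverse h1
    have hr := hA.hasStrictDerivAt.eventually_right_inverse h1
    rw [h0] at hB hr
    refine ⟨_, hB, ?_, ?_, hr⟩
    · have := hl.self_of_nhds
      rwa [h0] at this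
    · have := (hA.hasStrictDerivAt.to_localInverse h1).hasDerivAt.deriv
      rw [h0] at this
      rw [this]
      exact inv_ne_zero h1
  set V := dslope B 0 with hV
  have hBV : ∀ ζ, B ζ = ζ * V ζ := fun ζ => by
    have := sub_eq_mul_dslope B ζ
    rwa [hB0, sub_zero] at this
  have hV0 : V 0 ≠ 0 := by rwa [hV, dslope_same]
  have hVc : ∀ᶠ ζ in 𝓝 (0 : ℂ), ContinuousAt V ζ := by
    filter_upwards [hB.eventually_analyticAt] with ζ h
    rcases eq_or_ne ζ 0 with rfl | hne
    · exact continuousAt_dslope hB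
    · exact (continuousAt_dslope_of_ne hne).mpr h.continuousAt
  have hslit : ∀ᶠ ζ in 𝓝 (0 : ℂ), V ζ / V 0 ∈ Complex.slitPlane :=
    ((continuousAt_dslope hB).div_const _).eventually_mem
      (Complex.isOpen_slitPlane.mem_nhds (by
        change V 0 / V 0 ∈ _
        rw [div_self hV0]
        exact Complex.one_mem_slitPlane))
  have hsmall : ∀ᶠ ζ in 𝓝 (0 : ℂ), ‖B ζ‖ < 1 :=
    hB.continuousAt.norm.eventually_lt_const (by simp [hB0])
  obtain ⟨ρ, hρ, hball⟩ := Metric.eventually_nhds_iff_ball.mp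
    (hAB.and (hVc.and (hslit.and hsmall)))
  set x : ℝ := min ρ r / 2 with hx
  have hx0 : 0 < x := by positivity
  have hxρ : x < ρ := by have := min_le_left ρ r; rw [hx]; linarith
  have hxr : x < r := by have := min_le_right ρ r; rw [hx]; linarith
  let ζ : unitInterval → ℂ := fun t => x * Complex.exp (-(2 * Real.pi * Complex.I) * (t : ℝ))
  have hζc : Continuous ζ := by fun_prop
  have hζn : ∀ t, ‖ζ t‖ = x := fun t => by
    simp only [ζ]
    rw [norm_mul, Complex.norm_of_nonneg hx0.le, Complex.norm_exp]
    simp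
  have hζ : ∀ t, ζ t ∈ Metric.ball (0 : ℂ) ρ := fun t => by
    rw [mem_ball_zero_iff, hζn]; exact hxρ
  have hκ0 : (κ : ℂ) ≠ 0 := by exact_mod_cast hκ.ne'
  have hx0' : (x : ℂ) ≠ 0 := by exact_mod_cast hx0.ne'
  -- A continuous logarithm of the inverse B(ζ) = ζV(ζ) along the circle. The factor V(ζ)/V(0) stays
  -- in the slit plane and does not wind; the term −2πit records the winding of ζ and yields the
  -- translation by −2π/κ.
  let u : unitInterval → ℂ := fun t => (Complex.log (x * V 0) - 2 * Real.pi * Complex.I * (t : ℝ) +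
    Complex.log (V (ζ t) / V 0)) / (κ * Complex.I)
  have hexp : ∀ t, Complex.exp (κ * Complex.I * u t) = B (ζ t) := fun t => by
    simp only [u]
    have hs := Complex.slitPlane_ne_zero (hball _ (hζ t)).2.2.1
    rw [mul_div_cancel₀ _ (mul_ne_zero hκ0 Complex.I_ne_zero), Complex.exp_add, Complex.exp_log hs,
      sub_eq_add_neg, Complex.exp_add, Complex.exp_log (mul_ne_zero hx0' hV0), hBV]
    simp only [ζ, neg_mul]
    field_simp
  refine ⟨x, hx0', by rwa [Complex.norm_of_nonneg hx0.le], u, ?_, ?_, ?_, ?_⟩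
  · have h : Continuous fun t => Complex.log (V (ζ t) / V 0) := by
      refine continuous_iff_continuousAt.mpr fun t => ContinuousAt.clog ?_ (hball _ (hζ t)).2.2.1
      exact (ContinuousAt.comp (f := ζ) (g := V) (hball _ (hζ t)).2.1
        hζc.continuousAt).div_const _
    exact ((by fun_prop : Continuous fun t : unitInterval =>
      Complex.log (x * V 0) - 2 * Real.pi * Complex.I * (t : ℝ)).add h).div_const _
  · intro t
    have h := (hball _ (hζ t)).2.2.2
    rw [← hexp, norm_cexp_mul_I_mul, Real.exp_lt_one_iff] at h
    have : 0 < κ * (u t).im := by linarith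
    exact pos_of_mul_pos_right this hκ.le
  · intro t
    rw [hexp, (hball _ (hζ t)).1]
  · have hζ1 : ζ 1 = ζ 0 := by
      simp [ζ, Complex.exp_neg, Complex.exp_two_pi_mul_I]
    simp only [u, hζ1]
    push_cast
    field_simp
    simp
    ring

lemma trans_lift {X : Type*} [TopologicalSpace X] {f : X → ℂ} {x y z : X} {a b c : ℂ} {A : Path x y}
    {B : Path y z} {p : Path a b} {q : Path b c} (hA : ∀ t, f (A t) = p t)
    (hB : ∀ t, f (B t) = q t) (t : unitInterval) : f ((A.trans B) t) = (p.trans q) t := by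
  simp only [Path.trans_apply]
  split_ifs
  · exact hA _
  · exact hB _

/-- The lift of a lasso is the segment to τ, the lifted circle from τ to gτ, and the g-translate of
the segment backwards; the last piece lies over the return path because s is G_s-invariant. -/
lemma hasMonodromy_lasso {w₀ : ℝ} (h1 : 1 < w₀) (h9 : w₀ < 9) {e z : ℂ} {n : ℤ} {g : SL(2, ℤ)}
    (hg : g ∈ intHeunGroup) {τ : ℍ} (C : Path τ (g • τ)) (hC : ∀ t, hauptS (C t) = circlePath e z n t)
    {M : SL(2, ℝ)} (hM : IsTransformedBy g M) :
    ∃ γ : Path (w₀ : ℂ) w₀, IsLasso γ e z n ∧ HasMonodromy γ M := by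
  obtain ⟨τ₀, hw, hb⟩ := exists_base_point h1 h9
  have hτ : hauptS τ = e + z := by
    have := hC 0
    rwa [C.source, (circlePath e z n).source] at this
  let P : Path τ₀ τ := ⟨segmentPath τ₀ τ, segmentPath_zero _ _, segmentPath_one _ _⟩
  have e0 : hauptS (segmentPath τ₀ τ 0) = w₀ := by rw [segmentPath_zero, hw]
  have e1 : hauptS (segmentPath τ₀ τ 1) = e + z := by rw [segmentPath_one, hτ]
  let δ : Path (w₀ : ℂ) (e + z) := imagePath (segmentPath τ₀ τ) e0 e1
  have hP : ∀ t, hauptS (P t) = δ t := fun t => (imagePath_apply _ e0 e1 t).symm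
  let P' : Path (g • τ₀) (g • τ) := P.map (continuous_intSL_smul g)
  have hP' : ∀ t, hauptS (P'.symm t) = δ.symm t := fun t =>
    (hauptS_smul hg (P (unitInterval.symm t))).trans (hP (unitInterval.symm t))
  let Γ : Path τ₀ (g • τ₀) := (P.trans C).trans P'.symm
  have hΓ : ∀ t, hauptS (Γ t) = ((δ.trans (circlePath e z n)).trans δ.symm) t :=
    trans_lift (f := fun τ : ℍ => hauptS τ) (trans_lift (f := fun τ : ℍ => hauptS τ) hP hC) hP'
  exact ⟨_, ⟨δ, imagePath_mem _ e0 e1, rfl⟩,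
    hasMonodromy_of_lift hw hb (Γ := Γ.toContinuousMap) Γ.source hg Γ.target hΓ hM⟩

lemma exists_lasso {w₀ : ℝ} (h1 : 1 < w₀) (h9 : w₀ < 9) {c : Fin 4} {κ : ℝ} (hκ : 0 < κ)
    (hw : cuspWidth c * κ = 2 * Real.pi) {e z : ℂ} {n : ℤ} {u : unitInterval → ℂ}
    (hu : Continuous u) (hu0 : ∀ t, 0 < (u t).im) (hu1 : u 1 = u 0 - (2 * Real.pi / κ : ℝ))
    (hC : ∀ t, hauptS (mob (cuspMat c) (u t)) = circlePath e z n t) :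
    ∃ γ : Path (w₀ : ℂ) w₀, IsLasso γ e z n ∧ HasMonodromy γ (-toReal (cuspGen c)) := by
  have hw' : ((2 * Real.pi / κ : ℝ) : ℂ) = cuspWidth c := by
    rw [← hw, mul_div_cancel_right₀ _ hκ.ne']; simp
  have hcont : Continuous fun t => (⟨u t, hu0 t⟩ : ℍ) := by
    rw [UpperHalfPlane.isEmbedding_coe.continuous_iff]; exact hu
  let C : Path (cuspMat c • (⟨u 0, hu0 0⟩ : ℍ)) (cuspGen c • cuspMat c • (⟨u 0, hu0 0⟩ : ℍ)) :=
    { toFun := fun t => cuspMat c • (⟨u t, hu0 t⟩ : ℍ)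
      continuous_toFun := (continuous_intSL_smul _).comp hcont
      source' := rfl
      target' := by
        apply UpperHalfPlane.ext
        rw [← mul_smul, ← mob_coe, ← mob_coe, mob_cuspGen_mul_cuspMat]
        change mob _ (u 1) = mob _ (u 0 - _)
        rw [hu1, hw'] }
  refine hasMonodromy_lasso h1 h9 (cuspGen_mem c) C (fun t => ?_) (isTransformedBy_cuspGen c)
  rw [← hC t]
  change hauptS ↑(cuspMat c • (⟨u t, hu0 t⟩ : ℍ)) = _
  rw [← mob_coe]

lemma exists_lasso_finite {w₀ : ℝ} (h1 : 1 < w₀) (h9 : w₀ < 9) {c : Fin 4} {κ : ℝ} (hκ : 0 < κ)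
    (hw : cuspWidth c * κ = 2 * Real.pi) {F : ℂ → ℂ}
    (hF : ∀ u : ℂ, 0 < u.im → hauptS (mob (cuspMat c) u) = F (Complex.exp (κ * Complex.I * u)))
    (hFa : AnalyticAt ℂ F 0) (hF1 : deriv F 0 ≠ 0) : ∃ γ : Path (w₀ : ℂ) w₀,
      IsClockwiseLoopAround γ ((F 0 : ℂ) : OnePoint ℂ) ∧
        HasMonodromy γ (-toReal (cuspGen c)) := by
  obtain ⟨ζ, hζ0, hζ, u, hu, hu0, hA, hu1⟩ := exists_circle_lift (A := fun Q => F Q - F 0)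
    (hFa.sub analyticAt_const) (sub_self _) (by rwa [deriv_sub_const]) hκ one_pos
  obtain ⟨γ, h, hm⟩ := exists_lasso h1 h9 hκ hw (e := F 0) (z := ζ) (n := -1) hu hu0 hu1 fun t => by
    rw [hF _ (hu0 t), sub_eq_iff_eq_add'.mp (hA t)]
    simp [circlePath]
  exact ⟨γ, ⟨ζ, norm_pos_iff.mpr hζ0, hζ, h⟩, hm⟩

theorem exists_loop_nine {w₀ : ℝ} (h1 : 1 < w₀) (h9 : w₀ < 9) : ∃ γ : Path (w₀ : ℂ) w₀,
    IsClockwiseLoopAround γ ((9 : ℂ) : OnePoint ℂ) ∧ HasMonodromy γ (-T9) := by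
  have := exists_lasso_finite h1 h9 (c := 0) Real.pi_pos (by simp [cuspWidth])
    (F := fun Q => 9 * expS Q) (fun u hu => hauptS_mob_zero hu)
    (analyticAt_const.mul analyticAt_expS_zero)
    (by rw [deriv_const_mul _ analyticAt_expS_zero.differentiableAt, deriv_expS_zero]; norm_num)
  rwa [show cuspGen 0 = intT9 from rfl, toReal_intT9, expS_zero, mul_one] at this

lemma T9_mul_Tinf_mul_T0 : T9 * Tinf * T0 = T1 := by
  apply Subtype.ext
  change (!![1, -2; 0, 1] * !![4, -3; 3, -2] * !![4, -1; 9, -2] : Matrix (Fin 2) (Fin 2) ℝ) =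
    !![1, 0; -6, 1]
  norm_num [Matrix.mul_fin_two]

lemma toReal_cuspGen_one : toReal (cuspGen 1) = T1⁻¹ := by
  rw [show cuspGen 1 = (intT9 * intTinf * intT0)⁻¹ from rfl, map_inv, map_mul, map_mul, toReal_intT9,
    toReal_intTinf, toReal_intT0, T9_mul_Tinf_mul_T0]

theorem exists_loop_one {w₀ : ℝ} (h1 : 1 < w₀) (h9 : w₀ < 9) : ∃ γ : Path (w₀ : ℂ) w₀,
    IsClockwiseLoopAround γ ((1 : ℂ) : OnePoint ℂ) ∧ HasMonodromy γ (-T1⁻¹) := by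
  have hpi := Real.pi_pos
  have hne : expS 0 ≠ 0 := by rw [expS_zero]; exact one_ne_zero
  have := exists_lasso_finite h1 h9 (c := 1) (κ := Real.pi / 3) (by positivity)
    (by simp [cuspWidth]; ring) (F := fun Q => (expS Q)⁻¹) (fun u hu => hauptS_mob_one hu)
    (analyticAt_expS_zero.fun_inv hne)
    (by rw [(analyticAt_expS_zero.differentiableAt.hasDerivAt.fun_inv hne).deriv, deriv_expS_zero,
          expS_zero]; norm_num)
  rwa [toReal_cuspGen_one, expS_zero, inv_one] at this

theorem exists_loop_zero {w₀ : ℝ} (h1 : 1 < w₀) (h9 : w₀ < 9) : ∃ γ : Path (w₀ : ℂ) w₀,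
    IsClockwiseLoopAround γ ((0 : ℂ) : OnePoint ℂ) ∧ HasMonodromy γ (-T0) := by
  have hpi := Real.pi_pos
  have := exists_lasso_finite h1 h9 (c := 3) (κ := 2 * Real.pi) (by positivity)
    (by simp [cuspWidth]) (F := fun Q => 9 * expR Q) (fun u hu => hauptS_mob_three hu)
    (analyticAt_const.mul analyticAt_expR_zero)
    (by rw [deriv_const_mul _ analyticAt_expR_zero.differentiableAt, deriv_expR_zero]; norm_num)
  rwa [show cuspGen 3 = intT0 from rfl, toReal_intT0, expR_zero, mul_zero] at this

/-- At the cusp 1, s = 1/`expR`, so a clockwise circle about `expR` = 0 becomes a counterclockwise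
one in s. Taking its radius below 1/9 puts 0, 1 and 9 inside the circle in s. -/
theorem exists_loop_infty {w₀ : ℝ} (h1 : 1 < w₀) (h9 : w₀ < 9) : ∃ γ : Path (w₀ : ℂ) w₀,
    IsClockwiseLoopAround γ OnePoint.infty ∧ HasMonodromy γ (-Tinf) := by
  have hpi := Real.pi_pos
  have hκ : 0 < 2 * Real.pi / 3 := by positivity
  obtain ⟨ζ, hζ0, hζ, u, hu, hu0, hA, hu1⟩ := exists_circle_lift analyticAt_expR_zero expR_zero
    (by rw [deriv_expR_zero]; exact one_ne_zero) hκ (by norm_num : (0 : ℝ) < 1 / 9)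
  obtain ⟨γ, h, hm⟩ := exists_lasso h1 h9 (c := 2) hκ (by simp [cuspWidth]; ring) (e := 0) (z := ζ⁻¹)
    (n := 1) hu hu0 hu1 fun t => by
      rw [hauptS_mob_two (hu0 t), hA t, mul_inv, ← Complex.exp_neg]
      simp [circlePath]
  rw [show cuspGen 2 = intTinf from rfl, toReal_intTinf] at hm
  refine ⟨γ, ⟨ζ⁻¹, ?_, h⟩, hm⟩
  rw [norm_inv, lt_inv_comm₀ (by norm_num) (norm_pos_iff.mpr hζ0)]
  linarith

end

noncomputable section

/-! ### The values at the cusps -/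

/-- If M sends ∞ to x and has lower left entry c, then Im(M⁻¹τ) = Im τ/(c²|τ−x|²). Horoballs at x
therefore pull back to half planes Im > const. -/
lemma hasCuspValue_of_tendsto {M : SL(2, ℤ)} {x : ℝ} {e : OnePoint ℂ} (hc : M 1 0 ≠ 0)
    (hx : (M 1 0 : ℝ) * x = M 0 0)
    (h : Tendsto (fun u : ℍ => (hauptS ↑(M • u) : OnePoint ℂ)) atImInfty (𝓝 e)) :
    HasCuspValue ((x : ℝ) : OnePoint ℝ) e := by
  have hc' : (M 1 0 : ℝ) ≠ 0 := by exact_mod_cast hc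
  have key : ∀ τ : ℍ, (M⁻¹ • τ).im = ((M 1 0 : ℝ) ^ 2)⁻¹ * (τ.im / ‖(τ : ℂ) - x‖ ^ 2) := by
    intro τ
    have hd : denom (M⁻¹ : SL(2, ℤ)) τ = -(M 1 0 : ℂ) * ((τ : ℂ) - x) := by
      have hxc : (M 1 0 : ℂ) * x = M 0 0 := by exact_mod_cast hx
      rw [ModularGroup.denom_apply, Matrix.SpecialLinearGroup.SL2_inv_expl]
      simp
      linear_combination -hxc
    rw [ModularGroup.im_smul_eq_div_normSq, hd, Complex.normSq_eq_norm_sq, norm_mul, norm_neg,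
      mul_pow, ← Complex.ofReal_intCast, Complex.norm_real, Real.norm_eq_abs, sq_abs]
    field_simp
  have hlim : Tendsto (fun τ : ℍ => M⁻¹ • τ) (cuspFilter ((x : ℝ) : OnePoint ℝ)) atImInfty := by
    rw [atImInfty, tendsto_comap_iff]
    change Tendsto (fun τ : ℍ => (M⁻¹ • τ).im) _ _
    simp only [key]
    exact Tendsto.const_mul_atTop (by positivity) tendsto_comap
  refine (h.comp hlim).congr fun τ => ?_
  simp only [Function.comp_apply, smul_inv_smul]

lemma hasCuspValue_infty : HasCuspValue OnePoint.infty ((9 : ℂ) : OnePoint ℂ) := by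
  have := tendsto_hauptS_cusp 0
  simp only [cuspMat_zero_smul] at this
  exact this

lemma hasCuspValue_zero : HasCuspValue ((0 : ℝ) : OnePoint ℝ) ((1 : ℂ) : OnePoint ℂ) :=
  hasCuspValue_of_tendsto (M := cuspMat 1) (by decide) (by simp [cuspMat, ModularGroup.S])
    (tendsto_hauptS_cusp 1)

lemma hasCuspValue_one : HasCuspValue ((1 : ℝ) : OnePoint ℝ) OnePoint.infty :=
  hasCuspValue_of_tendsto (M := cuspMat 2) (by decide) (by simp [cuspMat])
    (tendsto_hauptS_cusp 2)

lemma hasCuspValue_third : HasCuspValue ((1 / 3 : ℝ) : OnePoint ℝ) ((0 : ℂ) : OnePoint ℂ) :=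
  hasCuspValue_of_tendsto (M := cuspMat 3) (by decide) (by simp [cuspMat])
    (tendsto_hauptS_cusp 3)

lemma tendsto_hauptS_mul_cusp {g : SL(2, ℤ)} (hg : g ∈ intHeunGroup) (c : Fin 4) :
    Tendsto (fun u : ℍ => (hauptS ↑((g * cuspMat c) • u) : OnePoint ℂ)) atImInfty
      (𝓝 (cuspValue c)) := by
  simp only [mul_smul, hauptS_smul hg]
  exact tendsto_hauptS_cusp c

/-- The cusp 1/2 is the image of 0 under T₍₀₎ and inherits its value; likewise 2 is the image of 0
under the inverse of T₍₉₎. -/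
lemma hasCuspValue_half : HasCuspValue ((1 / 2 : ℝ) : OnePoint ℝ) ((1 : ℂ) : OnePoint ℂ) := by
  have h : (intT0 * cuspMat 1) 1 0 = -2 ∧ (intT0 * cuspMat 1) 0 0 = -1 := by decide
  exact hasCuspValue_of_tendsto (by rw [h.1]; decide) (by rw [h.1, h.2]; norm_num)
    (tendsto_hauptS_mul_cusp intT0_mem 1)

lemma hasCuspValue_two : HasCuspValue ((2 : ℝ) : OnePoint ℝ) ((1 : ℂ) : OnePoint ℂ) := by
  have h : (intT9⁻¹ * cuspMat 1) 1 0 = 1 ∧ (intT9⁻¹ * cuspMat 1) 0 0 = 2 := by decide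
  exact hasCuspValue_of_tendsto (by rw [h.1]; decide) (by rw [h.1, h.2]; norm_num)
    (tendsto_hauptS_mul_cusp (inv_mem intT9_mem) 1)

lemma cuspAct_coe (g : SL(2, ℝ)) (x : ℝ) : cuspAct g (x : OnePoint ℝ) =
    if g 1 0 * x + g 1 1 = 0 then OnePoint.infty else
      (((g 0 0 * x + g 0 1) / (g 1 0 * x + g 1 1) : ℝ) : OnePoint ℝ) :=
  OnePoint.smul_some_eq_ite

lemma cuspAct_eq {g : SL(2, ℝ)} {x y : ℝ} (h0 : g 1 0 * x + g 1 1 ≠ 0)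
    (h : (g 0 0 * x + g 0 1) / (g 1 0 * x + g 1 1) = y) :
    cuspAct g (x : OnePoint ℝ) = (y : OnePoint ℝ) := by
  rw [cuspAct_coe, if_neg h0, h]

lemma isParabolic_of_trace {g : SL(2, ℝ)} (ht : g 0 0 + g 1 1 = 2)
    (h : g 0 1 ≠ 0 ∨ g 1 0 ≠ 0) : (g : Matrix (Fin 2) (Fin 2) ℝ).IsParabolic := by
  refine ⟨?_, ?_⟩
  · rintro ⟨a, ha⟩
    have h1 : g 0 1 = 0 := by rw [← ha]; simp
    have h2 : g 1 0 = 0 := by rw [← ha]; simp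
    exact h.elim (fun h => h h1) fun h => h h2
  · rw [Matrix.discr_fin_two, g.det_coe, Matrix.trace_fin_two, ht]
    norm_num

lemma isParabolicFixing_T0 : IsParabolicFixing T0 ((1 / 3 : ℝ) : OnePoint ℝ) :=
  ⟨isParabolic_of_trace (by simp [T0]; norm_num) (by simp [T0]),
    cuspAct_eq (by simp [T0]; norm_num) (by simp [T0]; norm_num)⟩

lemma isParabolicFixing_Tinf : IsParabolicFixing Tinf ((1 : ℝ) : OnePoint ℝ) :=
  ⟨isParabolic_of_trace (by simp [Tinf]; norm_num) (by simp [Tinf]),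
    cuspAct_eq (by simp [Tinf]; norm_num) (by simp [Tinf]; norm_num)⟩

lemma isParabolicFixing_T9 : IsParabolicFixing T9 OnePoint.infty :=
  ⟨isParabolic_of_trace (by simp [T9]; norm_num) (by simp [T9]),
    OnePoint.smul_infty_eq_self_iff.mpr (by change T9 1 0 = 0; simp [T9])⟩

lemma isParabolicFixing_T1 : IsParabolicFixing T1 ((0 : ℝ) : OnePoint ℝ) :=
  ⟨isParabolic_of_trace (by simp [T1]; norm_num) (by simp [T1]),
    cuspAct_eq (by simp [T1]) (by simp [T1])⟩

lemma cuspAct_T0 : cuspAct T0 ((0 : ℝ) : OnePoint ℝ) = ((1 / 2 : ℝ) : OnePoint ℝ) :=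
  cuspAct_eq (by simp [T0]) (by simp [T0])

lemma cuspAct_Tinf : cuspAct Tinf ((1 / 2 : ℝ) : OnePoint ℝ) = ((2 : ℝ) : OnePoint ℝ) :=
  cuspAct_eq (by simp [Tinf]; norm_num) (by simp [Tinf]; norm_num)

lemma cuspAct_T9 : cuspAct T9 ((2 : ℝ) : OnePoint ℝ) = ((0 : ℝ) : OnePoint ℝ) :=
  cuspAct_eq (by simp [T9]) (by simp [T9])

end
theorem theorem9 :
    -- the formulas for `s`, none of whose denominators vanishes
    (∀ τ : ℍ, theta3 0 τ ≠ 0 ∧ theta2 (1 / 6) τ ≠ 0 ∧ theta4 (1 / 6) τ ≠ 0 ∧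
      theta2 (1 / 3) τ ≠ 0 ∧ theta4 (1 / 3) τ ≠ 0 ∧
      hauptS τ = hauptZ τ ^ 2 ∧
      hauptS τ = theta1 (1 / 3) τ ^ 4 * theta3 (1 / 3) τ ^ 4 /
        (theta2 (1 / 3) τ ^ 4 * theta4 (1 / 3) τ ^ 4)) ∧
    -- `s` inverts the (multivalued) ratio of the two solutions of the Heun equation
    (∀ w₀ : ℝ, 1 < w₀ → w₀ < 9 →
      (∀ i, IsHeunSolutionAt (fun s => heunBasis s i) w₀) ∧
      (∀ (b : ℂ) (γ : Path (w₀ : ℂ) b), (∀ t, γ t ∈ heunDomain) →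
        (∃ F, ContinuesBasis γ F) ∧
        ∀ F, ContinuesBasis γ F →
          (∀ i, IsHeunSolutionAt (fun s => F 1 s i) b) ∧
          ∀ᶠ s in 𝓝 b, F 1 s 1 ≠ 0 ∧ ∃ τ : ℍ, (τ : ℂ) = F 1 s 0 / F 1 s 1 ∧ hauptS τ = s) ∧
      (∀ τ : ℍ, ∃ γ : Path (w₀ : ℂ) (hauptS τ), (∀ t, γ t ∈ heunDomain) ∧
        ∃ F, ContinuesBasis γ F ∧ F 1 (hauptS τ) 0 / F 1 (hauptS τ) 1 = τ)) ∧
    -- the monodromy representation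
    (∀ w₀ : ℝ, 1 < w₀ → w₀ < 9 →
      (∀ γ : Path (w₀ : ℂ) w₀, (∀ t, γ t ∈ heunDomain) →
        ∃ g ∈ heunGroup, HasMonodromy γ g ∨ HasMonodromy γ (-g)) ∧
      (∀ g ∈ heunGroup, ∃ γ : Path (w₀ : ℂ) w₀, (∀ t, γ t ∈ heunDomain) ∧
        (HasMonodromy γ g ∨ HasMonodromy γ (-g))) ∧
      (∃ γ : Path (w₀ : ℂ) w₀, IsClockwiseLoopAround γ ((0 : ℂ) : OnePoint ℂ) ∧
        HasMonodromy γ (-T0)) ∧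
      (∃ γ : Path (w₀ : ℂ) w₀, IsClockwiseLoopAround γ OnePoint.infty ∧
        HasMonodromy γ (-Tinf)) ∧
      (∃ γ : Path (w₀ : ℂ) w₀, IsClockwiseLoopAround γ ((9 : ℂ) : OnePoint ℂ) ∧
        HasMonodromy γ (-T9)) ∧
      (∃ γ : Path (w₀ : ℂ) w₀, IsClockwiseLoopAround γ ((1 : ℂ) : OnePoint ℂ) ∧
        HasMonodromy γ (-T1⁻¹))) ∧
    -- the automorphism group
    (∀ g : SL(2, ℝ), (∀ τ : ℍ, hauptS ↑(g • τ) = hauptS τ) ↔ g ∈ heunGroup ∨ -g ∈ heunGroup) ∧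
    -- the fixed points of the generators and the values of `s` there
    (IsParabolicFixing T0 ((1 / 3 : ℝ) : OnePoint ℝ) ∧
      HasCuspValue ((1 / 3 : ℝ) : OnePoint ℝ) ((0 : ℂ) : OnePoint ℂ)) ∧
    (IsParabolicFixing Tinf ((1 : ℝ) : OnePoint ℝ) ∧
      HasCuspValue ((1 : ℝ) : OnePoint ℝ) OnePoint.infty) ∧
    (IsParabolicFixing T9 OnePoint.infty ∧
      HasCuspValue OnePoint.infty ((9 : ℂ) : OnePoint ℂ)) ∧
    -- the fourth point and its cycle of cusps
    (HasCuspValue ((0 : ℝ) : OnePoint ℝ) ((1 : ℂ) : OnePoint ℂ) ∧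
      HasCuspValue ((1 / 2 : ℝ) : OnePoint ℝ) ((1 : ℂ) : OnePoint ℂ) ∧
      HasCuspValue ((2 : ℝ) : OnePoint ℝ) ((1 : ℂ) : OnePoint ℂ)) ∧
    (cuspAct T0 ((0 : ℝ) : OnePoint ℝ) = ((1 / 2 : ℝ) : OnePoint ℝ) ∧
      cuspAct Tinf ((1 / 2 : ℝ) : OnePoint ℝ) = ((2 : ℝ) : OnePoint ℝ) ∧
      cuspAct T9 ((2 : ℝ) : OnePoint ℝ) = ((0 : ℝ) : OnePoint ℝ)) ∧
    (T9 * Tinf * T0 = T1 ∧ IsParabolicFixing T1 ((0 : ℝ) : OnePoint ℝ)) := by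
  refine ⟨fun τ => ?_, fun w₀ h1 h9 => inversion h1 h9, fun w₀ h1 h9 => ⟨monodromy_mem h1 h9,
    fun g hg => exists_monodromy h1 h9 hg, exists_loop_zero h1 h9, exists_loop_infty h1 h9,
    exists_loop_nine h1 h9, exists_loop_one h1 h9⟩, automorphism_iff,
    ⟨isParabolicFixing_T0, hasCuspValue_third⟩, ⟨isParabolicFixing_Tinf, hasCuspValue_one⟩,
    ⟨isParabolicFixing_T9, hasCuspValue_infty⟩,
    ⟨hasCuspValue_zero, hasCuspValue_half, hasCuspValue_two⟩,
    ⟨cuspAct_T0, cuspAct_Tinf, cuspAct_T9⟩, T9_mul_Tinf_mul_T0, isParabolicFixing_T1⟩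
  have hτ := τ.im_pos
  obtain ⟨n1, n2, n3, n4⟩ := theta_third_ne_zero hτ
  obtain ⟨-, s2, s4⟩ := theta_sixth τ
  exact ⟨theta3_ne_zero hτ, s2 ▸ n1, s4 ▸ n3, n2, n4, hauptS_eq_hauptZ_sq hτ, hauptS_eq_third hτ⟩
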